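/- Let $\Bbbk$ be an algebraically closed field with $\mathrm{char}(\Bbbk)\neq 2$, let $A$ be a finite dimensional (associative, unital) $\Bbbk$-algebra, and let $\iota:A\to A$ be a $\Bbbk$-algebra automorphism with $\iota^2=\mathrm{id}_A$. For an $A$-$A$-bimodule $M$ (on which $\Bbbk$ acts centrally) let ${}^{\iota}M^{\iota}$ be the same space with both actions twisted by $\iota$. Let $\mathcal Q=\mathrm{add}(A\oplus (A\otimes_{\Bbbk}A))$ be the category of all $A$-$A$-bimodules that are direct summands of finite direct sums of copies of $A\oplus (A\otimes_{\Bbbk}A)$. Let $\hat{\mathcal Q}$ be the category whose objects are the pairs $(M,\alpha)$, where $M\in\mathcal Q$ and $\alpha:M\to{}^{\iota}M^{\iota}$ is an isomorphism of bimodules with $\alpha^2=\mathrm{id}_M$, and whose morphisms $(M,\alpha)\to(N,\beta)$ are the bimodule homomorphisms $\varphi:M\to N$ with $\varphi\alpha=\beta\varphi$. It is a tensor category with $(M,\alpha)\otimes(N,\beta)=(M\otimes_A N,\alpha\otimes\beta)$ and unit object $(A,\iota)$. Let $\mathscr{C}_{(A,\iota)}$ be the strictification of $\hat{\mathcal Q}$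 (1-morphisms are finite words in the objects of $\hat{\mathcal Q}$, 2-morphisms are the morphisms in $\hat{\mathcal Q}$ between the tensor products of the words, composition of 1-morphisms is concatenation, with $F\circ G$ corresponding to $F\otimes G$), regarded as a 2-category with one object. A ($\Bbbk$-linear) 2-category is called *finitary* if it has finitely many objects, if each category $\mathscr C(\mathtt i,\mathtt j)$ is additive, idempotent split, Krull-Schmidt and $\Bbbk$-linear with finitely many isomorphism classes of indecomposable objects and finite dimensional morphism spaces, and if horizontal composition is $\Bbbk$-bilinear on 2-morphisms. A finitary 2-category is called *weakly fiat* if it has a weak $\Bbbk$-linear anti-autoequivalence $\star$ (the identity on objects, reversing the directions of both 1-morphisms and 2-morphisms; not necessarily involutive) such that for each 1-morphism $F:\mathtt i\to\mathtt j$ there are 2-morphisms $F\circ F^{\star}\to \mathbb 1_{\mathtt j}$ and $\mathbb 1_{\mathtt i}\to F^{\star}\circ F$ that satisfy the axioms of adjoint functors. Then the 2-category $\mathscr{C}_{(A,\iota)}$ is finitary. If $A$ is connected (that is, $A\neq 0$ and the only central idempotents of $A$ are $0$ and $1$), then moreover its identity 1-morphism is indecomposable. If $A$ is self-injective (injective as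 a left module over itself), then $\mathscr{C}_{(A,\iota)}$ is weakly fiat. -/

import Mathlib

open CategoryTheory

universe u v w

noncomputable section

/-- An `A`-`A`-bimodule over `k` (with `k` acting centrally), i.e. a `k`-vector space with commuting
`k`-linear left and right actions of the `k`-algebra `A`. -/
structure Bimodule (k : Type u) (A : Type v) [Field k] [Ring A] [Algebra k A] where
  carrier : Type v
  [addCommGroup : AddCommGroup carrier]
  [module : Module k carrier]
  left : A →ₐ[k] Module.End k carrier
  right : Aᵐᵒᵖ →ₐ[k] Module.End k carrier
  left_right : ∀ (a : A) (b : Aᵐᵒᵖ) (m : carrier), left a (right b m) = right b (left a m)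

namespace Bimodule

variable {k : Type u} {A : Type v} [Field k] [Ring A] [Algebra k A]

attribute [instance] Bimodule.addCommGroup Bimodule.module

/-- The space of homomorphisms of bimodules, as a subspace of the space of linear maps. -/
def homs (M N : Bimodule k A) : Submodule k (M.carrier →ₗ[k] N.carrier) where
  carrier := {f | (∀ a m, f (M.left a m) = N.left a (f m)) ∧
    ∀ b m, f (M.right b m) = N.right b (f m)}
  add_mem' {f g} hf hg :=
    ⟨fun a m => by simp [hf.1, hg.1], fun b m => by simp [hf.2, hg.2]⟩
  zero_mem' := ⟨fun a m => by simp, fun b m => by simp⟩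
  smul_mem' c f hf := ⟨fun a m => by simp [hf.1], fun b m => by simp [hf.2]⟩

/-- Bimodules and their homomorphisms form a category. -/
instance category : Category (Bimodule k A) where
  Hom M N := homs M N
  id M := ⟨LinearMap.id, fun _ _ => rfl, fun _ _ => rfl⟩
  comp {M N P} f g := ⟨g.1 ∘ₗ f.1,
    fun a m => by
      rw [LinearMap.comp_apply, f.2.1, g.2.1]; rfl,
    fun b m => by
      rw [LinearMap.comp_apply, f.2.2, g.2.2]; rfl⟩

/-- The linear map underlying a homomorphism of bimodules. -/
def toLin {M N : Bimodule k A} (f : M ⟶ N) : M.carrier →ₗ[k] N.carrier := f.1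

/-- A homomorphism of bimodules from a linear map that commutes with both actions. -/
def ofLin {M N : Bimodule k A} (f : M.carrier →ₗ[k] N.carrier)
    (hl : ∀ a m, f (M.left a m) = N.left a (f m))
    (hr : ∀ b m, f (M.right b m) = N.right b (f m)) : M ⟶ N := ⟨f, hl, hr⟩

theorem toLin_injective {M N : Bimodule k A} {f g : M ⟶ N} (h : toLin f = toLin g) : f = g :=
  Subtype.ext h

@[simp] theorem toLin_ofLin {M N : Bimodule k A} (f : M.carrier →ₗ[k] N.carrier) (hl hr) :
    toLin (ofLin (M := M) (N := N) f hl hr) = f := rfl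

@[simp] theorem toLin_comp {M N P : Bimodule k A} (f : M ⟶ N) (g : N ⟶ P) :
    toLin (f ≫ g) = toLin g ∘ₗ toLin f := rfl

@[simp] theorem toLin_id (M : Bimodule k A) : toLin (𝟙 M) = LinearMap.id := rfl

theorem toLin_left {M N : Bimodule k A} (f : M ⟶ N) (a : A) (m : M.carrier) :
    toLin f (M.left a m) = N.left a (toLin f m) := f.2.1 a m

theorem toLin_right {M N : Bimodule k A} (f : M ⟶ N) (b : Aᵐᵒᵖ) (m : M.carrier) :
    toLin f (M.right b m) = N.right b (toLin f m) := f.2.2 b m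

/-! ### The tensor product over `A` -/

section Tensor

open scoped TensorProduct

/-- The subspace of `M ⊗[k] N` spanned by all `m a ⊗ n - m ⊗ a n`. -/
def balancing (M N : Bimodule k A) : Submodule k (M.carrier ⊗[k] N.carrier) :=
  Submodule.span k {x | ∃ (m : M.carrier) (a : A) (n : N.carrier),
    x = M.right (MulOpposite.op a) m ⊗ₜ[k] n - m ⊗ₜ[k] N.left a n}

/-- The action of `A` on `M ⊗_A N` through `M`. -/
def tensorLeft (M N : Bimodule k A) :
    A →ₐ[k] Module.End k ((M.carrier ⊗[k] N.carrier) ⧸ balancing M N) where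
  toFun a := (balancing M N).mapQ (balancing M N) ((M.left a).rTensor N.carrier) <| by
    rw [balancing, Submodule.span_le]
    rintro _ ⟨m, b, n, rfl⟩
    exact Submodule.subset_span ⟨M.left a m, b, n, by simp [M.left_right]⟩
  map_one' := by
    apply Submodule.linearMap_qext; ext m n; simp
  map_mul' a b := by
    apply Submodule.linearMap_qext; ext m n; simp
  map_zero' := by
    apply Submodule.linearMap_qext; ext m n; simp
  map_add' a b := by
    apply Submodule.linearMap_qext; ext m n; simp
  commutes' c := by
    apply Submodule.linearMap_qext; ext m n
    simp [Module.algebraMap_end_apply, ← TensorProduct.smul_tmul']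

/-- The action of `A` on `M ⊗_A N` through `N`. -/
def tensorRight (M N : Bimodule k A) :
    Aᵐᵒᵖ →ₐ[k] Module.End k ((M.carrier ⊗[k] N.carrier) ⧸ balancing M N) where
  toFun b := (balancing M N).mapQ (balancing M N) ((N.right b).lTensor M.carrier) <| by
    rw [balancing, Submodule.span_le]
    rintro _ ⟨m, a, n, rfl⟩
    exact Submodule.subset_span ⟨m, a, N.right b n, by simp [N.left_right]⟩
  map_one' := by
    apply Submodule.linearMap_qext; ext m n; simp
  map_mul' a b := by
    apply Submodule.linearMap_qext; ext m n; simp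
  map_zero' := by
    apply Submodule.linearMap_qext; ext m n; simp
  map_add' a b := by
    apply Submodule.linearMap_qext; ext m n; simp
  commutes' c := by
    have h : N.right (algebraMap k Aᵐᵒᵖ c) = algebraMap k (Module.End k N.carrier) c :=
      N.right.commutes c
    apply Submodule.linearMap_qext; ext m n
    simp only [h]
    simp [Module.algebraMap_end_apply]

/-- The bimodule `M ⊗_A N`, with `A` acting on the left through `M` and on the right
through `N`. -/
def tensor (M N : Bimodule k A) : Bimodule k A where
  carrier := (M.carrier ⊗[k] N.carrier) ⧸ balancing M N
  left := tensorLeft M N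
  right := tensorRight M N
  left_right a b x := by
    obtain ⟨x, rfl⟩ := Submodule.mkQ_surjective _ x
    induction x using TensorProduct.induction_on with
    | zero => simp
    | tmul m n => rfl
    | add x y hx hy => rw [map_add, map_add, map_add, hx, hy, map_add, map_add]

section tmul
variable {M N : Bimodule k A}

/-- The element `m ⊗ n` of `M ⊗_A N`. -/
def tmul (m : M.carrier) (n : N.carrier) : (tensor M N).carrier :=
  (balancing M N).mkQ (m ⊗ₜ[k] n)

@[simp] theorem tensor_left_tmul (a : A) (m : M.carrier) (n : N.carrier) :
    (tensor M N).left a (tmul m n) = tmul (M.left a m) n := rfl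

@[simp] theorem tensor_right_tmul (b : Aᵐᵒᵖ) (m : M.carrier) (n : N.carrier) :
    (tensor M N).right b (tmul m n) = tmul m (N.right b n) := rfl

theorem tmul_balanced (m : M.carrier) (a : A) (n : N.carrier) :
    tmul (M.right (MulOpposite.op a) m) n = tmul m (N.left a n) := by
  unfold tmul
  refine (Submodule.Quotient.eq _).2 (Submodule.subset_span ⟨m, a, n, rfl⟩)

theorem tmul_add (m : M.carrier) (n n' : N.carrier) :
    tmul m (n + n') = tmul m n + tmul m n' := by
  unfold tmul; rw [TensorProduct.tmul_add, map_add]; rfl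

theorem add_tmul (m m' : M.carrier) (n : N.carrier) :
    tmul (m + m') n = tmul m n + tmul m' n := by
  unfold tmul; rw [TensorProduct.add_tmul, map_add]; rfl

theorem smul_tmul (c : k) (m : M.carrier) (n : N.carrier) :
    tmul (c • m) n = c • tmul m n := by
  unfold tmul; rw [← TensorProduct.smul_tmul', map_smul]; rfl

theorem tmul_smul (c : k) (m : M.carrier) (n : N.carrier) :
    tmul m (c • n) = c • tmul m n := by
  unfold tmul; rw [TensorProduct.tmul_smul, map_smul]; rfl

/-- The linear map out of `M ⊗_A N` given by an `A`-balanced bilinear map. -/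
def lift {P : Type w} [AddCommGroup P] [Module k P] (f : M.carrier →ₗ[k] N.carrier →ₗ[k] P)
    (hf : ∀ m a n, f (M.right (MulOpposite.op a) m) n = f m (N.left a n)) :
    (tensor M N).carrier →ₗ[k] P :=
  (balancing M N).liftQ (TensorProduct.lift f) <| by
    rw [balancing, Submodule.span_le]
    rintro _ ⟨m, a, n, rfl⟩
    simp [hf]

@[simp] theorem lift_tmul {P : Type w} [AddCommGroup P] [Module k P]
    (f : M.carrier →ₗ[k] N.carrier →ₗ[k] P) (hf) (m : M.carrier) (n : N.carrier) :
    lift f hf (tmul m n) = f m n := rfl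

theorem tensor_ext {P : Type w} [AddCommGroup P] [Module k P]
    {f g : (tensor M N).carrier →ₗ[k] P} (h : ∀ m n, f (tmul m n) = g (tmul m n)) : f = g := by
  apply Submodule.linearMap_qext
  apply TensorProduct.ext'
  exact h

/-- The bilinear map `(m, n) ↦ m ⊗ n`. -/
def tmulₗ (M N : Bimodule k A) : M.carrier →ₗ[k] N.carrier →ₗ[k] (tensor M N).carrier :=
  LinearMap.mk₂ k tmul add_tmul smul_tmul tmul_add tmul_smul

@[simp] theorem tmulₗ_apply (m : M.carrier) (n : N.carrier) : tmulₗ M N m n = tmul m n := rfl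

/-- The map `m ⊗ n ↦ f m ⊗ g n`, for `f` and `g` for which this is balanced. -/
def mapTensor {M' N' : Bimodule k A} (f : M.carrier →ₗ[k] M'.carrier)
    (g : N.carrier →ₗ[k] N'.carrier)
    (h : ∀ m a n, tmul (f (M.right (MulOpposite.op a) m)) (g n) = tmul (f m) (g (N.left a n))) :
    (tensor M N).carrier →ₗ[k] (tensor M' N').carrier :=
  lift ((tmulₗ M' N').compl₁₂ f g) h

@[simp] theorem mapTensor_tmul {M' N' : Bimodule k A} (f : M.carrier →ₗ[k] M'.carrier)
    (g : N.carrier →ₗ[k] N'.carrier) (h) (m : M.carrier) (n : N.carrier) :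
    mapTensor f g h (tmul m n) = tmul (f m) (g n) := rfl

/-- A linear map out of `M ⊗_A N` is a bimodule homomorphism if it commutes with the actions on
the elements `m ⊗ n`. -/
def ofTensor {P : Bimodule k A} (f : (tensor M N).carrier →ₗ[k] P.carrier)
    (hl : ∀ a m n, f (tmul (M.left a m) n) = P.left a (f (tmul m n)))
    (hr : ∀ b m n, f (tmul m (N.right b n)) = P.right b (f (tmul m n))) : tensor M N ⟶ P :=
  ofLin f
    (fun a x => LinearMap.congr_fun (f := f ∘ₗ (tensor M N).left a) (g := P.left a ∘ₗ f)
      (tensor_ext fun m n => by simp [hl]) x)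
    (fun b x => LinearMap.congr_fun (f := f ∘ₗ (tensor M N).right b) (g := P.right b ∘ₗ f)
      (tensor_ext fun m n => by simp [hr]) x)

@[simp] theorem toLin_ofTensor {P : Bimodule k A} (f : (tensor M N).carrier →ₗ[k] P.carrier)
    (hl hr) : toLin (ofTensor f hl hr) = f := rfl

theorem hom_tensor_ext {P : Bimodule k A} {f g : tensor M N ⟶ P}
    (h : ∀ (m : M.carrier) (n : N.carrier), toLin f (tmul m n) = toLin g (tmul m n)) : f = g :=
  toLin_injective (tensor_ext h)

theorem hom_tensor_ext₃ {L P : Bimodule k A} {f g : tensor (tensor L M) N ⟶ P}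
    (h : ∀ (l : L.carrier) (m : M.carrier) (n : N.carrier),
      toLin f (tmul (tmul l m) n) = toLin g (tmul (tmul l m) n)) : f = g :=
  hom_tensor_ext fun x n => LinearMap.congr_fun (f := toLin f ∘ₗ (tmulₗ _ _).flip n)
    (g := toLin g ∘ₗ (tmulₗ _ _).flip n) (tensor_ext fun l m => h l m n) x

theorem hom_tensor_ext₃' {L P : Bimodule k A} {f g : tensor L (tensor M N) ⟶ P}
    (h : ∀ (l : L.carrier) (m : M.carrier) (n : N.carrier),
      toLin f (tmul l (tmul m n)) = toLin g (tmul l (tmul m n))) : f = g :=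
  hom_tensor_ext fun l x => LinearMap.congr_fun (f := toLin f ∘ₗ (tmulₗ _ _) l)
    (g := toLin g ∘ₗ (tmulₗ _ _) l) (tensor_ext fun m n => h l m n) x

theorem hom_tensor_ext₄ {K L P : Bimodule k A} {f g : tensor (tensor (tensor K L) M) N ⟶ P}
    (h : ∀ (j : K.carrier) (l : L.carrier) (m : M.carrier) (n : N.carrier),
      toLin f (tmul (tmul (tmul j l) m) n) = toLin g (tmul (tmul (tmul j l) m) n)) : f = g :=
  hom_tensor_ext₃ fun x m n => LinearMap.congr_fun
    (f := toLin f ∘ₗ (tmulₗ _ _).flip n ∘ₗ (tmulₗ _ _).flip m)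
    (g := toLin g ∘ₗ (tmulₗ _ _).flip n ∘ₗ (tmulₗ _ _).flip m)
    (tensor_ext fun j l => h j l m n) x

end tmul

/-- The tensor product of two homomorphisms. -/
def tensorMap {M M' N N' : Bimodule k A} (f : M ⟶ M') (g : N ⟶ N') : tensor M N ⟶ tensor M' N' :=
  ofTensor (mapTensor (toLin f) (toLin g) fun m a n => by
      rw [toLin_right, toLin_left, tmul_balanced])
    (fun a m n => by simp [toLin_left]) (fun b m n => by simp [toLin_right])

@[simp] theorem tensorMap_tmul {M M' N N' : Bimodule k A} (f : M ⟶ M') (g : N ⟶ N')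
    (m : M.carrier) (n : N.carrier) :
    toLin (tensorMap f g) (tmul m n) = tmul (toLin f m) (toLin g n) := rfl

/-- The associator `(m ⊗ n) ⊗ p ↦ m ⊗ (n ⊗ p)`. -/
def assocHom (M N P : Bimodule k A) : tensor (tensor M N) P ⟶ tensor M (tensor N P) :=
  let f : (tensor (tensor M N) P).carrier →ₗ[k] (tensor M (tensor N P)).carrier :=
    lift
      (lift (((LinearMap.llcomp k _ _ _).compl₁₂ (tmulₗ M (tensor N P)) (tmulₗ N P)))
        (fun m a n => LinearMap.ext fun p => by simp [tmul_balanced]))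
      (fun x a p => LinearMap.congr_fun (f := LinearMap.flip _ p ∘ₗ (tensor M N).right _)
        (g := LinearMap.flip _ _) (tensor_ext fun m n => by simp [tmul_balanced]) x)
  ofTensor f
    (fun a x p => LinearMap.congr_fun (f := f ∘ₗ (tmulₗ _ _).flip p ∘ₗ (tensor M N).left a)
      (g := (tensor M (tensor N P)).left a ∘ₗ f ∘ₗ (tmulₗ _ _).flip p)
      (tensor_ext fun m n => rfl) x)
    (fun b x p => LinearMap.congr_fun (f := f ∘ₗ (tmulₗ _ _).flip (P.right b p))
      (g := (tensor M (tensor N P)).right b ∘ₗ f ∘ₗ (tmulₗ _ _).flip p)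
      (tensor_ext fun m n => rfl) x)

@[simp] theorem assocHom_tmul (M N P : Bimodule k A) (m : M.carrier) (n : N.carrier)
    (p : P.carrier) : toLin (assocHom M N P) (tmul (tmul m n) p) = tmul m (tmul n p) := rfl

/-- The inverse associator `m ⊗ (n ⊗ p) ↦ (m ⊗ n) ⊗ p`. -/
def assocInv (M N P : Bimodule k A) : tensor M (tensor N P) ⟶ tensor (tensor M N) P :=
  let f : (tensor M (tensor N P)).carrier →ₗ[k] (tensor (tensor M N) P).carrier :=
    lift
      (lift
        (LinearMap.mk₂ k (fun n p => (tmulₗ (tensor M N) P).flip p ∘ₗ (tmulₗ M N).flip n)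
          (fun n n' p => LinearMap.ext fun m => by simp)
          (fun c n p => LinearMap.ext fun m => by simp)
          (fun n p p' => LinearMap.ext fun m => by simp)
          (fun c n p => LinearMap.ext fun m => by simp))
        (fun n a p => LinearMap.ext fun m => by simp [← tmul_balanced])).flip
      (fun m a x => LinearMap.congr_fun (f := LinearMap.flip _ _)
        (g := LinearMap.flip _ m ∘ₗ (tensor N P).left a)
        (tensor_ext fun n p => by simp [tmul_balanced]) x)
  ofTensor f
    (fun a m x => LinearMap.congr_fun (f := f ∘ₗ tmulₗ _ _ (M.left a m))
      (g := (tensor (tensor M N) P).left a ∘ₗ f ∘ₗ tmulₗ _ _ m)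
      (tensor_ext fun n p => rfl) x)
    (fun b m x => LinearMap.congr_fun (f := f ∘ₗ tmulₗ _ _ m ∘ₗ (tensor N P).right b)
      (g := (tensor (tensor M N) P).right b ∘ₗ f ∘ₗ tmulₗ _ _ m)
      (tensor_ext fun n p => rfl) x)

@[simp] theorem assocInv_tmul (M N P : Bimodule k A) (m : M.carrier) (n : N.carrier)
    (p : P.carrier) : toLin (assocInv M N P) (tmul m (tmul n p)) = tmul (tmul m n) p := rfl

variable (k A) in
/-- The regular bimodule `A`. -/
def regular : Bimodule k A where
  carrier := A
  left := Algebra.lmul k A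
  right :=
    { toFun := fun b => LinearMap.mulRight k b.unop
      map_one' := by ext; simp
      map_mul' := fun a b => by ext; simp [mul_assoc]
      map_zero' := by ext; simp
      map_add' := fun a b => by ext; simp [mul_add]
      commutes' := fun c => by
        ext x; simp [Module.algebraMap_end_apply, Algebra.smul_def, Algebra.commutes c x] }
  left_right a b m := (mul_assoc a m b.unop).symm

/-- An element of `A`, as an element of the regular bimodule. -/
def reg (a : A) : (regular k A).carrier := a

theorem regular_left (a x : A) : (regular k A).left a (reg x) = reg (a * x) := rfl

theorem regular_right (b : Aᵐᵒᵖ) (x : A) : (regular k A).right b (reg x) = reg (x * b.unop) := rfl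

/-- The left unitor `a ⊗ m ↦ a m`. -/
def lunitHom (M : Bimodule k A) : tensor (regular k A) M ⟶ M :=
  ofTensor (lift (M := regular k A) M.left.toLinearMap fun (x : A) a m => by
      change M.left (x * a) m = M.left x (M.left a m); simp)
    (fun a (x : A) m => by change M.left (a * x) m = M.left a (M.left x m); simp)
    (fun b (x : A) m => M.left_right x b m)

@[simp] theorem lunitHom_tmul (M : Bimodule k A) (x : A) (m : M.carrier) :
    toLin (lunitHom M) (tmul (reg x) m) = M.left x m := rfl

/-- The inverse left unitor `m ↦ 1 ⊗ m`. -/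
def lunitInv (M : Bimodule k A) : M ⟶ tensor (regular k A) M :=
  ofLin (tmulₗ (regular k A) M (reg 1))
    (fun a m => by
      change tmul _ _ = tmul (reg (a * 1)) m
      rw [← tmul_balanced, regular_right, mul_one]; simp)
    (fun b m => rfl)

@[simp] theorem lunitInv_apply (M : Bimodule k A) (m : M.carrier) :
    toLin (lunitInv M) m = tmul (reg 1) m := rfl

/-- The right unitor `m ⊗ a ↦ m a`. -/
def runitHom (M : Bimodule k A) : tensor M (regular k A) ⟶ M :=
  ofTensor (lift (N := regular k A)
      (M.right.toLinearMap ∘ₗ (MulOpposite.opLinearEquiv k).toLinearMap).flip fun m a (x : A) => by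
      change M.right (MulOpposite.op x) (M.right (MulOpposite.op a) m)
        = M.right (MulOpposite.op (a * x)) m
      simp)
    (fun a m (x : A) => (M.left_right a (MulOpposite.op x) m).symm)
    (fun b m (x : A) => by
      change M.right (MulOpposite.op (x * b.unop)) m = M.right b (M.right (MulOpposite.op x) m)
      simp)

@[simp] theorem runitHom_tmul (M : Bimodule k A) (m : M.carrier) (x : A) :
    toLin (runitHom M) (tmul m (reg x)) = M.right (MulOpposite.op x) m := rfl

/-- The inverse right unitor `m ↦ m ⊗ 1`. -/
def runitInv (M : Bimodule k A) : M ⟶ tensor M (regular k A) :=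
  ofLin ((tmulₗ M (regular k A)).flip (reg 1))
    (fun a m => rfl)
    (fun b m => by
      change tmul (M.right (MulOpposite.op b.unop) m) _ = tmul m (reg (1 * b.unop))
      rw [tmul_balanced, regular_left, mul_one, one_mul])

@[simp] theorem runitInv_apply (M : Bimodule k A) (m : M.carrier) :
    toLin (runitInv M) m = tmul m (reg 1) := rfl

/-- The tensor category of bimodules. -/
instance monoidalCategory : MonoidalCategory (Bimodule k A) where
  tensorObj := tensor
  tensorUnit := regular k A
  whiskerLeft M _ _ f := tensorMap (𝟙 M) f
  whiskerRight f N := tensorMap f (𝟙 N)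
  tensorHom := tensorMap
  associator M N P :=
    { hom := assocHom M N P
      inv := assocInv M N P
      hom_inv_id := hom_tensor_ext₃ fun m n p => rfl
      inv_hom_id := hom_tensor_ext₃' fun m n p => rfl }
  leftUnitor M :=
    { hom := lunitHom M
      inv := lunitInv M
      hom_inv_id := hom_tensor_ext fun (x : A) m => by
        change tmul (reg 1) (M.left x m) = tmul (reg x) m
        rw [← tmul_balanced, regular_right]; simp
      inv_hom_id := toLin_injective <| LinearMap.ext fun m => by
        change M.left 1 m = m
        simp }
  rightUnitor M :=
    { hom := runitHom M
      inv := runitInv M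
      hom_inv_id := hom_tensor_ext fun m (x : A) => by
        change tmul (M.right (MulOpposite.op x) m) (reg 1) = tmul m (reg x)
        rw [tmul_balanced, regular_left]; simp
      inv_hom_id := toLin_injective <| LinearMap.ext fun m => by
        change M.right 1 m = m
        simp }
  tensorHom_def f g := hom_tensor_ext fun m n => rfl
  id_tensorHom_id M N := hom_tensor_ext fun m n => rfl
  tensorHom_comp_tensorHom f f' g g' := hom_tensor_ext fun m n => rfl
  whiskerLeft_id M N := hom_tensor_ext fun m n => rfl
  id_whiskerRight M N := hom_tensor_ext fun m n => rfl
  associator_naturality f g h := hom_tensor_ext₃ fun l m n => rfl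
  leftUnitor_naturality f := hom_tensor_ext fun (x : A) m => (toLin_left f x m).symm
  rightUnitor_naturality f := hom_tensor_ext fun m (x : A) =>
    (toLin_right f (MulOpposite.op x) m).symm
  pentagon K L M N := hom_tensor_ext₄ fun j l m n => rfl
  triangle M N := hom_tensor_ext₃ fun m (x : A) n => (tmul_balanced m x n).symm

end Tensor

/-! ### The linear structure, direct sums, and the category `add (A ⊕ A ⊗ A)` -/

instance homAddCommGroup (M N : Bimodule k A) : AddCommGroup (M ⟶ N) :=
  inferInstanceAs (AddCommGroup (homs M N))

instance homModule (M N : Bimodule k A) : Module k (M ⟶ N) :=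
  inferInstanceAs (Module k (homs M N))

@[simp] theorem toLin_add {M N : Bimodule k A} (f g : M ⟶ N) :
    toLin (f + g) = toLin f + toLin g := rfl

@[simp] theorem toLin_smul {M N : Bimodule k A} (c : k) (f : M ⟶ N) :
    toLin (c • f) = c • toLin f := rfl

@[simp] theorem toLin_zero {M N : Bimodule k A} : toLin (0 : M ⟶ N) = 0 := rfl

instance preadditive : Preadditive (Bimodule k A) where
  add_comp _ _ _ f f' g := toLin_injective <| LinearMap.ext fun m => by simp
  comp_add _ _ _ f g g' := toLin_injective <| LinearMap.ext fun m => by simp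

instance linear : Linear k (Bimodule k A) where
  smul_comp _ _ _ c f g := toLin_injective <| LinearMap.ext fun m => by simp
  comp_smul _ _ _ f c g := toLin_injective <| LinearMap.ext fun m => by simp

/-- The direct sum of two bimodules. -/
def prod (M N : Bimodule k A) : Bimodule k A where
  carrier := M.carrier × N.carrier
  left :=
    { toFun := fun a => (M.left a).prodMap (N.left a)
      map_one' := by ext <;> simp
      map_mul' := fun a b => by ext <;> simp
      map_zero' := by ext <;> simp
      map_add' := fun a b => by ext <;> simp
      commutes' := fun c => by ext <;> simp [Module.algebraMap_end_apply] }
  right :=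
    { toFun := fun b => (M.right b).prodMap (N.right b)
      map_one' := by ext <;> simp
      map_mul' := fun a b => by ext <;> simp
      map_zero' := by ext <;> simp
      map_add' := fun a b => by ext <;> simp
      commutes' := fun c => by
        rw [AlgHom.commutes, AlgHom.commutes]
        ext <;> simp [Module.algebraMap_end_apply] }
  left_right a b m := Prod.ext (M.left_right a b m.1) (N.left_right a b m.2)

/-- The direct sum of `n` copies of a bimodule. -/
def power (M : Bimodule k A) (n : ℕ) : Bimodule k A where
  carrier := Fin n → M.carrier
  left :=
    { toFun := fun a => LinearMap.pi fun i => M.left a ∘ₗ LinearMap.proj i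
      map_one' := LinearMap.ext fun x => funext fun i => by simp
      map_mul' := fun a b => LinearMap.ext fun x => funext fun i => by simp
      map_zero' := LinearMap.ext fun x => funext fun i => by simp
      map_add' := fun a b => LinearMap.ext fun x => funext fun i => by simp
      commutes' := fun c => LinearMap.ext fun x => funext fun i => by
        simp [Module.algebraMap_end_apply] }
  right :=
    { toFun := fun b => LinearMap.pi fun i => M.right b ∘ₗ LinearMap.proj i
      map_one' := LinearMap.ext fun x => funext fun i => by simp
      map_mul' := fun a b => LinearMap.ext fun x => funext fun i => by simp
      map_zero' := LinearMap.ext fun x => funext fun i => by simp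
      map_add' := fun a b => LinearMap.ext fun x => funext fun i => by simp
      commutes' := fun c => LinearMap.ext fun x => funext fun i => by
        rw [AlgHom.commutes]
        simp [Module.algebraMap_end_apply] }
  left_right a b m := funext fun i => M.left_right a b (m i)

section
open scoped TensorProduct

variable (k A) in
/-- The bimodule `A ⊗ A` (tensor product over `k`), with `a (x ⊗ y) b = a x ⊗ y b`. -/
def free : Bimodule k A where
  carrier := A ⊗[k] A
  left :=
    { toFun := fun a => (LinearMap.mulLeft k a).rTensor A
      map_one' := TensorProduct.ext' fun x y => by simp
      map_mul' := fun a b => TensorProduct.ext' fun x y => by simp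
      map_zero' := TensorProduct.ext' fun x y => by simp
      map_add' := fun a b => TensorProduct.ext' fun x y => by
        simp [add_mul, TensorProduct.add_tmul]
      commutes' := fun c => TensorProduct.ext' fun x y => by
        simp [Module.algebraMap_end_apply, TensorProduct.smul_tmul', ← Algebra.smul_def] }
  right :=
    { toFun := fun b => (LinearMap.mulRight k b.unop).lTensor A
      map_one' := TensorProduct.ext' fun x y => by simp
      map_mul' := fun a b => TensorProduct.ext' fun x y => by simp [mul_assoc]
      map_zero' := TensorProduct.ext' fun x y => by simp
      map_add' := fun a b => TensorProduct.ext' fun x y => by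
        simp [mul_add, TensorProduct.tmul_add]
      commutes' := fun c => TensorProduct.ext' fun x y => by
        simp [Module.algebraMap_end_apply, ← Algebra.commutes, ← Algebra.smul_def] }
  left_right a b x := by
    induction x using TensorProduct.induction_on with
    | zero => simp
    | tmul m n => rfl
    | add x y hx hy => rw [map_add, map_add, map_add, hx, hy, map_add]

end

variable (k A) in
/-- The bimodule `A ⊕ (A ⊗ A)`. -/
def generator : Bimodule k A := prod (regular k A) (free k A)

/-- The objects of `add (A ⊕ (A ⊗ A))`: bimodules that are direct summands of a
direct sum of finitely many copies of `A ⊕ (A ⊗ A)`. -/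
def InAdd (M : Bimodule k A) : Prop :=
  ∃ (n : ℕ) (s : M ⟶ power (generator k A) n) (r : power (generator k A) n ⟶ M), s ≫ r = 𝟙 M

/-! The category `add (A ⊕ (A ⊗ A))` is closed under tensor products. -/

section Closure

/-- The projection to a component of a power. -/
def powerProj (M : Bimodule k A) (n : ℕ) (i : Fin n) : power M n ⟶ M :=
  ofLin (M := power M n) (LinearMap.proj (φ := fun _ : Fin n => M.carrier) i)
    (fun _ _ => rfl) (fun _ _ => rfl)

theorem powerProj_apply (M : Bimodule k A) (n : ℕ) (i : Fin n) (x : (power M n).carrier) :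
    toLin (powerProj M n i) x = (x : Fin n → M.carrier) i := rfl

/-- The map to a power with given components. -/
def powerLift {M P : Bimodule k A} {n : ℕ} (s : Fin n → (P ⟶ M)) : P ⟶ power M n :=
  ofLin (N := power M n) (LinearMap.pi fun i => toLin (s i))
    (fun a m => funext fun i => toLin_left (s i) a m)
    (fun b m => funext fun i => toLin_right (s i) b m)

theorem sum_toLin {M N : Bimodule k A} {J : Type*} (S : Finset J) (f : J → (M ⟶ N))
    (m : M.carrier) : toLin (∑ j ∈ S, f j) m = ∑ j ∈ S, toLin (f j) m := by
  classical
  induction S using Finset.induction_on with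
  | empty => simp
  | insert a S ha ih => rw [Finset.sum_insert ha, Finset.sum_insert ha, ← ih]; rfl

theorem InAdd.exists_sum {M : Bimodule k A} (h : InAdd M) :
    ∃ (n : ℕ) (s : Fin n → (M ⟶ generator k A)) (r : Fin n → (generator k A ⟶ M)),
      ∑ i, s i ≫ r i = 𝟙 M := by
  obtain ⟨n, s, r, h⟩ := h
  classical
  refine ⟨n, fun i => s ≫ powerProj _ n i,
    fun i => powerLift (fun j => if i = j then 𝟙 _ else 0) ≫ r, ?_⟩
  have : ∑ i, powerProj (generator k A) n i ≫
      powerLift (fun j => if i = j then 𝟙 (generator k A) else 0) = 𝟙 _ := by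
    apply toLin_injective
    ext x
    rw [sum_toLin]
    funext j
    refine (Finset.sum_apply (M := fun _ : Fin n => (generator k A).carrier) j _ _).trans ?_
    rw [Finset.sum_eq_single j]
    · change toLin (if j = j then 𝟙 (generator k A) else 0) _ = _
      rw [if_pos rfl]; rfl
    · intro i _ hij
      change toLin (if i = j then 𝟙 (generator k A) else 0) _ = _
      rw [if_neg hij]; rfl
    · simp
  calc _ = s ≫ (∑ i, powerProj (generator k A) n i ≫
      powerLift (fun j => if i = j then 𝟙 (generator k A) else 0)) ≫ r := by
        simp [Preadditive.sum_comp, Preadditive.comp_sum]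
    _ = 𝟙 M := by rw [this, Category.id_comp, h]

theorem InAdd.of_sum {M : Bimodule k A} {J : Type*} [Fintype J]
    (s : J → (M ⟶ generator k A)) (r : J → (generator k A ⟶ M))
    (h : ∑ i, s i ≫ r i = 𝟙 M) : InAdd M := by
  let e := Fintype.equivFin J
  refine ⟨Fintype.card J, powerLift fun i => s (e.symm i),
    ∑ i, powerProj _ _ i ≫ r (e.symm i), ?_⟩
  rw [Preadditive.comp_sum, ← h, ← e.symm.sum_comp]
  rfl

theorem InAdd.of_sum' {M : Bimodule k A} {J : Type*} [Fintype J] (X : J → Bimodule k A)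
    (hX : ∀ j, InAdd (X j)) (s : ∀ j, M ⟶ X j) (r : ∀ j, X j ⟶ M)
    (h : ∑ i, s i ≫ r i = 𝟙 M) : InAdd M := by
  choose n s' r' h' using fun j => (hX j).exists_sum
  refine InAdd.of_sum (J := Σ j, Fin (n j)) (fun p => s p.1 ≫ s' p.1 p.2)
    (fun p => r' p.1 p.2 ≫ r p.1) ?_
  rw [Fintype.sum_sigma, ← h]
  refine Finset.sum_congr rfl fun j _ => ?_
  calc _ = s j ≫ (∑ i, s' j i ≫ r' j i) ≫ r j := by
        simp [Preadditive.sum_comp, Preadditive.comp_sum]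
    _ = _ := by rw [h', Category.id_comp]

theorem InAdd.of_retract {M N : Bimodule k A} (hN : InAdd N) (s : M ⟶ N) (r : N ⟶ M)
    (h : s ≫ r = 𝟙 M) : InAdd M :=
  InAdd.of_sum' (J := Unit) (fun _ => N) (fun _ => hN) (fun _ => s) (fun _ => r) (by simpa using h)

/-- The two summands of `A ⊕ (A ⊗ A)`. -/
def summand : Bool → Bimodule k A
  | true => regular k A
  | false => free k A

/-- The projections of `A ⊕ (A ⊗ A)` to its summands. -/
def toSummand : ∀ b, generator k A ⟶ summand (k := k) (A := A) b
  | true => ofLin (M := generator k A) (LinearMap.fst k (regular k A).carrier (free k A).carrier)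
      (fun _ _ => rfl) (fun _ _ => rfl)
  | false => ofLin (M := generator k A) (LinearMap.snd k (regular k A).carrier (free k A).carrier)
      (fun _ _ => rfl) (fun _ _ => rfl)

/-- The inclusions of the summands of `A ⊕ (A ⊗ A)`. -/
def ofSummand : ∀ b, summand (k := k) (A := A) b ⟶ generator k A
  | true => ofLin (N := generator k A) (LinearMap.inl k (regular k A).carrier (free k A).carrier)
      (fun a _ => Prod.ext rfl (map_zero ((free k A).left a)).symm)
      (fun b _ => Prod.ext rfl (map_zero ((free k A).right b)).symm)
  | false => ofLin (N := generator k A) (LinearMap.inr k (regular k A).carrier (free k A).carrier)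
      (fun a _ => Prod.ext (map_zero ((regular k A).left a)).symm rfl)
      (fun b _ => Prod.ext (map_zero ((regular k A).right b)).symm rfl)

theorem sum_summand :
    ∑ b, toSummand b ≫ ofSummand b = 𝟙 (generator k A) := by
  apply toLin_injective
  ext x
  rw [sum_toLin]
  rw [Fintype.sum_bool]
  exact Prod.ext (add_zero _) (zero_add _)

theorem inAdd_summand (b : Bool) : InAdd (summand (k := k) (A := A) b) := by
  refine InAdd.of_sum (J := Unit) (fun _ => ofSummand b) (fun _ => toSummand b) ?_
  rw [Fintype.sum_unique]
  cases b <;> rfl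

theorem inAdd_regular : InAdd (regular k A) := inAdd_summand true

theorem inAdd_free : InAdd (free k A) := inAdd_summand false

section
open scoped TensorProduct

/-- An element `a ⊗ b` of `A ⊗ A`. -/
def freeMk (a b : A) : (free k A).carrier := a ⊗ₜ[k] b

theorem free_left (a x y : A) : (free k A).left a (freeMk x y) = freeMk (a * x) y := rfl

theorem free_right (b : Aᵐᵒᵖ) (x y : A) :
    (free k A).right b (freeMk x y) = freeMk x (y * b.unop) := rfl

theorem freeMk_add (a b b' : A) :
    (freeMk a (b + b') : (free k A).carrier) = freeMk a b + freeMk a b' :=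
  TensorProduct.tmul_add _ _ _

theorem add_freeMk (a a' b : A) :
    (freeMk (a + a') b : (free k A).carrier) = freeMk a b + freeMk a' b :=
  TensorProduct.add_tmul _ _ _

theorem freeMk_smul (c : k) (a b : A) :
    (freeMk a (c • b) : (free k A).carrier) = c • freeMk a b :=
  TensorProduct.tmul_smul _ _ _

theorem smul_freeMk (c : k) (a b : A) :
    (freeMk (c • a) b : (free k A).carrier) = c • freeMk a b :=
  (TensorProduct.smul_tmul' _ _ _).symm

/-- The linear map out of `A ⊗ A` given by a bilinear map. -/
def freeLift {P : Type w} [AddCommGroup P] [Module k P] (f : A →ₗ[k] A →ₗ[k] P) :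
    (free k A).carrier →ₗ[k] P := TensorProduct.lift f

theorem free_ext {P : Type w} [AddCommGroup P] [Module k P] {f g : (free k A).carrier →ₗ[k] P}
    (h : ∀ a b : A, f (freeMk a b) = g (freeMk a b)) : f = g :=
  TensorProduct.ext' h

/-- For a linear form `φ` on `A`, the homomorphism `(a ⊗ b) ⊗ (c ⊗ d) ↦ φ (b c) a ⊗ d`. -/
def freeContract (φ : A →ₗ[k] k) : tensor (free k A) (free k A) ⟶ free k A :=
  let g : (free k A).carrier →ₗ[k] (free k A).carrier →ₗ[k] (free k A).carrier :=
    freeLift <| LinearMap.mk₂ k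
      (fun a b => freeLift <| LinearMap.mk₂ k (fun c d => φ (b * c) • (freeMk a d : (free k A).carrier))
        (fun c c' d => by simp [mul_add, add_smul])
        (fun r c d => by simp [mul_smul])
        (fun c d d' => by simp [freeMk_add])
        (fun r c d => by rw [freeMk_smul, smul_comm]))
      (fun a a' b => free_ext fun c d => by
        change φ (b * c) • (freeMk (a + a') d : (free k A).carrier) =
          φ (b * c) • freeMk a d + φ (b * c) • freeMk a' d
        rw [add_freeMk, smul_add])
      (fun r a b => free_ext fun c d => by
        change φ (b * c) • (freeMk (r • a) d : (free k A).carrier) =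
          r • φ (b * c) • freeMk a d
        rw [smul_freeMk, smul_comm])
      (fun a b b' => free_ext fun c d => by
        change φ ((b + b') * c) • (freeMk a d : (free k A).carrier) =
          φ (b * c) • freeMk a d + φ (b' * c) • freeMk a d
        rw [add_mul, map_add, add_smul])
      (fun r a b => free_ext fun c d => by
        change φ ((r • b) * c) • (freeMk a d : (free k A).carrier) =
          r • φ (b * c) • freeMk a d
        rw [smul_mul_assoc, map_smul, smul_assoc])
  have hg : ∀ a b c d : A, g (freeMk a b) (freeMk c d) = φ (b * c) • freeMk a d :=
    fun _ _ _ _ => rfl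
  ofTensor (lift g
      (fun m a n => LinearMap.congr_fun₂ (f := g ∘ₗ (free k A).right _)
        (g := g.compl₂ ((free k A).left a))
        (free_ext fun x y => free_ext fun z w => by
          simp [free_left, free_right, hg, mul_assoc]) m n))
    (fun a => LinearMap.congr_fun₂ (f := g ∘ₗ (free k A).left a)
        (g := g.compr₂ ((free k A).left a))
        (free_ext fun x y => free_ext fun z w => by
          simp [free_left, hg]))
    (fun b => LinearMap.congr_fun₂ (f := g.compl₂ ((free k A).right b))
        (g := g.compr₂ ((free k A).right b))
        (free_ext fun x y => free_ext fun z w => by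
          simp [free_right, hg]))

theorem freeContract_apply (φ : A →ₗ[k] k) (a b c d : A) :
    toLin (freeContract φ) (tmul (freeMk a b) (freeMk c d)) = φ (b * c) • freeMk a d := rfl

/-- For `x` in `A`, the homomorphism `a ⊗ d ↦ (a ⊗ x) ⊗ (1 ⊗ d)`. -/
def freeExpand (x : A) : free k A ⟶ tensor (free k A) (free k A) :=
  let g : (free k A).carrier →ₗ[k] (tensor (free k A) (free k A)).carrier :=
    freeLift <| LinearMap.mk₂ k (fun a d => tmul (freeMk a x) (freeMk 1 d))
      (fun a a' d => by rw [add_freeMk, add_tmul])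
      (fun r a d => by rw [smul_freeMk, smul_tmul])
      (fun a d d' => by rw [freeMk_add, tmul_add])
      (fun r a d => by rw [freeMk_smul, tmul_smul])
  ofLin g
    (fun a m => LinearMap.congr_fun (f := g ∘ₗ (free k A).left a)
      (g := (tensor (free k A) (free k A)).left a ∘ₗ g) (free_ext fun y z => by
        change tmul (freeMk (a * y) x) (freeMk 1 z)
          = (tensor (free k A) (free k A)).left a (tmul (freeMk y x) (freeMk 1 z))
        rw [tensor_left_tmul, free_left]) m)
    (fun b m => LinearMap.congr_fun (f := g ∘ₗ (free k A).right b)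
      (g := (tensor (free k A) (free k A)).right b ∘ₗ g) (free_ext fun y z => by
        change tmul (freeMk y x) (freeMk 1 (z * b.unop))
          = (tensor (free k A) (free k A)).right b (tmul (freeMk y x) (freeMk 1 z))
        rw [tensor_right_tmul, free_right]) m)

theorem freeExpand_apply (x a d : A) :
    toLin (freeExpand (k := k) x) (freeMk a d) = tmul (freeMk a x) (freeMk 1 d) := rfl

theorem hom_free_tensor_ext {P : Bimodule k A} {f g : tensor (free k A) (free k A) ⟶ P}
    (h : ∀ a b c d : A, toLin f (tmul (freeMk a b) (freeMk c d))
      = toLin g (tmul (freeMk a b) (freeMk c d))) : f = g :=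
  hom_tensor_ext fun m n => LinearMap.congr_fun₂ (f := (tmulₗ _ _).compr₂ (toLin f))
    (g := (tmulₗ _ _).compr₂ (toLin g))
    (free_ext fun a b => free_ext fun c d => h a b c d) m n

end

theorem inAdd_free_tensor_free [Module.Finite k A] : InAdd (tensor (free k A) (free k A)) := by
  let b := Module.finBasis k A
  refine InAdd.of_sum' (fun _ => free k A) (fun _ => inAdd_free)
    (fun i => freeContract (b.coord i)) (fun i => freeExpand (b i)) ?_
  refine hom_free_tensor_ext fun x y z w => ?_
  rw [sum_toLin]
  have h1 : ∀ i, toLin (freeContract (b.coord i) ≫ freeExpand (b i))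
      (tmul (freeMk x y) (freeMk z w)) = 
      tmul (freeMk x (b.repr (y * z) i • b i)) (freeMk 1 w) := fun i => by
    rw [toLin_comp, LinearMap.comp_apply, freeContract_apply, map_smul, freeExpand_apply,
      freeMk_smul, smul_tmul]
    rfl
  rw [Finset.sum_congr rfl fun i _ => h1 i]
  have h2 : ∀ v : A, ∑ i, tmul (freeMk (k := k) x (b.repr v i • b i)) (freeMk (k := k) 1 w)
      = tmul (freeMk x v) (freeMk 1 w) := fun v => by
    let T : A →ₗ[k] (tensor (free k A) (free k A)).carrier :=
      { toFun := fun v => tmul (freeMk x v) (freeMk 1 w)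
        map_add' := fun v v' => by rw [freeMk_add, add_tmul]
        map_smul' := fun c v => by rw [freeMk_smul, smul_tmul]; rfl }
    change ∑ i, T _ = T v
    rw [← map_sum, b.sum_repr]
  rw [h2]
  have h3 : (freeMk x (y * z) : (free k A).carrier)
      = (free k A).right (MulOpposite.op z) (freeMk x y) := rfl
  rw [h3, tmul_balanced, free_left, mul_one]
  rfl

theorem inAdd_summand_tensor [Module.Finite k A] (b c : Bool) :
    InAdd (tensor (summand (k := k) (A := A) b) (summand c)) := by
  cases b
  · cases c
    · exact inAdd_free_tensor_free
    · exact inAdd_free.of_retract (MonoidalCategory.rightUnitor (free k A)).hom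
        (MonoidalCategory.rightUnitor (free k A)).inv (Iso.hom_inv_id _)
  · exact (inAdd_summand c).of_retract (MonoidalCategory.leftUnitor (summand c)).hom
      (MonoidalCategory.leftUnitor (summand c)).inv (Iso.hom_inv_id _)

theorem tensorMap_sum {M M' N N' : Bimodule k A} {J J' : Type*} [Fintype J] [Fintype J']
    (f : J → (M ⟶ M')) (g : J' → (N ⟶ N')) :
    ∑ p : J × J', tensorMap (f p.1) (g p.2) = tensorMap (∑ j, f j) (∑ j, g j) := by
  refine hom_tensor_ext fun m n => ?_
  rw [sum_toLin, tensorMap_tmul, sum_toLin, sum_toLin, Fintype.sum_prod_type]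
  refine Eq.trans ?_ (tmulₗ_apply _ _)
  rw [LinearMap.map_sum₂]
  refine Finset.sum_congr rfl fun j _ => ?_
  rw [map_sum]
  rfl

theorem inAdd_tensor_of_sum {M N : Bimodule k A} {J J' : Type*} [Fintype J] [Fintype J']
    (X : J → Bimodule k A) (Y : J' → Bimodule k A)
    (h : ∀ j j', InAdd (tensor (X j) (Y j')))
    (s : ∀ j, M ⟶ X j) (r : ∀ j, X j ⟶ M) (s' : ∀ j, N ⟶ Y j) (r' : ∀ j, Y j ⟶ N)
    (h₁ : ∑ j, s j ≫ r j = 𝟙 M) (h₂ : ∑ j, s' j ≫ r' j = 𝟙 N) : InAdd (tensor M N) := by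
  refine InAdd.of_sum' (J := J × J') (fun p => tensor (X p.1) (Y p.2)) (fun p => h _ _)
    (fun p => tensorMap (s p.1) (s' p.2)) (fun p => tensorMap (r p.1) (r' p.2)) ?_
  refine Eq.trans (Eq.trans ?_ (tensorMap_sum (fun j => s j ≫ r j) (fun j => s' j ≫ r' j))) ?_
  · exact Finset.sum_congr rfl fun p _ => hom_tensor_ext fun m n => rfl
  · rw [h₁, h₂]
    exact hom_tensor_ext fun m n => rfl

theorem InAdd.tensor [Module.Finite k A] {M N : Bimodule k A} (hM : InAdd M) (hN : InAdd N) :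
    InAdd (tensor M N) := by
  obtain ⟨n, s, r, h⟩ := hM.exists_sum
  obtain ⟨n', s', r', h'⟩ := hN.exists_sum
  refine inAdd_tensor_of_sum _ _ (fun _ _ => ?_) s r s' r' h h'
  exact inAdd_tensor_of_sum _ _ inAdd_summand_tensor toSummand ofSummand toSummand ofSummand
    sum_summand sum_summand

end Closure

end Bimodule

/-! ### Symmetric bimodules -/

/-- An `ι`-symmetric bimodule over `add (A ⊕ (A ⊗ A))`: a bimodule `M` in this category with a
homomorphism `α` from `M` to its twist by `ι` on both sides, such that `α ∘ α = id`
(so `α` is an isomorphism). A homomorphism to the twist is a linear map with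
`α (a m) = ι a (α m)` and `α (m b) = (α m) ι b`. -/
structure SymBimodule {k : Type u} {A : Type v} [Field k] [Ring A] [Algebra k A] (ι : A ≃ₐ[k] A)
    (hι : Function.Involutive ι) where
  bimod : Bimodule k A
  inAdd : bimod.InAdd
  sym : bimod.carrier →ₗ[k] bimod.carrier
  sym_left : ∀ (a : A) (m : bimod.carrier), sym (bimod.left a m) = bimod.left (ι a) (sym m)
  sym_right : ∀ (b : A) (m : bimod.carrier),
    sym (bimod.right (MulOpposite.op b) m) = bimod.right (MulOpposite.op (ι b)) (sym m)
  sym_sym : ∀ m : bimod.carrier, sym (sym m) = m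

namespace SymBimodule

open Bimodule

variable {k : Type u} {A : Type v} [Field k] [Ring A] [Algebra k A] {ι : A ≃ₐ[k] A}
  {hι : Function.Involutive ι}

/-- The homomorphisms of bimodules that commute with the symmetries. -/
def homs (X Y : SymBimodule ι hι) : Submodule k (X.bimod ⟶ Y.bimod) where
  carrier := {f | ∀ m, toLin f (X.sym m) = Y.sym (toLin f m)}
  add_mem' {f g} hf hg m := by
    have hf := hf m
    have hg := hg m
    simp [hf, hg]
  zero_mem' m := by simp
  smul_mem' c f hf m := by
    have hf := hf m
    simp [hf]

/-- The category of `ι`-symmetric bimodules over `add (A ⊕ (A ⊗ A))`. -/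
instance category : Category (SymBimodule ι hι) where
  Hom X Y := homs X Y
  id X := ⟨𝟙 X.bimod, fun _ => rfl⟩
  comp {X Y Z} f g := ⟨f.1 ≫ g.1, fun m => by
    rw [toLin_comp, LinearMap.comp_apply, f.2, g.2]; rfl⟩

/-- The bimodule homomorphism underlying a homomorphism of symmetric bimodules. -/
def toHom {X Y : SymBimodule ι hι} (f : X ⟶ Y) : X.bimod ⟶ Y.bimod := f.1

theorem toHom_sym {X Y : SymBimodule ι hι} (f : X ⟶ Y) (m : X.bimod.carrier) :
    toLin (toHom f) (X.sym m) = Y.sym (toLin (toHom f) m) := f.2 m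

/-- A homomorphism of symmetric bimodules from one of bimodules that commutes with the
symmetries. -/
def ofHom {X Y : SymBimodule ι hι} (f : X.bimod ⟶ Y.bimod)
    (hf : ∀ m, toLin f (X.sym m) = Y.sym (toLin f m)) : X ⟶ Y := ⟨f, hf⟩

theorem toHom_injective {X Y : SymBimodule ι hι} {f g : X ⟶ Y} (h : toHom f = toHom g) : f = g :=
  Subtype.ext h

/-- An isomorphism of bimodules that commutes with the symmetries is an isomorphism of symmetric
bimodules. -/
def ofIso {X Y : SymBimodule ι hι} (f : X.bimod ≅ Y.bimod)
    (hf : ∀ m, toLin f.hom (X.sym m) = Y.sym (toLin f.hom m)) : X ≅ Y where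
  hom := ofHom f.hom hf
  inv := ofHom f.inv fun m => by
    have h : ∀ y, toLin f.hom (toLin f.inv y) = y := fun y =>
      LinearMap.congr_fun (congrArg toLin f.inv_hom_id) y
    have h' : ∀ x, toLin f.inv (toLin f.hom x) = x := fun x =>
      LinearMap.congr_fun (congrArg toLin f.hom_inv_id) x
    rw [← h' (X.sym _), hf, h]
  hom_inv_id := toHom_injective f.hom_inv_id
  inv_hom_id := toHom_injective f.inv_hom_id

instance homAddCommGroup (X Y : SymBimodule ι hι) : AddCommGroup (X ⟶ Y) :=
  inferInstanceAs (AddCommGroup (homs X Y))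

instance homModule (X Y : SymBimodule ι hι) : Module k (X ⟶ Y) :=
  inferInstanceAs (Module k (homs X Y))

@[simp] theorem toHom_comp {X Y Z : SymBimodule ι hι} (f : X ⟶ Y) (g : Y ⟶ Z) :
    toHom (f ≫ g) = toHom f ≫ toHom g := rfl

@[simp] theorem toHom_id (X : SymBimodule ι hι) : toHom (𝟙 X) = 𝟙 X.bimod := rfl

@[simp] theorem toHom_add {X Y : SymBimodule ι hι} (f g : X ⟶ Y) :
    toHom (f + g) = toHom f + toHom g := rfl

@[simp] theorem toHom_smul {X Y : SymBimodule ι hι} (c : k) (f : X ⟶ Y) :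
    toHom (c • f) = c • toHom f := rfl

instance preadditive : Preadditive (SymBimodule ι hι) where
  add_comp _ _ _ f f' g := toHom_injective <| by simp
  comp_add _ _ _ f g g' := toHom_injective <| by simp

instance linear : Linear k (SymBimodule ι hι) where
  smul_comp _ _ _ c f g := toHom_injective <| by simp
  comp_smul _ _ _ f c g := toHom_injective <| by simp

/-- The forgetful functor to bimodules. -/
def forget (ι : A ≃ₐ[k] A) (hι : Function.Involutive ι) : SymBimodule ι hι ⥤ Bimodule k A where
  obj X := X.bimod
  map f := toHom f

instance : (forget ι hι).Faithful where
  map_injective h := toHom_injective h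

/-- The symmetry `m ⊗ n ↦ α m ⊗ β n` of a tensor product. -/
def tensorSym (X Y : SymBimodule ι hι) : (Bimodule.tensor X.bimod Y.bimod).carrier →ₗ[k]
    (Bimodule.tensor X.bimod Y.bimod).carrier :=
  mapTensor X.sym Y.sym fun m a n => by rw [X.sym_right, tmul_balanced, Y.sym_left]

@[simp] theorem tensorSym_tmul (X Y : SymBimodule ι hι) (m : X.bimod.carrier)
    (n : Y.bimod.carrier) : tensorSym X Y (tmul m n) = tmul (X.sym m) (Y.sym n) := rfl

/-- The tensor product over `A` of symmetric bimodules. -/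
def tensor [Module.Finite k A] (X Y : SymBimodule ι hι) : SymBimodule ι hι where
  bimod := Bimodule.tensor X.bimod Y.bimod
  inAdd := X.inAdd.tensor Y.inAdd
  sym := tensorSym X Y
  sym_left a := LinearMap.congr_fun
    (f := tensorSym X Y ∘ₗ (Bimodule.tensor X.bimod Y.bimod).left a)
    (g := (Bimodule.tensor X.bimod Y.bimod).left (ι a) ∘ₗ tensorSym X Y)
    (tensor_ext fun m n => by simp [X.sym_left])
  sym_right b := LinearMap.congr_fun
    (f := tensorSym X Y ∘ₗ (Bimodule.tensor X.bimod Y.bimod).right (MulOpposite.op b))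
    (g := (Bimodule.tensor X.bimod Y.bimod).right (MulOpposite.op (ι b)) ∘ₗ tensorSym X Y)
    (tensor_ext fun m n => by simp [Y.sym_right])
  sym_sym := LinearMap.congr_fun
    (f := tensorSym X Y ∘ₗ tensorSym X Y) (g := LinearMap.id)
    (tensor_ext fun m n => by simp [X.sym_sym, Y.sym_sym])

theorem tensor_sym_tmul [Module.Finite k A] (X Y : SymBimodule ι hι) (m : X.bimod.carrier)
    (n : Y.bimod.carrier) : (tensor X Y).sym (tmul m n) = tmul (X.sym m) (Y.sym n) := rfl

variable (ι hι) in
/-- The regular bimodule `A` with the symmetry `ι`. -/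
def unit : SymBimodule ι hι where
  bimod := regular k A
  inAdd := inAdd_regular
  sym := ι.toLinearMap
  sym_left a m := map_mul (M := A) ι a m
  sym_right b m := map_mul (M := A) ι m b
  sym_sym m := hι m

section Monoidal

open MonoidalCategory

variable [Module.Finite k A]

/-- The tensor product of two homomorphisms. -/
def tensorMap {X X' Y Y' : SymBimodule ι hι} (f : X ⟶ X') (g : Y ⟶ Y') :
    tensor X Y ⟶ tensor X' Y' :=
  ofHom (Bimodule.tensorMap (toHom f) (toHom g)) <| LinearMap.congr_fun
    (f := toLin (Bimodule.tensorMap (toHom f) (toHom g)) ∘ₗ (tensor X Y).sym)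
    (g := (tensor X' Y').sym ∘ₗ toLin (Bimodule.tensorMap (toHom f) (toHom g)))
    (tensor_ext fun m n => by
      change tmul (toLin (toHom f) (X.sym m)) (toLin (toHom g) (Y.sym n)) =
        tmul (X'.sym (toLin (toHom f) m)) (Y'.sym (toLin (toHom g) n))
      rw [toHom_sym, toHom_sym])

/-- The associator is the one of bimodules. -/
def assoc (X Y Z : SymBimodule ι hι) : tensor (tensor X Y) Z ≅ tensor X (tensor Y Z) :=
  ofIso (α_ X.bimod Y.bimod Z.bimod) <| LinearMap.congr_fun
    (f := toLin (assocHom X.bimod Y.bimod Z.bimod) ∘ₗ (tensor (tensor X Y) Z).sym)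
    (g := (tensor X (tensor Y Z)).sym ∘ₗ toLin (assocHom X.bimod Y.bimod Z.bimod))
    (tensor_ext fun x p => LinearMap.congr_fun
      (f := toLin (assocHom X.bimod Y.bimod Z.bimod) ∘ₗ (tensor (tensor X Y) Z).sym ∘ₗ
        (tmulₗ (tensor X Y).bimod Z.bimod).flip p)
      (g := (tensor X (tensor Y Z)).sym ∘ₗ toLin (assocHom X.bimod Y.bimod Z.bimod) ∘ₗ
        (tmulₗ (tensor X Y).bimod Z.bimod).flip p)
      (tensor_ext fun _ _ => rfl) x)

/-- The left unitor is the one of bimodules. -/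
def lunit (X : SymBimodule ι hι) : tensor (unit ι hι) X ≅ X :=
  ofIso (λ_ X.bimod) <| LinearMap.congr_fun
    (f := toLin (lunitHom X.bimod) ∘ₗ (tensor (unit ι hι) X).sym)
    (g := X.sym ∘ₗ toLin (lunitHom X.bimod))
    (tensor_ext fun (a : A) m => (X.sym_left a m).symm)

/-- The right unitor is the one of bimodules. -/
def runit (X : SymBimodule ι hι) : tensor X (unit ι hι) ≅ X :=
  ofIso (ρ_ X.bimod) <| LinearMap.congr_fun
    (f := toLin (runitHom X.bimod) ∘ₗ (tensor X (unit ι hι)).sym)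
    (g := X.sym ∘ₗ toLin (runitHom X.bimod))
    (tensor_ext fun m (a : A) => (X.sym_right a m).symm)

instance monoidalCategoryStruct : MonoidalCategoryStruct (SymBimodule ι hι) where
  tensorObj := tensor
  tensorUnit := unit ι hι
  whiskerLeft X _ _ f := tensorMap (𝟙 X) f
  whiskerRight f Y := tensorMap f (𝟙 Y)
  tensorHom := tensorMap
  associator := assoc
  leftUnitor := lunit
  rightUnitor := runit

/-- The tensor category of `ι`-symmetric bimodules: the axioms hold because they hold for
bimodules. -/
instance monoidalCategory : MonoidalCategory (SymBimodule ι hι) :=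
  Monoidal.induced (forget ι hι)
    { μIso := fun X Y => Iso.refl (Bimodule.tensor X.bimod Y.bimod)
      εIso := Iso.refl (regular k A)
      whiskerLeft_eq := fun _ _ _ _ => hom_tensor_ext fun _ _ => rfl
      whiskerRight_eq := fun _ _ => hom_tensor_ext fun _ _ => rfl
      tensorHom_eq := fun _ _ => hom_tensor_ext fun _ _ => rfl
      associator_eq := fun _ _ _ => hom_tensor_ext₃ fun _ _ _ => rfl
      leftUnitor_eq := fun _ => hom_tensor_ext fun _ _ => rfl
      rightUnitor_eq := fun _ => hom_tensor_ext fun _ _ => rfl }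

end Monoidal

end SymBimodule

/-! ### Strictification of a monoidal category -/

section Strictification

open MonoidalCategory

/-- The strictification of a monoidal category `C`: its objects are the finite words in the objects
of `C`, and its morphisms are the morphisms in `C` between the tensor products of the words. -/
structure Strictification (C : Type u) where
  word : List C

namespace Strictification

variable {C : Type u} [Category.{v} C] [MonoidalCategory C]

/-- The tensor product `X₁ ⊗ (X₂ ⊗ (⋯ ⊗ (Xₙ ⊗ 𝟙)))` of a word. -/
def eval : List C → C
  | [] => 𝟙_ C
  | X :: l => X ⊗ eval l

/-- The canonical isomorphism given by rebracketing. -/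
def evalAppend : ∀ l l' : List C, eval (l ++ l') ≅ eval l ⊗ eval l'
  | [], l' => (λ_ (eval l')).symm
  | X :: l, l' => whiskerLeftIso X (evalAppend l l') ≪≫ (α_ X (eval l) (eval l')).symm

instance category : Category (Strictification C) where
  Hom X Y := eval X.word ⟶ eval Y.word
  id X := 𝟙 (eval X.word)
  comp f g := CategoryStruct.comp (obj := C) f g
  id_comp f := Category.id_comp (obj := C) f
  comp_id f := Category.comp_id (obj := C) f
  assoc f g h := Category.assoc (obj := C) f g h

variable (C) in
/-- The functor that evaluates words. -/
def evalFunctor : Strictification C ⥤ C where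
  obj X := eval X.word
  map f := f

instance : (evalFunctor C).Faithful where
  map_injective h := h

instance monoidalCategoryStruct : MonoidalCategoryStruct (Strictification C) where
  tensorObj X Y := ⟨X.word ++ Y.word⟩
  tensorUnit := ⟨[]⟩
  whiskerLeft X Y Z f :=
    ((evalAppend X.word Y.word).hom ≫ eval X.word ◁ (evalFunctor C).map f ≫
      (evalAppend X.word Z.word).inv : eval (X.word ++ Y.word) ⟶ eval (X.word ++ Z.word))
  whiskerRight {Y Z} f X :=
    ((evalAppend Y.word X.word).hom ≫ (evalFunctor C).map f ▷ eval X.word ≫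
      (evalAppend Z.word X.word).inv : eval (Y.word ++ X.word) ⟶ eval (Z.word ++ X.word))
  tensorHom {X Y X' Y'} f g :=
    ((evalAppend X.word X'.word).hom ≫ ((evalFunctor C).map f ⊗ₘ (evalFunctor C).map g) ≫
      (evalAppend Y.word Y'.word).inv : eval (X.word ++ X'.word) ⟶ eval (Y.word ++ Y'.word))
  associator X Y Z := eqToIso (congrArg mk (List.append_assoc X.word Y.word Z.word))
  leftUnitor X := eqToIso (congrArg mk (List.nil_append X.word))
  rightUnitor X := eqToIso (congrArg mk (List.append_nil X.word))

theorem eqToHom_cons (X : C) {l l' : List C} (h : l = l') :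
    eqToHom (congrArg eval (congrArg (X :: ·) h)) = X ◁ eqToHom (congrArg eval h) := by
  subst h
  exact (whiskerLeft_id X (eval l)).symm

theorem evalFunctor_eqToHom {l l' : List C} (h : l = l') :
    (evalFunctor C).map (eqToHom (congrArg mk h)) = eqToHom (congrArg eval h) := by
  subst h
  rfl

theorem eval_assoc : ∀ l₁ l₂ l₃ : List C,
    eqToHom (congrArg eval (List.append_assoc l₁ l₂ l₃)) =
      (evalAppend (l₁ ++ l₂) l₃).hom ≫ (evalAppend l₁ l₂).hom ▷ eval l₃ ≫
        (α_ (eval l₁) (eval l₂) (eval l₃)).hom ≫ eval l₁ ◁ (evalAppend l₂ l₃).inv ≫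
          (evalAppend l₁ (l₂ ++ l₃)).inv
  | [], l₂, l₃ => by
    simp [evalAppend, eval]
  | X :: l₁, l₂, l₃ => by
    refine (eqToHom_cons X (List.append_assoc l₁ l₂ l₃)).trans ?_
    rw [eval_assoc l₁ l₂ l₃]
    simp [evalAppend, eval]

theorem eval_nil : ∀ l : List C,
    eqToHom (congrArg eval (List.append_nil l)) = (evalAppend l []).hom ≫ (ρ_ (eval l)).hom
  | [] => by
    change 𝟙 (𝟙_ C) = (λ_ (𝟙_ C)).inv ≫ (ρ_ (𝟙_ C)).hom
    rw [← unitors_equal, Iso.inv_hom_id]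
  | X :: l => by
    refine (eqToHom_cons X (List.append_nil l)).trans ?_
    rw [eval_nil l]
    have key : ∀ {P Q : C} (f : P ⟶ Q ⊗ 𝟙_ C), X ◁ (f ≫ (ρ_ Q).hom) =
        (X ◁ f ≫ (α_ X Q (𝟙_ C)).inv) ≫ (ρ_ (X ⊗ Q)).hom := fun f => by simp
    exact key (evalAppend l []).hom

instance monoidalCategory : MonoidalCategory (Strictification C) :=
  Monoidal.induced (evalFunctor C)
    { μIso := fun X Y => (evalAppend X.word Y.word).symm
      εIso := Iso.refl (𝟙_ C)
      whiskerLeft_eq := fun _ _ _ _ => rfl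
      whiskerRight_eq := fun _ _ => rfl
      tensorHom_eq := fun _ _ => rfl
      associator_eq := fun X Y Z => by
        refine (evalFunctor_eqToHom (List.append_assoc X.word Y.word Z.word)).trans ?_
        rw [eval_assoc]
        change _ = ((evalAppend (X.word ++ Y.word) Z.word).hom ≫
          ((evalAppend X.word Y.word).hom ⊗ₘ 𝟙 (eval Z.word))) ≫
          (α_ (eval X.word) (eval Y.word) (eval Z.word)).hom ≫
          (𝟙 (eval X.word) ⊗ₘ (evalAppend Y.word Z.word).inv) ≫
          (evalAppend X.word (Y.word ++ Z.word)).inv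
        simp only [tensorHom_id, id_tensorHom, Category.assoc]
      leftUnitor_eq := fun X => by
        refine (evalFunctor_eqToHom (List.nil_append X.word)).trans ?_
        change 𝟙 (eval X.word) = ((λ_ (eval X.word)).inv ≫ (𝟙 (𝟙_ C) ⊗ₘ 𝟙 (eval X.word))) ≫
          (λ_ (eval X.word)).hom
        simp
      rightUnitor_eq := fun X => by
        refine (evalFunctor_eqToHom (List.append_nil X.word)).trans ?_
        rw [eval_nil]
        have key : ∀ {P Q : C} (f : P ⟶ Q ⊗ 𝟙_ C), f ≫ (ρ_ Q).hom =
          (f ≫ (𝟙 Q ⊗ₘ 𝟙 (𝟙_ C))) ≫ (ρ_ Q).hom := fun f => by simp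
        exact key (evalAppend X.word []).hom }

instance preadditive [Preadditive C] : Preadditive (Strictification C) where
  homGroup X Y := inferInstanceAs (AddCommGroup (eval X.word ⟶ eval Y.word))
  add_comp X Y Z := Preadditive.add_comp (C := C) (eval X.word) (eval Y.word) (eval Z.word)
  comp_add X Y Z := Preadditive.comp_add (C := C) (eval X.word) (eval Y.word) (eval Z.word)

instance linear {k : Type w} [Semiring k] [Preadditive C] [Linear k C] :
    Linear k (Strictification C) where
  homModule X Y := inferInstanceAs (Module k (eval X.word ⟶ eval Y.word))
  smul_comp X Y Z := Linear.smul_comp (C := C) (eval X.word) (eval Y.word) (eval Z.word)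
  comp_smul X Y Z := Linear.comp_smul (C := C) (eval X.word) (eval Y.word) (eval Z.word)

end Strictification

end Strictification

/-! ### One-object 2-categories -/

section Delooping

/-- The one-object bicategory whose 1-morphisms are the objects of the monoidal category `D`, whose
2-morphisms are the morphisms of `D`, and where the composition `F ∘ G` ("first `G`, then `F`") of
1-morphisms is the tensor product `F ⊗ G`. -/
structure Delooping (D : Type u) where

namespace Delooping

variable {D : Type u} [Category.{v} D] [MonoidalCategory D]

open MonoidalCategory in
/-- In Mathlib, `F ≫ G` is "first `F`, then `G`". -/
instance bicategory : Bicategory (Delooping D) where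
  Hom _ _ := D
  id _ := 𝟙_ D
  comp F G := G ⊗ F
  whiskerLeft F _ _ η := η ▷ F
  whiskerRight η G := G ◁ η
  associator F G H := (α_ H G F).symm
  leftUnitor F := ρ_ F
  rightUnitor F := λ_ F
  whisker_exchange η θ := (whisker_exchange θ η).symm

end Delooping

end Delooping

namespace Delooping

open MonoidalCategory in
/-- The delooping of a strictification is a (strict) 2-category. -/
instance strict {C : Type u} [Category.{v} C] [MonoidalCategory C] :
    Bicategory.Strict (Delooping (Strictification C)) where
  id_comp F := congrArg Strictification.mk (List.append_nil F.word)
  comp_id F := congrArg Strictification.mk (List.nil_append F.word)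
  assoc F G H := congrArg Strictification.mk (List.append_assoc H.word G.word F.word).symm
  leftUnitor_eqToIso _ := rfl
  rightUnitor_eqToIso _ := rfl
  associator_eqToIso _ _ _ := rfl

end Delooping

namespace Delooping

variable {D : Type u} [Category.{v} D] [MonoidalCategory D]

instance preadditive [Preadditive D] (a b : Delooping D) : Preadditive (a ⟶ b) :=
  inferInstanceAs (Preadditive D)

instance linear {k : Type w} [Semiring k] [Preadditive D] [Linear k D] (a b : Delooping D) :
    Linear k (a ⟶ b) :=
  inferInstanceAs (Linear k D)

end Delooping

/-! ### Finitary and weakly fiat 2-categories -/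

section Finitary

open Limits

/-- An object is indecomposable if it is nonzero and is not a direct sum of two nonzero
objects. -/
def IsIndecomposable {C : Type u} [Category.{v} C] [Preadditive C] (X : C) : Prop :=
  ¬ IsZero X ∧ ∀ (Y Z : C) (b : BinaryBicone Y Z), Nonempty b.IsBilimit → Nonempty (b.pt ≅ X) →
    IsZero Y ∨ IsZero Z

/-- An additive category is Krull-Schmidt if each object is a finite direct sum of
objects with local endomorphism rings. -/
def IsKrullSchmidt (C : Type u) [Category.{v} C] [Preadditive C] : Prop :=
  ∀ X : C, ∃ (n : ℕ) (Y : Fin n → C) (b : Bicone Y),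
    (∀ i, IsLocalRing (End (Y i))) ∧ Nonempty b.IsBilimit ∧ Nonempty (b.pt ≅ X)

/-- There are only finitely many isomorphism classes of indecomposable objects. -/
def HasFinitelyManyIndecomposables (C : Type u) [Category.{v} C] [Preadditive C] : Prop :=
  ∃ (n : ℕ) (Y : Fin n → C), ∀ X : C, IsIndecomposable X → ∃ i, Nonempty (X ≅ Y i)

open Bicategory in
/-- A bicategory with `k`-linear categories of 1-morphisms is a finitary 2-category if it is
strict (i.e. a 2-category), if it has finitely many objects, if each category of 1-morphisms is
additive, idempotent split and Krull-Schmidt, with finitely many isomorphism classes of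
indecomposable objects and with finite dimensional morphism spaces, and if horizontal composition is
`k`-bilinear on 2-morphisms. -/
structure IsFinitary (k : Type w) [Field k] (B : Type u) [Bicategory.{v} B]
    [∀ a b : B, Preadditive (a ⟶ b)] [∀ a b : B, Linear k (a ⟶ b)] : Prop where
  finite_objects : Finite B
  additive : ∀ a b : B, HasFiniteBiproducts (a ⟶ b)
  idempotent_split : ∀ a b : B, IsIdempotentComplete (a ⟶ b)
  krullSchmidt : ∀ a b : B, IsKrullSchmidt (a ⟶ b)
  finite_indecomposables : ∀ a b : B, HasFinitelyManyIndecomposables (a ⟶ b)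
  finite_hom : ∀ (a b : B) (F G : a ⟶ b), Module.Finite k (F ⟶ G)
  whiskerLeft_add : ∀ {a b c : B} (F : a ⟶ b) {G H : b ⟶ c} (η θ : G ⟶ H),
    F ◁ (η + θ) = F ◁ η + F ◁ θ
  whiskerLeft_smul : ∀ {a b c : B} (F : a ⟶ b) {G H : b ⟶ c} (r : k) (η : G ⟶ H),
    F ◁ (r • η) = r • (F ◁ η)
  add_whiskerRight : ∀ {a b c : B} {F G : a ⟶ b} (η θ : F ⟶ G) (H : b ⟶ c),
    (η + θ) ▷ H = η ▷ H + θ ▷ H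
  smul_whiskerRight : ∀ {a b c : B} {F G : a ⟶ b} (r : k) (η : F ⟶ G) (H : b ⟶ c),
    (r • η) ▷ H = r • (η ▷ H)
  strict : Bicategory.Strict B

/-- The identity 1-morphisms are indecomposable. -/
def HasIndecomposableIdentities (B : Type u) [Bicategory.{v} B]
    [∀ a b : B, Preadditive (a ⟶ b)] : Prop :=
  ∀ a : B, @IsIndecomposable (a ⟶ a) (Bicategory.homCategory a a) _ (𝟙 a)

open Bicategory Opposite in
/-- A weak `k`-linear anti-autoequivalence of a 2-category that is the identity on
objects: a biequivalence to the 2-category with the directions of both 1-morphisms and 2-morphisms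
reversed. It consists of equivalences `star` between (the opposite of) the category of 1-morphisms
from `a` to `b` and the one from `b` to `a`, with coherent natural isomorphisms
`𝟙 ≅ 𝟙⋆` and `G⋆ ≫ F⋆ ≅ (F ≫ G)⋆`. -/
structure AntiAutoequivalence (k : Type w) [Field k] (B : Type u) [Bicategory.{v} B]
    [∀ a b : B, Preadditive (a ⟶ b)] [∀ a b : B, Linear k (a ⟶ b)] where
  star : ∀ a b : B, (a ⟶ b)ᵒᵖ ⥤ (b ⟶ a)
  isEquivalence : ∀ a b : B, (star a b).IsEquivalence
  map_add : ∀ {a b : B} {F G : a ⟶ b} (η θ : F ⟶ G),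
    (star a b).map (η + θ).op = (star a b).map η.op + (star a b).map θ.op
  map_smul : ∀ {a b : B} {F G : a ⟶ b} (r : k) (η : F ⟶ G),
    (star a b).map (r • η).op = r • (star a b).map η.op
  mapId : ∀ a : B, @Iso (a ⟶ a) (homCategory a a) (𝟙 a) ((star a a).obj (op (𝟙 a)))
  mapComp : ∀ {a b c : B} (F : a ⟶ b) (G : b ⟶ c),
    (star b c).obj (op G) ≫ (star a b).obj (op F) ≅ (star a c).obj (op (F ≫ G))
  mapComp_naturality_right : ∀ {a b c : B} (F : a ⟶ b) {G G' : b ⟶ c} (η : G ⟶ G'),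
    (mapComp F G').hom ≫ (star a c).map (F ◁ η).op =
      (star b c).map η.op ▷ (star a b).obj (op F) ≫ (mapComp F G).hom
  mapComp_naturality_left : ∀ {a b c : B} {F F' : a ⟶ b} (η : F ⟶ F') (G : b ⟶ c),
    (mapComp F' G).hom ≫ (star a c).map (η ▷ G).op =
      (star b c).obj (op G) ◁ (star a b).map η.op ≫ (mapComp F G).hom
  mapComp_assoc : ∀ {a b c d : B} (F : a ⟶ b) (G : b ⟶ c) (H : c ⟶ d),
    (star c d).obj (op H) ◁ (mapComp F G).hom ≫ (mapComp (F ≫ G) H).hom =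
      (α_ ((star c d).obj (op H)) ((star b c).obj (op G)) ((star a b).obj (op F))).inv ≫
        (mapComp G H).hom ▷ (star a b).obj (op F) ≫ (mapComp F (G ≫ H)).hom ≫
          (star a d).map (α_ F G H).hom.op
  mapComp_id_left : ∀ {a b : B} (F : a ⟶ b),
    (star a b).obj (op F) ◁ (mapId a).hom ≫ (mapComp (𝟙 a) F).hom =
      (ρ_ ((star a b).obj (op F))).hom ≫ (star a b).map (λ_ F).hom.op
  mapComp_id_right : ∀ {a b : B} (F : a ⟶ b),
    (mapId b).hom ▷ (star a b).obj (op F) ≫ (mapComp F (𝟙 b)).hom =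
      (λ_ ((star a b).obj (op F))).hom ≫ (star a b).map (ρ_ F).hom.op

/-- A finitary 2-category is weakly fiat if it has a weak anti-autoequivalence `star` together with
adjunctions `(F, F⋆)`, i.e. 2-morphisms `F ∘ F⋆ ⟶ 𝟙` and `𝟙 ⟶ F⋆ ∘ F` that satisfy the triangle
identities, for all 1-morphisms `F`. -/
def IsWeaklyFiat (k : Type w) [Field k] (B : Type u) [Bicategory.{v} B]
    [∀ a b : B, Preadditive (a ⟶ b)] [∀ a b : B, Linear k (a ⟶ b)] : Prop :=
  IsFinitary k B ∧ ∃ S : AntiAutoequivalence k B, ∀ (a b : B) (F : a ⟶ b),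
    Nonempty (Bicategory.Adjunction F ((S.star a b).obj (Opposite.op F)))

end Finitary

/-! ### The 2-category of symmetric bimodules -/

/-- The 2-category of `ι`-symmetric bimodules over `add (A ⊕ (A ⊗ A))`: it has one object, and it is
the strictification of the tensor category of these bimodules. -/
abbrev SymTwoCategory {k : Type u} {A : Type v} [Field k] [Ring A] [Algebra k A] (ι : A ≃ₐ[k] A)
    (hι : Function.Involutive ι) : Type :=
  Delooping (Strictification (SymBimodule ι hι))

/-- A ring is connected if it is nonzero and has no central idempotents except `0` and `1`. -/
def IsConnectedRing (A : Type v) [Ring A] : Prop :=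
  Nontrivial A ∧ ∀ e ∈ Set.center A, e * e = e → e = 0 ∨ e = 1

/-- A ring is (left) self-injective if it is injective as a left module over itself. -/
def IsSelfInjective (A : Type v) [Ring A] : Prop := Module.Injective A A

end

/-! Finitarity comes from finitely many additive generators. Let (M, α) be a symmetric bimodule. The
identity of M is a sum of composites M → S → M of bimodule maps s and r, where S is A or A ⊗ A with
its symmetry β = ι or ι ⊗ ι. These maps need not commute with the symmetries, so s is replaced by
the two maps s ± βsα into (S, ±β), and r likewise by r ± αrβ. Over the two signs the mixed terms
cancel, and the composites add up to 2(rs + α(rs)α) (`sum_symmetrize`). Summing over all s and r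
gives 2(1 + α²) = 4, which is invertible as char 𝕜 ≠ 2. Hence every object is a retract of a direct
sum of copies of the four objects (A, ±ι) and (A ⊗ A, ±ι ⊗ ι) (`exists_sum_gen`). Since morphism
spaces are finite dimensional and idempotents split, each object is a finite direct sum of objects
with local endomorphism rings (`hasLocalDecomposition`), and each indecomposable is a summand of one
of the four generators (`hasFinitelyManyIndecomposables`).

The identity 1-morphism is indecomposable for connected A because a bimodule endomorphism of A is
multiplication by a central element (`unit_idempotent`).

For weak fiatness, adjoints of 1-morphisms are duals in the tensor category. The right dual of A ⊗ A
is End(A) ≅ A ⊗ A*. It belongs to add(A ⊕ A ⊗ A) because self-injectivity makes A* a projective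
right module (`IsSelfInjective.exists_dual_retraction`, `inAdd_endo`). Evaluation and coevaluation
respect the symmetries, so the four generators have right duals, and these pass to direct sums and
retracts (`exists_exactPairing_of_generators`). Left duals are never constructed: taking right duals
is an injective map on the finite set of isomorphism classes of objects with local endomorphism
rings, so it is surjective (`exists_leftDual_of_rightDuals`).

If every 1-morphism has a right adjoint and is, up to isomorphism, one itself, then passing to right
adjoints is an anti-autoequivalence (`adjointAntiAutoequivalence`). Its coherence is inherited from
the bicategory of adjunctions, where a 2-morphism is determined by its component between left
adjoints. The strictification is an equivalent tensor category, so the work is done with symmetric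
bimodules and then transported. -/

noncomputable section

/-! ### Right adjoints as an anti-autoequivalence -/

section AdjointAntiAutoequivalence

open Bicategory Opposite

variable {B : Type u} [Bicategory.{v} B]

/-- The 1-morphism in the bicategory of adjunctions given by an adjunction. -/
abbrev adjHom {a b : B} {F : a ⟶ b} {R : b ⟶ a} (h : Adjunction F R) :
    (Adj.mk a : Adj B) ⟶ Adj.mk b := Adj.Hom.mk h

/-- The 2-morphism between adjunctions with a given component between left adjoints. -/
def adjLift {a b : Adj B} {x y : a ⟶ b} (η : x.l ⟶ y.l) : x ⟶ y where
  τl := η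
  τr := conjugateEquiv y.adj x.adj η

@[simp] theorem adjLift_τl {a b : Adj B} {x y : a ⟶ b} (η : x.l ⟶ y.l) :
    (adjLift (x := x) (y := y) η).τl = η := rfl

/-- The isomorphism between adjunctions with a given component between left adjoints. -/
def adjLiftIso {a b : Adj B} {x y : a ⟶ b} (e : x.l ≅ y.l) : x ≅ y where
  hom := adjLift e.hom
  inv := adjLift e.inv
  hom_inv_id := Adj.hom₂_ext (by simp)
  inv_hom_id := Adj.hom₂_ext (by simp)

@[simp] theorem adjLiftIso_hom_τl {a b : Adj B} {x y : a ⟶ b} (e : x.l ≅ y.l) :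
    (adjLiftIso (x := x) (y := y) e).hom.τl = e.hom := rfl

variable (R : ∀ {a b : B}, (a ⟶ b) → (b ⟶ a)) (adj : ∀ {a b : B} (F : a ⟶ b), Adjunction F (R F))

/-- The functor that sends a 1-morphism to its chosen right adjoint. -/
def rightAdjointFunctor (a b : B) : (a ⟶ b)ᵒᵖ ⥤ (b ⟶ a) where
  obj F := R F.unop
  map {F G} η := (adjLift (x := adjHom (adj G.unop)) (y := adjHom (adj F.unop)) η.unop).τr
  map_id F := conjugateEquiv_id (adj F.unop)
  map_comp {F G H} η θ :=
    (conjugateEquiv_comp (adj F.unop) (adj G.unop) (adj H.unop) η.unop θ.unop).symm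

/-- Full faithfulness is the bijectivity of taking mates; essential surjectivity is the assumption
`hR`. -/
theorem rightAdjointFunctor_isEquivalence
    (hR : ∀ {a b : B} (G : b ⟶ a), ∃ F : a ⟶ b, Nonempty (R F ≅ G)) (a b : B) :
    (rightAdjointFunctor R adj a b).IsEquivalence where
  faithful := ⟨fun {F G η θ} h =>
    Quiver.Hom.unop_inj ((conjugateEquiv (adj F.unop) (adj G.unop)).injective h)⟩
  full := ⟨fun {F G} η => ⟨((conjugateEquiv (adj F.unop) (adj G.unop)).symm η).op,
    (conjugateEquiv (adj F.unop) (adj G.unop)).apply_symm_apply η⟩⟩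
  essSurj := ⟨fun G => by
    obtain ⟨F, ⟨e⟩⟩ := hR G
    exact ⟨op F, ⟨e⟩⟩⟩

/-- The isomorphism of adjunctions between a chosen adjunction of a composite and the composite of
the chosen adjunctions. -/
def adjComp {a b c : B} (F : a ⟶ b) (G : b ⟶ c) :
    adjHom (adj (F ≫ G)) ≅ adjHom (adj F) ≫ adjHom (adj G) :=
  adjLiftIso (Iso.refl _)

/-- The isomorphism of adjunctions between a chosen adjunction of an identity and the identity
adjunction. -/
def adjId (a : B) : adjHom (adj (𝟙 a)) ≅ 𝟙 (Adj.mk a : Adj B) :=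
  adjLiftIso (Iso.refl _)

variable {R}

/-- In this and the next four lemmas both sides are 2-morphisms of adjunctions, so it suffices to
compare their components between left adjoints. There the comparison isomorphisms are identities,
and only bicategory axioms remain. The components between right adjoints then give the coherence of
`star`. -/
theorem adj_whiskerLeft_comm {a b c : B} (F : a ⟶ b) {G G' : b ⟶ c} (η : G ⟶ G') :
    adjLift (x := adjHom (adj (F ≫ G))) (y := adjHom (adj (F ≫ G'))) (F ◁ η) ≫
        (adjComp R adj F G').hom =
      (adjComp R adj F G).hom ≫ adjHom (adj F) ◁
        adjLift (x := adjHom (adj G)) (y := adjHom (adj G')) η :=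
  Adj.hom₂_ext (by simp [adjComp])

theorem adj_whiskerRight_comm {a b c : B} {F F' : a ⟶ b} (η : F ⟶ F') (G : b ⟶ c) :
    adjLift (x := adjHom (adj (F ≫ G))) (y := adjHom (adj (F' ≫ G))) (η ▷ G) ≫
        (adjComp R adj F' G).hom =
      (adjComp R adj F G).hom ≫ adjLift (x := adjHom (adj F)) (y := adjHom (adj F')) η ▷
        adjHom (adj G) :=
  Adj.hom₂_ext (by simp [adjComp])

theorem adj_assoc_comm {a b c d : B} (F : a ⟶ b) (G : b ⟶ c) (H : c ⟶ d) :
    (adjComp R adj (F ≫ G) H).hom ≫ (adjComp R adj F G).hom ▷ adjHom (adj H) =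
      adjLift (x := adjHom (adj ((F ≫ G) ≫ H))) (y := adjHom (adj (F ≫ G ≫ H))) (α_ F G H).hom ≫
        (adjComp R adj F (G ≫ H)).hom ≫ adjHom (adj F) ◁ (adjComp R adj G H).hom ≫
          (α_ (adjHom (adj F)) (adjHom (adj G)) (adjHom (adj H))).inv :=
  Adj.hom₂_ext (by simp [adjComp])

theorem adj_leftUnitor_comm {a b : B} (F : a ⟶ b) :
    (adjComp R adj (𝟙 a) F).hom ≫ (adjId R adj a).hom ▷ adjHom (adj F) =
      adjLift (x := adjHom (adj (𝟙 a ≫ F))) (y := adjHom (adj F)) (λ_ F).hom ≫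
        (λ_ (adjHom (adj F))).inv :=
  Adj.hom₂_ext (by simp [adjComp, adjId])

theorem adj_rightUnitor_comm {a b : B} (F : a ⟶ b) :
    (adjComp R adj F (𝟙 b)).hom ≫ adjHom (adj F) ◁ (adjId R adj b).hom =
      adjLift (x := adjHom (adj (F ≫ 𝟙 b))) (y := adjHom (adj F)) (ρ_ F).hom ≫
        (ρ_ (adjHom (adj F))).inv :=
  Adj.hom₂_ext (by simp [adjComp, adjId])

/-- If all 1-morphisms of a `k`-linear 2-category have right adjoints and each 1-morphism is
isomorphic to such a right adjoint, then taking right adjoints is an anti-autoequivalence. -/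
def adjointAntiAutoequivalence (k : Type w) [Field k]
    [∀ a b : B, Preadditive (a ⟶ b)] [∀ a b : B, Linear k (a ⟶ b)] (hB : IsFinitary k B)
    (hR : ∀ {a b : B} (G : b ⟶ a), ∃ F : a ⟶ b, Nonempty (R F ≅ G)) :
    AntiAutoequivalence k B where
  star a b := rightAdjointFunctor R adj a b
  isEquivalence := rightAdjointFunctor_isEquivalence R adj hR
  map_add {a b F G} η θ := by
    change conjugateEquiv (adj G) (adj F) (η + θ) =
      conjugateEquiv (adj G) (adj F) η + conjugateEquiv (adj G) (adj F) θ
    simp only [conjugateEquiv_apply', hB.whiskerLeft_add, hB.add_whiskerRight,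
      Preadditive.add_comp, Preadditive.comp_add]
  map_smul {a b F G} r η := by
    change conjugateEquiv (adj G) (adj F) (r • η) = r • conjugateEquiv (adj G) (adj F) η
    simp only [conjugateEquiv_apply', hB.whiskerLeft_smul, hB.smul_whiskerRight,
      Linear.smul_comp, Linear.comp_smul]
  mapId a := (Adj.rIso (adjId R adj a)).symm
  mapComp F G := (Adj.rIso (adjComp R adj F G)).symm
  -- Each remaining axiom is the right-adjoint component of an identity above; passing to this
  -- component reverses vertical composition, which accounts for the order of the factors.
  mapComp_naturality_right F _ _ η := congrArg Adj.Hom₂.τr (adj_whiskerLeft_comm adj F η)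
  mapComp_naturality_left η G := congrArg Adj.Hom₂.τr (adj_whiskerRight_comm adj η G)
  mapComp_assoc F G H := (congrArg Adj.Hom₂.τr (adj_assoc_comm adj F G H)).trans
    (by simp; rfl)
  mapComp_id_left F := congrArg Adj.Hom₂.τr (adj_leftUnitor_comm adj F)
  mapComp_id_right F := congrArg Adj.Hom₂.τr (adj_rightUnitor_comm adj F)

/-- Only the existence of adjoints on both sides is required: `hl` supplies the choice of right
adjoints, and `hr` the essential surjectivity of that choice. -/
theorem IsFinitary.isWeaklyFiat (k : Type w) [Field k]
    [∀ a b : B, Preadditive (a ⟶ b)] [∀ a b : B, Linear k (a ⟶ b)] (hB : IsFinitary k B)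
    (hl : ∀ {a b : B} (F : a ⟶ b), ∃ G : b ⟶ a, Nonempty (Adjunction F G))
    (hr : ∀ {a b : B} (G : b ⟶ a), ∃ F : a ⟶ b, Nonempty (Adjunction F G)) :
    IsWeaklyFiat k B := by
  choose R adj using @hl
  refine ⟨hB, adjointAntiAutoequivalence (R := @R) (fun F => (adj F).some) k hB fun G => ?_,
    fun a b F => adj F⟩
  obtain ⟨F, ⟨h⟩⟩ := hr G
  -- Two right adjoints of the same 1-morphism are isomorphic.
  exact ⟨F, ⟨conjugateIsoEquiv (adj F).some h (Iso.refl F)⟩⟩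

end AdjointAntiAutoequivalence

/-! ### Idempotents and local rings -/

section LocalRing

open Polynomial

/-- For an integral element `r` of an algebra there is an idempotent `e` such that `r` is nilpotent
if `e = 0` and invertible if `e = 1`. -/
theorem exists_idempotent_of_isIntegral (k : Type w) [Field k] {R : Type v} [Ring R] [Algebra k R]
    (r : R) (hr : IsIntegral k r) :
    ∃ e : R, e * e = e ∧ (e = 0 → IsNilpotent r) ∧ (e = 1 → IsUnit r) := by
  -- The minimal polynomial is split into its part at the root 0 and a factor prime to `X`. The
  -- Bézout relation `s * X ^ m + t * q = 1` evaluated at `r` gives two orthogonal idempotents with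
  -- sum 1, as in Fitting's lemma; `e` is the first.
  obtain ⟨m, q, hq, hmq⟩ : ∃ (m : ℕ) (q : k[X]), ¬ X ∣ q ∧ minpoly k r = X ^ m * q := by
    obtain ⟨q, hm, hq⟩ := exists_eq_pow_rootMultiplicity_mul_and_not_dvd (minpoly k r)
      (minpoly.ne_zero hr) 0
    simp only [C_0, sub_zero] at hm hq
    exact ⟨_, q, hq, hm⟩
  have hco : IsCoprime (X ^ m) q :=
    ((irreducible_X (R := k)).coprime_iff_not_dvd.2 hq).pow_left
  obtain ⟨s, t, hst⟩ := hco
  have h0 : aeval r (X ^ m * q) = 0 := hmq ▸ minpoly.aeval k r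
  have h1 : aeval r (s * X ^ m) + aeval r (t * q) = 1 := by rw [← map_add, hst, map_one]
  refine ⟨aeval r (s * X ^ m), ?_, fun h => ⟨m, ?_⟩, fun h => ?_⟩
  · have h2 : aeval r (s * X ^ m) * aeval r (t * q) = 0 := by
      rw [← map_mul, show s * X ^ m * (t * q) = s * t * (X ^ m * q) by ring, map_mul, h0, mul_zero]
    calc _ = aeval r (s * X ^ m) * (aeval r (s * X ^ m) + aeval r (t * q)) := by
          rw [mul_add, h2, add_zero]
      _ = _ := by rw [h1, mul_one]
  · rw [h, zero_add] at h1
    calc r ^ m = aeval r (X ^ m : k[X]) * aeval r (t * q) := by rw [h1, mul_one, map_pow, aeval_X]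
      _ = 0 := by rw [← map_mul, show (X ^ m * (t * q) : k[X]) = t * (X ^ m * q) by ring, map_mul,
                    h0, mul_zero]
  -- For `m = 0` the equation `e = 1` carries no information. In that case `q` is the whole minimal
  -- polynomial, and a Bézout relation between `X` and `q` gives the inverse of `r`.
  · rcases m with _ | m
    · obtain ⟨s', t', h'⟩ := ((irreducible_X (R := k)).coprime_iff_not_dvd.2 hq)
      have h3 : aeval r (s' * X) + aeval r (t' * q) = 1 := by rw [← map_add, h', map_one]
      rw [pow_zero, one_mul] at h0
      rw [map_mul _ t', h0, mul_zero, add_zero, map_mul, aeval_X] at h3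
      have h4 : r * aeval r s' = 1 := by
        rw [← h3]
        simpa using congrArg (aeval r) (mul_comm X s')
      exact ⟨⟨r, _, h4, h3⟩, rfl⟩
    · have h3 : aeval r (s * X ^ m) * r = 1 := by
        rw [← h, pow_succ, ← mul_assoc, map_mul _ _ X, aeval_X]
      have h4 : r * aeval r (s * X ^ m) = 1 := by
        rw [← h, pow_succ, ← mul_assoc, mul_comm _ X, map_mul _ X, aeval_X]
      exact ⟨⟨r, _, h4, h3⟩, rfl⟩

/-- Every element is integral, hence nilpotent or invertible by the previous lemma, and 1 minus a
nilpotent element is invertible. -/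
theorem isLocalRing_of_idempotents (k : Type w) [Field k] {R : Type v} [Ring R] [Algebra k R]
    [Module.Finite k R] [Nontrivial R] (h : ∀ e : R, e * e = e → e = 0 ∨ e = 1) :
    IsLocalRing R := by
  refine .of_isUnit_or_isUnit_one_sub_self fun r => ?_
  obtain ⟨e, he, h0, h1⟩ := exists_idempotent_of_isIntegral k r (Algebra.IsIntegral.isIntegral r)
  rcases h e he with rfl | rfl
  · exact .inr (h0 rfl).isUnit_one_sub
  · exact .inl (h1 rfl)

theorem IsLocalRing.eq_zero_or_eq_one_of_mul_self {R : Type v} [Ring R] [IsLocalRing R] {e : R}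
    (he : e * e = e) : e = 0 ∨ e = 1 := by
  rcases IsLocalRing.isUnit_or_isUnit_of_add_one (add_sub_cancel e 1) with h | h
  · exact .inr (h.mul_left_cancel (by rw [he, mul_one]))
  · exact .inl (h.mul_left_cancel (by rw [sub_mul, one_mul, he, sub_self, mul_zero]))

/-- Induction on the number of terms: after division by the sum, either the first term or the rest
is a unit. -/
theorem exists_isUnit_of_isUnit_sum {R : Type v} [Ring R] [IsLocalRing R] {J : Type*}
    (S : Finset J) (f : J → R) (h : IsUnit (∑ j ∈ S, f j)) : ∃ j ∈ S, IsUnit (f j) := by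
  classical
  induction S using Finset.induction_on with
  | empty => simp at h
  | insert a S ha ih =>
    rw [Finset.sum_insert ha] at h
    obtain ⟨u, hu⟩ := h
    have h2 : ↑u⁻¹ * f a + ↑u⁻¹ * ∑ j ∈ S, f j = 1 := by rw [← mul_add, ← hu, u.inv_mul]
    rcases IsLocalRing.isUnit_or_isUnit_of_add_one h2 with h | h
    · exact ⟨a, by simp, by simpa using h⟩
    · obtain ⟨j, hj, h⟩ := ih (by simpa using h)
      exact ⟨j, by simp [hj], h⟩

end LocalRing

/-! ### Krull–Schmidt decompositions and finiteness of indecomposables -/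

section KrullSchmidt

open Limits

variable {C : Type u} [Category.{v} C] [Preadditive C]

/-- A decomposition of an object as a finite direct sum of objects with local endomorphism
rings. -/
def HasLocalDecomposition (X : C) : Prop :=
  ∃ (J : Type) (_ : Fintype J) (Y : J → C) (p : ∀ j, X ⟶ Y j) (i : ∀ j, Y j ⟶ X),
    (∀ j, IsLocalRing (End (Y j))) ∧ (∀ j, i j ≫ p j = 𝟙 _) ∧
    (∀ j j', j ≠ j' → i j ≫ p j' = 0) ∧ ∑ j, p j ≫ i j = 𝟙 X

theorem isKrullSchmidt_of_hasLocalDecomposition (h : ∀ X : C, HasLocalDecomposition X) :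
    IsKrullSchmidt C := by
  classical
  intro X
  obtain ⟨J, _, Y, p, i, hY, h1, h0, hs⟩ := h X
  let e := (Fintype.equivFin J).symm
  refine ⟨Fintype.card J, fun n => Y (e n),
    { pt := X, π := fun n => p (e n), ι := fun n => i (e n), ι_π := fun n n' => ?_ },
    fun n => hY _, ⟨isBilimitOfTotal _ ?_⟩, ⟨Iso.refl X⟩⟩
  · split_ifs with hn
    · subst hn; simpa using h1 _
    · exact h0 _ _ (e.injective.ne hn)
  · change ∑ n, p (e n) ≫ i (e n) = _
    rw [e.sum_comp fun j => p j ≫ i j, hs]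

theorem HasLocalDecomposition.of_split {X Y Z : C} (hY : HasLocalDecomposition Y)
    (hZ : HasLocalDecomposition Z) (p : X ⟶ Y) (i : Y ⟶ X) (q : X ⟶ Z) (j : Z ⟶ X)
    (hip : i ≫ p = 𝟙 Y) (hjq : j ≫ q = 𝟙 Z) (h : p ≫ i + q ≫ j = 𝟙 X) :
    HasLocalDecomposition X := by
  have hiq : i ≫ q = 0 := by
    -- Expanding the sum gives `i ≫ q + i ≫ q = i ≫ q`, so orthogonality need not be assumed.
    have : i ≫ (p ≫ i + q ≫ j) ≫ q = i ≫ q := by rw [h, Category.id_comp]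
    simpa [reassoc_of% hip, hjq] using this
  have hjp : j ≫ p = 0 := by
    have : j ≫ (p ≫ i + q ≫ j) ≫ p = j ≫ p := by rw [h, Category.id_comp]
    simpa [reassoc_of% hjq, hip] using this
  obtain ⟨J, _, Y', p', i', hY', h1, h0, hs⟩ := hY
  obtain ⟨K, _, Z', q', j', hZ', k1, k0, ks⟩ := hZ
  refine ⟨J ⊕ K, inferInstance, Sum.elim Y' Z',
    Sum.rec (fun n => p ≫ p' n) (fun n => q ≫ q' n),
    Sum.rec (fun n => i' n ≫ i) (fun n => j' n ≫ j), ?_, ?_, ?_, ?_⟩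
  · rintro (n | n)
    exacts [hY' n, hZ' n]
  · rintro (n | n)
    · simp [reassoc_of% hip, h1]
    · simp [reassoc_of% hjq, k1]
  · rintro (n | n) (n' | n') hn
    · simp [reassoc_of% hip, h0 n n' (by simpa using hn)]; rfl
    · simp [reassoc_of% hiq]; rfl
    · simp [reassoc_of% hjp]; rfl
    · simp [reassoc_of% hjq, k0 n n' (by simpa using hn)]; rfl
  · rw [Fintype.sum_sum_type, ← h]
    congr 1
    · calc _ = p ≫ (∑ n, p' n ≫ i' n) ≫ i := by simp [Preadditive.sum_comp, Preadditive.comp_sum]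
        _ = _ := by rw [hs, Category.id_comp]
    · calc _ = q ≫ (∑ n, q' n ≫ j' n) ≫ j := by simp [Preadditive.sum_comp, Preadditive.comp_sum]
        _ = _ := by rw [ks, Category.id_comp]

variable (k : Type w) [Field k] [Linear k C]

/-- The endomorphism space of a proper direct summand is smaller. -/
theorem finrank_end_lt_of_split {X Y : C} [Module.Finite k (X ⟶ X)] (p : X ⟶ Y) (i : Y ⟶ X)
    (hip : i ≫ p = 𝟙 Y) (h : p ≫ i ≠ 𝟙 X) :
    Module.finrank k (Y ⟶ Y) < Module.finrank k (X ⟶ X) := by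
  let T : (Y ⟶ Y) →ₗ[k] (X ⟶ X) := Linear.leftComp k X p ∘ₗ Linear.rightComp k Y i
  have hT : ∀ f, T f = p ≫ f ≫ i := fun _ => rfl
  have hinj : Function.Injective T := fun f g hfg => by
    have : i ≫ T f ≫ p = i ≫ T g ≫ p := by rw [hfg]
    simpa [hT, hip, reassoc_of% hip] using this
  rw [← LinearMap.finrank_range_of_inj hinj]
  refine Submodule.finrank_lt fun htop => h ?_
  obtain ⟨f, hf⟩ : 𝟙 X ∈ LinearMap.range T := htop ▸ Submodule.mem_top
  rw [hT] at hf
  -- The image of the embedding `T` misses the identity: if `p ≫ f ≫ i` is the identity, then so is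
  -- the idempotent `p ≫ i`.
  calc p ≫ i = (p ≫ i) ≫ p ≫ f ≫ i := by rw [hf, Category.comp_id]
    _ = p ≫ f ≫ i := by simp [reassoc_of% hip]
    _ = 𝟙 X := hf

theorem isLocalRing_end {X : C} [Module.Finite k (X ⟶ X)] (hX : ¬ IsZero X)
    (h : ∀ e : X ⟶ X, e ≫ e = e → e = 0 ∨ e = 𝟙 X) : IsLocalRing (End X) := by
  have : Module.Finite k (End X) := inferInstanceAs (Module.Finite k (X ⟶ X))
  have : Nontrivial (End X) := ⟨⟨𝟙 X, 0, fun h => hX ((IsZero.iff_id_eq_zero X).2 h)⟩⟩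
  exact isLocalRing_of_idempotents k h

/-- Induction on the dimension of the endomorphism space. If there is a nontrivial idempotent, it
and its complement split off two summands with smaller endomorphism spaces; otherwise the
endomorphism ring is local or the object is zero, with the empty decomposition. -/
theorem hasLocalDecomposition [∀ X Y : C, Module.Finite k (X ⟶ Y)] [IsIdempotentComplete C]
    (X : C) : HasLocalDecomposition X := by
  induction hn : Module.finrank k (X ⟶ X) using Nat.strong_induction_on generalizing X with
  | _ n ih =>
  by_cases hX : IsZero X
  · exact ⟨Empty, inferInstance, Empty.elim, fun j => j.elim, fun j => j.elim, fun j => j.elim,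
      fun j => j.elim, fun j => j.elim, hX.eq_of_src _ _⟩
  by_cases h : ∀ e : X ⟶ X, e ≫ e = e → e = 0 ∨ e = 𝟙 X
  · exact ⟨Unit, inferInstance, fun _ => X, fun _ => 𝟙 X, fun _ => 𝟙 X,
      fun _ => isLocalRing_end k hX h, fun _ => Category.id_comp _, fun _ _ h => (h rfl).elim,
      by simp⟩
  push Not at h
  obtain ⟨e, he, h0, h1⟩ := h
  obtain ⟨Y, i, p, hip, hpi⟩ := IsIdempotentComplete.idempotents_split X e he
  obtain ⟨Z, j, q, hjq, hqj⟩ := IsIdempotentComplete.idempotents_split X (𝟙 X - e)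
    (by simp [Preadditive.sub_comp, Preadditive.comp_sub, he])
  have hY := finrank_end_lt_of_split k p i hip (hpi ▸ h1)
  have hZ := finrank_end_lt_of_split k q j hjq (by rw [hqj]; simpa using h0)
  exact .of_split (ih _ (hn ▸ hY) Y rfl) (ih _ (hn ▸ hZ) Z rfl) p i q j hip hjq (by
    rw [hpi, hqj, add_sub_cancel])

omit k in
/-- An object is indecomposable if it has no idempotent endomorphisms except `0` and `1`. -/
theorem isIndecomposable_of_idempotents {X : C} (hX : ¬ IsZero X)
    (h : ∀ e : X ⟶ X, e ≫ e = e → e = 0 ∨ e = 𝟙 X) : IsIndecomposable X := by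
  refine ⟨hX, fun Y Z b ⟨hb⟩ ⟨φ⟩ => ?_⟩
  have key := h (φ.inv ≫ b.fst ≫ b.inl ≫ φ.hom) (by simp)
  rcases key with h | h
  · left
    rw [IsZero.iff_id_eq_zero]
    calc 𝟙 Y = b.inl ≫ φ.hom ≫ (φ.inv ≫ b.fst ≫ b.inl ≫ φ.hom) ≫ φ.inv ≫ b.fst := by simp
      _ = 0 := by rw [h]; simp
  · right
    rw [IsZero.iff_id_eq_zero]
    calc 𝟙 Z = b.inr ≫ φ.hom ≫ 𝟙 X ≫ φ.inv ≫ b.snd := by simp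
      _ = b.inr ≫ φ.hom ≫ (φ.inv ≫ b.fst ≫ b.inl ≫ φ.hom) ≫ φ.inv ≫ b.snd := by rw [h]
      _ = 0 := by simp

-- The images of an idempotent and of its complement form a direct sum decomposition, so one of the
-- two images vanishes.
omit [Linear k C] k in
theorem IsIndecomposable.eq_zero_or_eq_id [IsIdempotentComplete C] {X : C}
    (hX : IsIndecomposable X) (e : X ⟶ X) (he : e ≫ e = e) : e = 0 ∨ e = 𝟙 X := by
  obtain ⟨Y, i, p, hip, hpi⟩ := IsIdempotentComplete.idempotents_split X e he
  obtain ⟨Z, j, q, hjq, hqj⟩ := IsIdempotentComplete.idempotents_split X (𝟙 X - e)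
    (by simp [Preadditive.sub_comp, Preadditive.comp_sub, he])
  have h : p ≫ i + q ≫ j = 𝟙 X := by rw [hpi, hqj, add_sub_cancel]
  have hiq : i ≫ q = 0 := by
    have : i ≫ (p ≫ i + q ≫ j) ≫ q = i ≫ q := by rw [h, Category.id_comp]
    simpa [reassoc_of% hip, hjq] using this
  have hjp : j ≫ p = 0 := by
    have : j ≫ (p ≫ i + q ≫ j) ≫ p = j ≫ p := by rw [h, Category.id_comp]
    simpa [reassoc_of% hjq, hip] using this
  let b : BinaryBicone Y Z :=
    { pt := X, fst := p, snd := q, inl := i, inr := j, inl_fst := hip, inl_snd := hiq,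
      inr_fst := hjp, inr_snd := hjq }
  rcases hX.2 Y Z b ⟨isBinaryBilimitOfTotal b h⟩ ⟨Iso.refl X⟩ with hY | hZ
  · left; rw [← hpi, hY.eq_of_tgt p 0, zero_comp]
  · right; rw [← h, hZ.eq_of_tgt q 0, zero_comp, add_zero, hpi]

theorem IsIndecomposable.isLocalRing [IsIdempotentComplete C] {X : C} [Module.Finite k (X ⟶ X)]
    (hX : IsIndecomposable X) : IsLocalRing (End X) :=
  isLocalRing_end k hX.1 hX.eq_zero_or_eq_id

omit k in
theorem not_isZero_of_isLocalRing {X : C} [IsLocalRing (End X)] : ¬ IsZero X := fun h =>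
  zero_ne_one (α := End X) (h.eq_of_src _ _)

omit k in
/-- If the identity of an object with local endomorphism ring is a sum of morphisms that factor
through some objects, then the object is a retract of one of them. -/
theorem exists_retract_of_sum {X : C} [IsLocalRing (End X)] {J : Type*} [Fintype J] {Y : J → C}
    (s : ∀ j, X ⟶ Y j) (r : ∀ j, Y j ⟶ X) (h : ∑ j, s j ≫ r j = 𝟙 X) :
    ∃ (j : J) (r' : Y j ⟶ X), s j ≫ r' = 𝟙 X := by
  obtain ⟨j, -, ⟨x, hx⟩⟩ := exists_isUnit_of_isUnit_sum (R := End X) Finset.univ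
    (fun j => s j ≫ r j) (by
      rw [show (∑ j, (s j ≫ r j) : End X) = 1 from h]; exact isUnit_one)
  refine ⟨j, r j ≫ (↑x⁻¹ : End X), ?_⟩
  have : (↑x⁻¹ : End X) * ↑x = 1 := x.inv_mul
  rw [hx] at this
  simpa [End.mul_def] using this

omit k in
/-- A retraction between objects with local endomorphism rings is an isomorphism. -/
theorem nonempty_iso_of_retract {X Y : C} [IsLocalRing (End X)] [IsLocalRing (End Y)]
    (s : X ⟶ Y) (r : Y ⟶ X) (h : s ≫ r = 𝟙 X) : Nonempty (X ≅ Y) := by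
  rcases IsLocalRing.eq_zero_or_eq_one_of_mul_self (R := End Y) (e := r ≫ s)
    (by simp [End.mul_def, reassoc_of% h]) with h' | h'
  · refine (zero_ne_one (α := End X) ?_).elim
    calc (0 : X ⟶ X) = s ≫ (r ≫ s) ≫ r := by
          rw [show r ≫ s = 0 from h', zero_comp, comp_zero]
      _ = 𝟙 X := by simp [h]
  · exact ⟨s, r, h, h'⟩

/-- If the identities of all objects are sums of morphisms that factor through finitely many fixed
objects, then there are only finitely many indecomposable objects. -/
theorem hasFinitelyManyIndecomposables [∀ X Y : C, Module.Finite k (X ⟶ Y)]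
    [IsIdempotentComplete C] {T : Type} [Fintype T] (G : T → C)
    (hG : ∀ X : C, ∃ (J : Type) (_ : Fintype J) (t : J → T) (s : ∀ j, X ⟶ G (t j))
      (r : ∀ j, G (t j) ⟶ X), ∑ j, s j ≫ r j = 𝟙 X) : HasFinitelyManyIndecomposables C := by
  choose K _ Y p i hY _ _ hs using fun t => hasLocalDecomposition k (G t)
  let e := Fintype.equivFin (Σ t, K t)
  let Z : (Σ t, K t) → C := fun x => Y x.1 x.2
  refine ⟨Fintype.card (Σ t, K t), fun n => Z (e.symm n), fun X hX => ?_⟩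
  have := hX.isLocalRing k
  obtain ⟨J, _, t, s, r, hsr⟩ := hG X
  -- Locality is used twice: `X` is a retract of one generator, and then of one local summand of
  -- that generator. A retraction between objects with local endomorphism rings is an isomorphism.
  obtain ⟨j, r', hr'⟩ := exists_retract_of_sum s r hsr
  obtain ⟨l, r'', hr''⟩ := exists_retract_of_sum (fun l => s j ≫ p _ l) (fun l => i (t j) l ≫ r')
    (by simpa [Preadditive.sum_comp, Preadditive.comp_sum, hr'] using
      congrArg (fun f => s j ≫ f ≫ r') (hs (t j)))
  have := hY (t j) l
  refine ⟨e ⟨t j, l⟩, ?_⟩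
  change Nonempty (X ≅ Z (e.symm (e ⟨t j, l⟩)))
  rw [e.symm_apply_apply]
  exact nonempty_iso_of_retract _ _ hr''

end KrullSchmidt

/-! ### Right duals of retracts and of direct sums -/

section Duality

open Limits MonoidalCategory ExactPairing

variable {C : Type u} [Category.{v} C] [MonoidalCategory C]

/-- The interchange law slides `i` and `p` to the outside, so that the only map left between
coevaluation and evaluation is `i' ≫ p'`. For retracts this is an idempotent, for direct sums an
identity or zero. The next lemma is the mirror image, with `i ≫ p` in the middle. -/
theorem evaluation_coevaluation_conj {X Y X' Y' P Q P' : C} (η : 𝟙_ C ⟶ X ⊗ Y)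
    (ε : Y' ⊗ X' ⟶ 𝟙_ C) (i : X ⟶ P) (i' : Y ⟶ Q) (p' : Q ⟶ Y') (p : P' ⟶ X') :
    (η ≫ (i ⊗ₘ i')) ▷ P' ≫ (α_ P Q P').hom ≫ P ◁ ((p' ⊗ₘ p) ≫ ε) =
      𝟙_ C ◁ p ≫ η ▷ X' ≫ (α_ X Y X').hom ≫ X ◁ ((i' ≫ p') ▷ X' ≫ ε) ≫ i ▷ 𝟙_ C := by
  calc _ = η ▷ P' ⊗≫ (i ▷ (Y ⊗ P') ≫ P ◁ (i' ▷ P' ≫ p' ▷ P' ≫ Y' ◁ p ≫ ε)) := by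
        simp only [MonoidalCategory.tensorHom_def]; monoidal
    _ = η ▷ P' ⊗≫ X ◁ (i' ▷ P' ≫ p' ▷ P' ≫ Y' ◁ p ≫ ε) ≫ i ▷ 𝟙_ C := by
        rw [whisker_exchange]
    _ = η ▷ P' ⊗≫ X ◁ (((i' ≫ p') ▷ P' ≫ Y' ◁ p) ≫ ε) ≫ i ▷ 𝟙_ C := by
        simp only [comp_whiskerRight, Category.assoc]
    _ = (η ▷ P' ≫ (X ⊗ Y) ◁ p) ⊗≫ X ◁ ((i' ≫ p') ▷ X' ≫ ε) ≫ i ▷ 𝟙_ C := by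
        rw [← whisker_exchange]; monoidal
    _ = _ := by rw [← whisker_exchange]; monoidal

theorem coevaluation_evaluation_conj {X Y X' Y' P Q Q' : C} (η : 𝟙_ C ⟶ X ⊗ Y)
    (ε : Y' ⊗ X' ⟶ 𝟙_ C) (i : X ⟶ P) (i' : Y ⟶ Q) (p' : Q' ⟶ Y') (p : P ⟶ X') :
    Q' ◁ (η ≫ (i ⊗ₘ i')) ≫ (α_ Q' P Q).inv ≫ ((p' ⊗ₘ p) ≫ ε) ▷ Q =
      p' ▷ 𝟙_ C ≫ Y' ◁ (η ≫ (i ≫ p) ▷ Y) ≫ (α_ Y' X' Y).inv ≫ ε ▷ Y ≫ 𝟙_ C ◁ i' := by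
  calc _ = Q' ◁ (η ≫ i ▷ Y) ⊗≫ ((Q' ⊗ P) ◁ i' ≫ (p' ▷ P ≫ Y' ◁ p ≫ ε) ▷ Q) := by
        simp only [MonoidalCategory.tensorHom_def]; monoidal
    _ = Q' ◁ (η ≫ i ▷ Y) ⊗≫ ((p' ▷ P ≫ Y' ◁ p ≫ ε) ▷ Y ≫ 𝟙_ C ◁ i') := by
        rw [whisker_exchange]
    _ = (Q' ◁ (η ≫ i ▷ Y) ≫ p' ▷ (P ⊗ Y)) ⊗≫ (Y' ◁ p ≫ ε) ▷ Y ≫ 𝟙_ C ◁ i' := by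
        monoidal
    _ = _ := by rw [whisker_exchange]; monoidal

/-- A retract of an object with a right dual has a right dual, if idempotents split. -/
theorem exists_exactPairing_of_retract [IsIdempotentComplete C] {X X' Y' : C}
    [ExactPairing X' Y'] (s : X ⟶ X') (r : X' ⟶ X) (h : s ≫ r = 𝟙 X) :
    ∃ Y : C, Nonempty (ExactPairing X Y) := by
  let _ : HasRightDual X' := ⟨Y'⟩
  -- The idempotent `r ≫ s` cuts `X` out of `X'`. Its mate `m` is an idempotent of the dual `Y'`,
  -- and the image of `m` is the dual of `X`.
  let m : Y' ⟶ Y' := rightAdjointMate (X := X') (Y := X') (r ≫ s)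
  have hm : m ≫ m = m := by
    change rightAdjointMate (X := X') (Y := X') (r ≫ s) ≫
      rightAdjointMate (X := X') (Y := X') (r ≫ s) = _
    rw [← comp_rightAdjointMate, Category.assoc, reassoc_of% h]
  have hε : m ▷ X' ≫ ε_ X' Y' = Y' ◁ (r ≫ s) ≫ ε_ X' Y' :=
    rightAdjointMate_comp_evaluation (X := X') (Y := X') (r ≫ s)
  have hη : η_ X' Y' ≫ X' ◁ m = η_ X' Y' ≫ (r ≫ s) ▷ Y' :=
    coevaluation_comp_rightAdjointMate (X := X') (Y := X') (r ≫ s)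
  obtain ⟨Y, σ, ρ, hσρ, hρσ⟩ := IsIdempotentComplete.idempotents_split Y' m hm
  refine ⟨Y, ⟨⟨η_ X' Y' ≫ (r ⊗ₘ ρ), (σ ⊗ₘ s) ≫ ε_ X' Y', ?_, ?_⟩⟩⟩
  · rw [coevaluation_evaluation_conj, ← hη]
    calc _ = σ ▷ 𝟙_ C ≫ (Y' ◁ η_ X' Y' ≫ (α_ Y' X' Y').inv ≫ ((Y' ⊗ X') ◁ m ≫ ε_ X' Y' ▷ Y')) ≫
            𝟙_ C ◁ ρ := by monoidal
      _ = σ ▷ 𝟙_ C ≫ (Y' ◁ η_ X' Y' ≫ (α_ Y' X' Y').inv ≫ ε_ X' Y' ▷ Y') ≫ 𝟙_ C ◁ (m ≫ ρ) := by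
            rw [whisker_exchange]; monoidal
      _ = (ρ_ Y).hom ≫ (σ ≫ m ≫ ρ) ≫ (λ_ Y).inv := by
            rw [coevaluation_evaluation]; monoidal
      _ = _ := by rw [← hρσ]; simp [hσρ]
  · rw [evaluation_coevaluation_conj, hρσ, hε]
    calc _ = 𝟙_ C ◁ s ≫ (η_ X' Y' ▷ X' ≫ (X' ⊗ Y') ◁ (r ≫ s)) ≫ (α_ X' Y' X').hom ≫
            X' ◁ ε_ X' Y' ≫ r ▷ 𝟙_ C := by monoidal
      _ = 𝟙_ C ◁ (s ≫ r ≫ s) ≫ (η_ X' Y' ▷ X' ≫ (α_ X' Y' X').hom ≫ X' ◁ ε_ X' Y') ≫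
            r ▷ 𝟙_ C := by rw [← whisker_exchange]; monoidal
      _ = (λ_ X).hom ≫ (s ≫ r ≫ s ≫ r) ≫ (ρ_ X).inv := by
            rw [evaluation_coevaluation]; monoidal
      _ = _ := by simp [h]

variable [Preadditive C] [MonoidalPreadditive C]

/-- The exact pairing between two finite direct sums. -/
theorem nonempty_exactPairing_sum {J : Type*} [Fintype J] {X Y : J → C}
    [∀ j, ExactPairing (X j) (Y j)] {P Q : C} (p : ∀ j, P ⟶ X j) (i : ∀ j, X j ⟶ P)
    (q : ∀ j, Q ⟶ Y j) (l : ∀ j, Y j ⟶ Q) (hip : ∀ j, i j ≫ p j = 𝟙 _)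
    (hip' : ∀ j j', j ≠ j' → i j ≫ p j' = 0) (hp : ∑ j, p j ≫ i j = 𝟙 P)
    (hlq : ∀ j, l j ≫ q j = 𝟙 _) (hlq' : ∀ j j', j ≠ j' → l j ≫ q j' = 0)
    (hq : ∑ j, q j ≫ l j = 𝟙 Q) : Nonempty (ExactPairing P Q) := by
  classical
  refine ⟨⟨∑ j, η_ (X j) (Y j) ≫ (i j ⊗ₘ l j), ∑ j, (q j ⊗ₘ p j) ≫ ε_ (X j) (Y j), ?_, ?_⟩⟩
  · simp only [whiskerLeft_sum, sum_whiskerRight, Preadditive.sum_comp, Preadditive.comp_sum]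
    -- The terms with `j' ≠ j` vanish by orthogonality of the summands; the diagonal terms reduce to
    -- the triangle identities of the given pairings.
    have key : ∀ j j', Q ◁ (η_ (X j') (Y j') ≫ (i j' ⊗ₘ l j')) ≫ (α_ Q P Q).inv ≫
        ((q j ⊗ₘ p j) ≫ ε_ (X j) (Y j)) ▷ Q =
        if j' = j then (ρ_ Q).hom ≫ (q j ≫ l j) ≫ (λ_ Q).inv else 0 := fun j j' => by
      rw [coevaluation_evaluation_conj]
      split_ifs with h
      · subst h
        rw [hip]
        calc _ = q j' ▷ 𝟙_ C ≫ (Y j' ◁ η_ (X j') (Y j') ≫ (α_ (Y j') (X j') (Y j')).inv ≫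
              ε_ (X j') (Y j') ▷ Y j') ≫ 𝟙_ C ◁ l j' := by monoidal
          _ = _ := by rw [coevaluation_evaluation]; monoidal
      · simp [hip' _ _ h]
    simp only [key]
    calc _ = (ρ_ Q).hom ≫ (∑ j, q j ≫ l j) ≫ (λ_ Q).inv := by
          simp [Preadditive.sum_comp, Preadditive.comp_sum]
      _ = _ := by rw [hq, Category.id_comp]
  · simp only [whiskerLeft_sum, sum_whiskerRight, Preadditive.sum_comp, Preadditive.comp_sum]
    have key : ∀ j j', (η_ (X j') (Y j') ≫ (i j' ⊗ₘ l j')) ▷ P ≫ (α_ P Q P).hom ≫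
        P ◁ ((q j ⊗ₘ p j) ≫ ε_ (X j) (Y j)) =
        if j' = j then (λ_ P).hom ≫ (p j ≫ i j) ≫ (ρ_ P).inv else 0 := fun j j' => by
      rw [evaluation_coevaluation_conj]
      split_ifs with h
      · subst h
        rw [hlq]
        calc _ = 𝟙_ C ◁ p j' ≫ (η_ (X j') (Y j') ▷ X j' ≫ (α_ (X j') (Y j') (X j')).hom ≫
              X j' ◁ ε_ (X j') (Y j')) ≫ i j' ▷ 𝟙_ C := by monoidal
          _ = _ := by rw [evaluation_coevaluation]; monoidal
      · simp [hlq' _ _ h]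
    simp only [key]
    calc _ = (λ_ P).hom ≫ (∑ j, p j ≫ i j) ≫ (ρ_ P).inv := by
          simp [Preadditive.sum_comp, Preadditive.comp_sum]
      _ = _ := by rw [hp, Category.id_comp]

theorem nonempty_exactPairing_biproduct [HasFiniteBiproducts C] {J : Type} [Fintype J]
    {X Y : J → C} [∀ j, ExactPairing (X j) (Y j)] {Q : C} (q : ∀ j, Q ⟶ Y j) (l : ∀ j, Y j ⟶ Q)
    (hlq : ∀ j, l j ≫ q j = 𝟙 _) (hlq' : ∀ j j', j ≠ j' → l j ≫ q j' = 0)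
    (hq : ∑ j, q j ≫ l j = 𝟙 Q) : Nonempty (ExactPairing (⨁ X) Q) := by
  classical
  exact nonempty_exactPairing_sum (biproduct.π X) (biproduct.ι X) q l
    (fun j => biproduct.ι_π_self X j) (fun j j' h => biproduct.ι_π_ne X h)
    biproduct.total hlq hlq' hq

/-- If the generators have right duals, then so do all objects. -/
theorem exists_exactPairing_of_generators [HasFiniteBiproducts C] [IsIdempotentComplete C]
    {X : C} {J : Type} [Fintype J] {G : J → C} (hG : ∀ j, ∃ Y : C, Nonempty (ExactPairing (G j) Y))
    (s : ∀ j, X ⟶ G j) (r : ∀ j, G j ⟶ X) (h : ∑ j, s j ≫ r j = 𝟙 X) :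
    ∃ Y : C, Nonempty (ExactPairing X Y) := by
  classical
  choose Y hY using hG
  have (j : J) : ExactPairing (G j) (Y j) := (hY j).some
  have := (nonempty_exactPairing_biproduct (X := G) (biproduct.π Y) (biproduct.ι Y)
    (fun j => biproduct.ι_π_self Y j) (fun j j' h => biproduct.ι_π_ne Y h) biproduct.total).some
  exact exists_exactPairing_of_retract (X' := ⨁ G) (Y' := ⨁ Y) (biproduct.lift s) (biproduct.desc r)
    (by rw [biproduct.lift_desc, h])

end Duality

/-! ### Exact pairings as adjunctions, and left duals by counting -/

section Zigzag

open Bicategory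

variable {B : Type u} [Bicategory.{v} B] {a b : B} {f : a ⟶ b} {g : b ⟶ a}

theorem leftZigzag_eq (s : 𝟙 a ⟶ f ≫ g) (t : g ≫ f ⟶ 𝟙 b) :
    leftZigzag s t = s ▷ f ≫ (α_ f g f).hom ≫ f ◁ t := by
  simp [leftZigzag, bicategoricalComp]

theorem rightZigzag_eq (s : 𝟙 a ⟶ f ≫ g) (t : g ≫ f ⟶ 𝟙 b) :
    rightZigzag s t = g ◁ s ≫ (α_ g f g).inv ≫ t ▷ g := by
  simp [rightZigzag, bicategoricalComp]

end Zigzag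

section RightDuals

open Limits MonoidalCategory ExactPairing

variable {D : Type u} [Category.{v} D] [MonoidalCategory D]

/-- An object of a monoidal category as a 1-morphism. -/
abbrev Delooping.of (X : D) : (⟨⟩ : Delooping D) ⟶ (⟨⟩ : Delooping D) := X

/-- An exact pairing is an adjunction in the delooping. -/
def exactPairingAdjunction {X Y : D} (h : ExactPairing X Y) :
    Bicategory.Adjunction (Delooping.of Y) (Delooping.of X) where
  unit := η_ X Y
  counit := ε_ X Y
  left_triangle := (leftZigzag_eq _ _).trans (coevaluation_evaluation X Y)
  right_triangle := (rightZigzag_eq _ _).trans (evaluation_coevaluation X Y)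

/-- The bijection between morphisms of objects and of their right duals. -/
def mateOfPairing {X Y X' Y' : D} (h : ExactPairing X Y) (h' : ExactPairing X' Y') :
    (Y' ⟶ Y) ≃ (X ⟶ X') :=
  Bicategory.conjugateEquiv (exactPairingAdjunction h) (exactPairingAdjunction h')

theorem mateOfPairing_id {X Y : D} (h : ExactPairing X Y) : mateOfPairing h h (𝟙 Y) = 𝟙 X :=
  Bicategory.conjugateEquiv_id (exactPairingAdjunction h)

theorem mateOfPairing_comp {X Y X' Y' X'' Y'' : D} (h : ExactPairing X Y) (h' : ExactPairing X' Y')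
    (h'' : ExactPairing X'' Y'') (f : Y'' ⟶ Y') (g : Y' ⟶ Y) :
    mateOfPairing h h'' (f ≫ g) = mateOfPairing h h' g ≫ mateOfPairing h' h'' f :=
  (Bicategory.conjugateEquiv_comp (exactPairingAdjunction h) (exactPairingAdjunction h')
    (exactPairingAdjunction h'') g f).symm

theorem mateOfPairing_zero [Preadditive D] [MonoidalPreadditive D] {X Y X' Y' : D}
    (h : ExactPairing X Y) (h' : ExactPairing X' Y') : mateOfPairing h h' 0 = 0 := by
  refine (Bicategory.conjugateEquiv_apply' (exactPairingAdjunction h) (exactPairingAdjunction h')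
    (0 : Y' ⟶ Y)).trans ?_
  change (λ_ X).inv ≫ η_ X' Y' ▷ X ≫ (X' ◁ (0 : Y' ⟶ Y)) ▷ X ≫ (α_ X' Y X).hom ≫
    X' ◁ ε_ X Y ≫ (ρ_ X').hom = 0
  simp

/-- Objects with isomorphic right duals are isomorphic. -/
theorem nonempty_iso_of_pairing {X Y X' Y' : D} (h : ExactPairing X Y) (h' : ExactPairing X' Y')
    (e : Y ≅ Y') : Nonempty (X ≅ X') :=
  ⟨{ hom := mateOfPairing h h' e.inv
     inv := mateOfPairing h' h e.hom
     hom_inv_id := by rw [← mateOfPairing_comp, e.hom_inv_id, mateOfPairing_id]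
     inv_hom_id := by rw [← mateOfPairing_comp, e.inv_hom_id, mateOfPairing_id] }⟩

variable [Preadditive D] [MonoidalPreadditive D]

/-- Taking mates is a bijection from endomorphisms of `Y` to those of `X` that reverses composition
and preserves 0 and 1. Hence `Y` has only trivial idempotents because `X` does. -/
theorem isLocalRing_end_of_pairing (k : Type w) [Field k] [Linear k D]
    [∀ X Y : D, Module.Finite k (X ⟶ Y)] {X Y : D} (h : ExactPairing X Y)
    [IsLocalRing (End X)] : IsLocalRing (End Y) := by
  refine isLocalRing_end k (fun h0 => ?_) fun e he => ?_
  · refine not_isZero_of_isLocalRing (X := X) ((IsZero.iff_id_eq_zero X).2 ?_)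
    rw [← mateOfPairing_id h, h0.eq_of_src (𝟙 Y) 0, mateOfPairing_zero]
  · rcases IsLocalRing.eq_zero_or_eq_one_of_mul_self (R := End X) (e := mateOfPairing h h e)
      (by rw [End.mul_def, ← mateOfPairing_comp, he]) with h' | h'
    · exact .inl ((mateOfPairing h h).injective (h'.trans (mateOfPairing_zero h h).symm))
    · exact .inr ((mateOfPairing h h).injective (h'.trans (mateOfPairing_id h).symm))

/-- In a monoidal category with finitely many indecomposable objects, if each object has a right
dual, then each object is a right dual. -/
theorem exists_leftDual_of_rightDuals (k : Type w) [Field k] [Linear k D]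
    [∀ X Y : D, Module.Finite k (X ⟶ Y)] [IsIdempotentComplete D] [HasFiniteBiproducts D]
    (hfin : HasFinitelyManyIndecomposables D)
    (hD : ∀ X : D, ∃ Y : D, Nonempty (ExactPairing X Y)) (Y : D) :
    ∃ X : D, Nonempty (ExactPairing X Y) := by
  -- The classes counted are isomorphism classes of objects with local endomorphism rings. These
  -- objects are indecomposable, so there are finitely many classes.
  let S : Setoid {X : D // IsLocalRing (End X)} :=
    { r := fun X Y => Nonempty (X.1 ≅ Y.1)
      iseqv := ⟨fun X => ⟨Iso.refl _⟩, fun ⟨e⟩ => ⟨e.symm⟩, fun ⟨e⟩ ⟨e'⟩ => ⟨e ≪≫ e'⟩⟩ }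
  have hS : Finite (Quotient S) := by
    obtain ⟨n, Z, hZ⟩ := hfin
    have hind (X : {X : D // IsLocalRing (End X)}) : ∃ i, Nonempty (X.1 ≅ Z i) := by
      have := X.2
      exact hZ _ (isIndecomposable_of_idempotents not_isZero_of_isLocalRing fun e he =>
        IsLocalRing.eq_zero_or_eq_one_of_mul_self (R := End X.1) (e := e) he)
    choose i hi using hind
    refine Finite.of_injective (fun q : Quotient S => i q.out) fun q q' h => ?_
    obtain ⟨e⟩ := hi q.out
    obtain ⟨e'⟩ := hi q'.out
    rw [← q.out_eq, ← q'.out_eq]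
    exact Quotient.sound ⟨e ≪≫ eqToIso (congrArg Z h) ≪≫ e'.symm⟩
  choose R hR using hD
  let T : Quotient S → Quotient S := fun q => ⟦⟨R q.out.1, by
    have := q.out.2
    exact isLocalRing_end_of_pairing k (hR q.out.1).some⟩⟧
  have hT : Function.Injective T := fun q q' h => by
    obtain ⟨e⟩ : Nonempty (R q.out.1 ≅ R q'.out.1) := Quotient.exact h
    rw [← q.out_eq, ← q'.out_eq]
    exact Quotient.sound (nonempty_iso_of_pairing (hR _).some (hR _).some e)
  have hloc (Z : D) (hZ : IsLocalRing (End Z)) : ∃ X : D, Nonempty (ExactPairing X Z) := by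
    -- An injective self-map of a finite set is surjective, so every object with local endomorphism
    -- ring is a right dual.
    obtain ⟨q, hq⟩ := Finite.surjective_of_injective hT ⟦⟨Z, hZ⟩⟧
    obtain ⟨e⟩ : Nonempty (R q.out.1 ≅ Z) := Quotient.exact hq
    have := (hR q.out.1).some
    exact ⟨q.out.1, ⟨exactPairingCongrRight e.symm⟩⟩
  obtain ⟨J, _, Z, p, i, hZ, h1, h0, hs⟩ := hasLocalDecomposition k Y
  choose X hX using fun j => hloc (Z j) (hZ j)
  have (j : J) : ExactPairing (X j) (Z j) := (hX j).some
  exact ⟨⨁ X, nonempty_exactPairing_biproduct p i h1 h0 hs⟩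

end RightDuals

/-! ### Direct sums, images and finite dimensionality -/

namespace Bimodule

variable {k : Type u} {A : Type v} [Field k] [Ring A] [Algebra k A]

/-- The direct sum of finitely many bimodules. -/
def pi {n : ℕ} (M : Fin n → Bimodule k A) : Bimodule k A where
  carrier := ∀ i, (M i).carrier
  left :=
    { toFun := fun a => LinearMap.pi fun i => (M i).left a ∘ₗ LinearMap.proj i
      map_one' := LinearMap.ext fun x => funext fun i => by simp
      map_mul' := fun a b => LinearMap.ext fun x => funext fun i => by simp
      map_zero' := LinearMap.ext fun x => funext fun i => by simp
      map_add' := fun a b => LinearMap.ext fun x => funext fun i => by simp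
      commutes' := fun c => LinearMap.ext fun x => funext fun i => by
        simp [Module.algebraMap_end_apply] }
  right :=
    { toFun := fun b => LinearMap.pi fun i => (M i).right b ∘ₗ LinearMap.proj i
      map_one' := LinearMap.ext fun x => funext fun i => by simp
      map_mul' := fun a b => LinearMap.ext fun x => funext fun i => by simp
      map_zero' := LinearMap.ext fun x => funext fun i => by simp
      map_add' := fun a b => LinearMap.ext fun x => funext fun i => by simp
      commutes' := fun c => LinearMap.ext fun x => funext fun i => by
        simp only [AlgHom.commutes]
        simp [Module.algebraMap_end_apply] }
  left_right a b m := funext fun i => (M i).left_right a b (m i)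

/-- The projection to a summand. -/
def piProj {n : ℕ} (M : Fin n → Bimodule k A) (i : Fin n) : pi M ⟶ M i :=
  ofLin (M := pi M) (LinearMap.proj (φ := fun i => (M i).carrier) i)
    (fun _ _ => rfl) (fun _ _ => rfl)

/-- The inclusion of a summand. -/
def piIncl {n : ℕ} (M : Fin n → Bimodule k A) (i : Fin n) : M i ⟶ pi M :=
  ofLin (N := pi M) (LinearMap.single k (fun i => (M i).carrier) i)
    (fun a m => funext fun j => by
      change Pi.single (M := fun i => (M i).carrier) i ((M i).left a m) j =
        (M j).left a (Pi.single (M := fun i => (M i).carrier) i m j)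
      rcases eq_or_ne j i with rfl | h
      · simp
      · simp [h])
    (fun b m => funext fun j => by
      change Pi.single (M := fun i => (M i).carrier) i ((M i).right b m) j =
        (M j).right b (Pi.single (M := fun i => (M i).carrier) i m j)
      rcases eq_or_ne j i with rfl | h
      · simp
      · simp [h])

theorem sum_pi {n : ℕ} (M : Fin n → Bimodule k A) :
    ∑ i, piProj M i ≫ piIncl M i = 𝟙 (pi M) := by
  refine toLin_injective (LinearMap.ext fun x => ?_)
  rw [sum_toLin]
  exact Finset.univ_sum_single (M := fun i => (M i).carrier) x

theorem piIncl_piProj {n : ℕ} (M : Fin n → Bimodule k A) (i : Fin n) :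
    piIncl M i ≫ piProj M i = 𝟙 (M i) :=
  toLin_injective <| LinearMap.ext fun x => Pi.single_eq_same (M := fun i => (M i).carrier) i x

theorem piIncl_piProj_ne {n : ℕ} (M : Fin n → Bimodule k A) {i j : Fin n} (h : i ≠ j) :
    piIncl M i ≫ piProj M j = 0 :=
  toLin_injective <| LinearMap.ext fun x =>
    Pi.single_eq_of_ne (M := fun i => (M i).carrier) h.symm x

/-- A subspace that is stable under both actions, as a bimodule. -/
def ofSubmodule (M : Bimodule k A) (S : Submodule k M.carrier)
    (hl : ∀ a, ∀ m ∈ S, M.left a m ∈ S) (hr : ∀ b, ∀ m ∈ S, M.right b m ∈ S) : Bimodule k A where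
  carrier := S
  left :=
    { toFun := fun a => (M.left a).restrict (hl a)
      map_one' := LinearMap.ext fun x => Subtype.ext (by simp)
      map_mul' := fun a b => LinearMap.ext fun x => Subtype.ext (by simp)
      map_zero' := LinearMap.ext fun x => Subtype.ext (by simp)
      map_add' := fun a b => LinearMap.ext fun x => Subtype.ext (by simp)
      commutes' := fun c => LinearMap.ext fun x => Subtype.ext (by
        simp [Module.algebraMap_end_apply]) }
  right :=
    { toFun := fun b => (M.right b).restrict (hr b)
      map_one' := LinearMap.ext fun x => Subtype.ext (by simp)
      map_mul' := fun a b => LinearMap.ext fun x => Subtype.ext (by simp)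
      map_zero' := LinearMap.ext fun x => Subtype.ext (by simp)
      map_add' := fun a b => LinearMap.ext fun x => Subtype.ext (by simp)
      commutes' := fun c => LinearMap.ext fun x => Subtype.ext (by
        simp only [AlgHom.commutes, LinearMap.coe_restrict_apply]
        simp [Module.algebraMap_end_apply]) }
  left_right a b m := Subtype.ext (M.left_right a b m)

/-- The image of a homomorphism of bimodules. -/
def range {M N : Bimodule k A} (f : M ⟶ N) : Bimodule k A :=
  ofSubmodule N (LinearMap.range (toLin f))
    (by rintro a _ ⟨m, rfl⟩; exact ⟨M.left a m, toLin_left f a m⟩)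
    (by rintro b _ ⟨m, rfl⟩; exact ⟨M.right b m, toLin_right f b m⟩)

/-- The inclusion of the image of a homomorphism. -/
def rangeIncl {M N : Bimodule k A} (f : M ⟶ N) : range f ⟶ N :=
  ofLin (M := range f) (LinearMap.range (toLin f)).subtype (fun _ _ => rfl) (fun _ _ => rfl)

/-- A homomorphism as a map to its image. -/
def toRange {M N : Bimodule k A} (f : M ⟶ N) : M ⟶ range f :=
  ofLin (N := range f) (LinearMap.rangeRestrict (toLin f))
    (fun a m => Subtype.ext (toLin_left f a m)) (fun b m => Subtype.ext (toLin_right f b m))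

theorem rangeIncl_toRange {M : Bimodule k A} (e : M ⟶ M) (he : e ≫ e = e) :
    rangeIncl e ≫ toRange e = 𝟙 (range e) :=
  toLin_injective <| LinearMap.ext fun ⟨_, m, hm⟩ => Subtype.ext (by
    subst hm
    exact LinearMap.congr_fun (congrArg toLin he) m)

instance finite_free [Module.Finite k A] : Module.Finite k (free k A).carrier :=
  inferInstanceAs (Module.Finite k (TensorProduct k A A))

instance finite_generator [Module.Finite k A] : Module.Finite k (generator k A).carrier :=
  inferInstanceAs (Module.Finite k (A × (free k A).carrier))

theorem InAdd.finite [Module.Finite k A] {M : Bimodule k A} (h : InAdd M) :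
    Module.Finite k M.carrier := by
  obtain ⟨n, s, r, h⟩ := h
  have : Module.Finite k (power (generator k A) n).carrier :=
    inferInstanceAs (Module.Finite k (Fin n → (generator k A).carrier))
  exact Module.Finite.of_surjective (toLin r) fun m =>
    ⟨toLin s m, LinearMap.congr_fun (congrArg toLin h) m⟩

end Bimodule

/-! ### Additive, idempotent split and linear structure on symmetric bimodules -/

namespace SymBimodule

open Bimodule Limits

variable {k : Type u} {A : Type v} [Field k] [Ring A] [Algebra k A] {ι : A ≃ₐ[k] A}
  {hι : Function.Involutive ι}

/-- The direct sum of finitely many symmetric bimodules. -/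
def pi {n : ℕ} (X : Fin n → SymBimodule ι hι) : SymBimodule ι hι where
  bimod := Bimodule.pi fun i => (X i).bimod
  inAdd := InAdd.of_sum' (fun i => (X i).bimod) (fun i => (X i).inAdd) _ _ (sum_pi _)
  sym := LinearMap.pi fun i => (X i).sym ∘ₗ LinearMap.proj i
  sym_left a _ := funext fun i => (X i).sym_left a _
  sym_right b _ := funext fun i => (X i).sym_right b _
  sym_sym _ := funext fun i => (X i).sym_sym _

theorem toHom_sum {X Y : SymBimodule ι hι} {J : Type*} (S : Finset J) (f : J → (X ⟶ Y)) :
    toHom (∑ j ∈ S, f j) = ∑ j ∈ S, toHom (f j) :=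
  map_sum (homs X Y).subtype f S

instance hasFiniteBiproducts : HasFiniteBiproducts (SymBimodule ι hι) where
  out n :=
    { has_biproduct := fun X => by
        let b : Bicone X :=
          { pt := pi X
            π := fun i => ofHom (piProj (fun i => (X i).bimod) i) fun _ => rfl
            ι := fun i => ofHom (piIncl (fun i => (X i).bimod) i) fun m => by
              funext j
              change Pi.single (M := fun i => (X i).bimod.carrier) i ((X i).sym m) j =
                (X j).sym (Pi.single (M := fun i => (X i).bimod.carrier) i m j)
              rcases eq_or_ne j i with rfl | h
              · simp
              · simp [h]
            ι_π := fun i j => by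
              split_ifs with h
              · subst h
                exact toHom_injective (piIncl_piProj _ i)
              · exact toHom_injective (piIncl_piProj_ne (fun i => (X i).bimod) h) }
        refine hasBiproduct_of_total b (toHom_injective ?_)
        rw [toHom_sum]
        exact sum_pi fun i => (X i).bimod }

/-- The image of an endomorphism of a symmetric bimodule that splits off. -/
def range {X : SymBimodule ι hι} (e : X ⟶ X) (he : e ≫ e = e) : SymBimodule ι hι where
  bimod := Bimodule.range (toHom e)
  inAdd := X.inAdd.of_retract (rangeIncl (toHom e)) (toRange (toHom e))
    (rangeIncl_toRange _ (congrArg toHom he))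
  sym := X.sym.restrict (p := LinearMap.range (toLin (toHom e)))
    (q := LinearMap.range (toLin (toHom e)))
    (by rintro _ ⟨m, rfl⟩; exact ⟨X.sym m, toHom_sym e m⟩)
  sym_left a m := Subtype.ext (X.sym_left a m.1)
  sym_right b m := Subtype.ext (X.sym_right b m.1)
  sym_sym m := Subtype.ext (X.sym_sym m.1)

instance isIdempotentComplete : IsIdempotentComplete (SymBimodule ι hι) where
  idempotents_split _ e he := ⟨range e he, ofHom (rangeIncl (toHom e)) fun _ => rfl,
    ofHom (toRange (toHom e)) fun m => Subtype.ext (toHom_sym e m),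
    toHom_injective (rangeIncl_toRange _ (congrArg toHom he)), rfl⟩

variable [Module.Finite k A]

instance finite_hom (X Y : SymBimodule ι hι) : Module.Finite k (X ⟶ Y) := by
  have := X.inAdd.finite
  have := Y.inAdd.finite
  let T : (X ⟶ Y) →ₗ[k] (X.bimod.carrier →ₗ[k] Y.bimod.carrier) :=
    { toFun := fun f => toLin (toHom f)
      map_add' := fun _ _ => rfl
      map_smul' := fun _ _ => rfl }
  exact Module.Finite.of_injective T fun f g h => toHom_injective (toLin_injective h)

instance monoidalPreadditive : MonoidalPreadditive (SymBimodule ι hι) where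
  whiskerLeft_zero := toHom_injective <| hom_tensor_ext fun m _ => map_zero (tmulₗ _ _ m)
  zero_whiskerRight {X _ _} := toHom_injective <| hom_tensor_ext fun _ n =>
    map_zero ((tmulₗ _ X.bimod).flip n)
  whiskerLeft_add _ _ := toHom_injective <| hom_tensor_ext fun _ _ => tmul_add _ _ _
  add_whiskerRight _ _ := toHom_injective <| hom_tensor_ext fun _ _ => add_tmul _ _ _

instance monoidalLinear : MonoidalLinear k (SymBimodule ι hι) where
  whiskerLeft_smul _ _ _ _ _ := toHom_injective <| hom_tensor_ext fun _ _ => tmul_smul _ _ _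
  smul_whiskerRight _ _ _ _ _ := toHom_injective <| hom_tensor_ext fun _ _ => smul_tmul _ _ _

end SymBimodule

/-! ### Four generators with signs, and the unit object -/

namespace SymBimodule

open Bimodule Limits MonoidalCategory

variable {k : Type u} {A : Type v} [Field k] [Ring A] [Algebra k A] {ι : A ≃ₐ[k] A}
  {hι : Function.Involutive ι}

/-- A sign, as a scalar. -/
def sgn (k : Type u) [Field k] (c : Bool) : k := if c then 1 else -1

theorem sgn_mul_sgn (c : Bool) : sgn k c * sgn k c = 1 := by
  cases c <;> simp [sgn]

/-- A symmetric bimodule with the symmetry multiplied by a sign. -/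
def twist (c : Bool) (X : SymBimodule ι hι) : SymBimodule ι hι where
  bimod := X.bimod
  inAdd := X.inAdd
  sym := sgn k c • X.sym
  sym_left a m := by simp [X.sym_left]
  sym_right b m := by simp [X.sym_right]
  sym_sym m := by simp [X.sym_sym, smul_smul, sgn_mul_sgn]

/-- The conjugate of a homomorphism by the symmetries. -/
def conj {X Y : SymBimodule ι hι} (f : X.bimod ⟶ Y.bimod) : X.bimod ⟶ Y.bimod :=
  ofLin (Y.sym ∘ₗ toLin f ∘ₗ X.sym)
    (fun a m => by simp [X.sym_left, toLin_left, Y.sym_left, hι a])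
    (fun b m => by
      obtain ⟨b, rfl⟩ := MulOpposite.op_surjective b
      simp [X.sym_right, toLin_right, Y.sym_right, hι b])

theorem conj_apply {X Y : SymBimodule ι hι} (f : X.bimod ⟶ Y.bimod) (m : X.bimod.carrier) :
    toLin (conj f) m = Y.sym (toLin f (X.sym m)) := rfl

/-- The sum of a homomorphism and its conjugate. -/
def symmetrize {X Y : SymBimodule ι hι} (f : X.bimod ⟶ Y.bimod) : X ⟶ Y :=
  ofHom (f + conj f) fun m => by
    simp [conj_apply, X.sym_sym, Y.sym_sym, add_comm]

/-- The symmetrized maps carry a sign in their conjugated parts. In the composite the sign enters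
squared or linearly; the linear terms cancel in the sum over both signs. -/
theorem sum_symmetrize {X Y : SymBimodule ι hι} (s : X.bimod ⟶ Y.bimod) (r : Y.bimod ⟶ X.bimod) :
    ∑ c, toHom (symmetrize (Y := twist c Y) s ≫ symmetrize (X := twist c Y) r) =
      (2 : k) • (s ≫ r + conj (X := X) (Y := X) (s ≫ r)) := by
  refine toLin_injective (LinearMap.ext fun m => ?_)
  rw [Fintype.sum_bool]
  let S := toLin s
  let R := toLin r
  let y (c : Bool) := S m + sgn k c • Y.sym (S (X.sym m))
  change (R (y true) + X.sym (R (sgn k true • Y.sym (y true)))) +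
    (R (y false) + X.sym (R (sgn k false • Y.sym (y false)))) =
      (2 : k) • (R (S m) + X.sym (R (S (X.sym m))))
  simp only [y, sgn, map_add, map_neg, Y.sym_sym, two_smul, smul_add, if_true, one_smul,
    Bool.false_eq_true, if_false, neg_smul]
  abel

/-- The two summands of `A ⊕ (A ⊗ A)`, with the symmetries `ι` and `ι ⊗ ι`. -/
def symSummand (ι : A ≃ₐ[k] A) (hι : Function.Involutive ι) : Bool → SymBimodule ι hι
  | true => unit ι hι
  | false =>
    { bimod := free k A
      inAdd := inAdd_free
      sym := TensorProduct.map ι.toLinearMap ι.toLinearMap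
      sym_left := fun a => LinearMap.congr_fun
        (f := TensorProduct.map ι.toLinearMap ι.toLinearMap ∘ₗ (free k A).left a)
        (g := (free k A).left (ι a) ∘ₗ TensorProduct.map ι.toLinearMap ι.toLinearMap)
        (free_ext fun x y => by
          change freeMk (ι (a * x)) (ι y) = freeMk (ι a * ι x) (ι y)
          rw [map_mul])
      sym_right := fun b => LinearMap.congr_fun
        (f := TensorProduct.map ι.toLinearMap ι.toLinearMap ∘ₗ
          (free k A).right (MulOpposite.op b))
        (g := (free k A).right (MulOpposite.op (ι b)) ∘ₗ
          TensorProduct.map ι.toLinearMap ι.toLinearMap)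
        (free_ext fun x y => by
          change freeMk (ι x) (ι (y * b)) = freeMk (ι x) (ι y * ι b)
          rw [map_mul])
      sym_sym := LinearMap.congr_fun
        (f := TensorProduct.map ι.toLinearMap ι.toLinearMap ∘ₗ
          TensorProduct.map ι.toLinearMap ι.toLinearMap) (g := LinearMap.id)
        (free_ext fun x y => by
          change freeMk (ι (ι x)) (ι (ι y)) = freeMk x y
          rw [hι, hι]) }

theorem symSummand_bimod (b : Bool) : (symSummand ι hι b).bimod = summand b := by
  cases b <;> rfl

theorem exists_sum_summand (X : SymBimodule ι hι) :
    ∃ (J : Type) (_ : Fintype J) (t : J → Bool) (s : ∀ j, X.bimod ⟶ (symSummand ι hι (t j)).bimod)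
      (r : ∀ j, (symSummand ι hι (t j)).bimod ⟶ X.bimod), ∑ j, s j ≫ r j = 𝟙 X.bimod := by
  obtain ⟨n, s, r, h⟩ := X.inAdd.exists_sum
  refine ⟨Fin n × Bool, inferInstance, Prod.snd,
    fun j => s j.1 ≫ toSummand j.2 ≫ eqToHom (symSummand_bimod j.2).symm,
    fun j => eqToHom (symSummand_bimod j.2) ≫ ofSummand j.2 ≫ r j.1, ?_⟩
  rw [Fintype.sum_prod_type, ← h]
  refine Finset.sum_congr rfl fun i _ => ?_
  calc _ = s i ≫ (∑ b, toSummand b ≫ ofSummand b) ≫ r i := by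
        simp
    _ = _ := by rw [sum_summand, Category.id_comp]

/-- The four generators: the two summands of `A ⊕ (A ⊗ A)` with signs. -/
def gen (ι : A ≃ₐ[k] A) (hι : Function.Involutive ι) (t : Bool × Bool) : SymBimodule ι hι :=
  twist t.1 (symSummand ι hι t.2)

theorem exists_sum_gen (hk : (2 : k) ≠ 0) (X : SymBimodule ι hι) :
    ∃ (J : Type) (_ : Fintype J) (t : J → Bool × Bool) (s : ∀ j, X ⟶ gen ι hι (t j))
      (r : ∀ j, gen ι hι (t j) ⟶ X), ∑ j, s j ≫ r j = 𝟙 X := by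
  obtain ⟨J, _, t, s, r, h⟩ := X.exists_sum_summand
  refine ⟨J × Bool, inferInstance, fun j => (j.2, t j.1), fun j => symmetrize (s j.1),
    -- One factor 2 comes from the sum over the signs, the other from a map plus its conjugate when
    -- the total is the identity.
    fun j => (4⁻¹ : k) • symmetrize (X := gen ι hι (j.2, t j.1)) (r j.1), toHom_injective ?_⟩
  simp only [Linear.comp_smul]
  rw [← Finset.smul_sum, toHom_smul, Fintype.sum_prod_type, toHom_sum]
  have h4 : (4 : k) ≠ 0 := by
    rw [show (4 : k) = 2 * 2 by norm_num]; exact mul_ne_zero hk hk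
  have key : ∀ j, toHom (∑ c, symmetrize (X := X) (Y := gen ι hι (c, t j)) (s j) ≫
      symmetrize (X := gen ι hι (c, t j)) (Y := X) (r j)) =
      (2 : k) • (s j ≫ r j + conj (X := X) (Y := X) (s j ≫ r j)) := fun j => by
    rw [toHom_sum]
    exact sum_symmetrize (X := X) (Y := symSummand ι hι (t j)) (s j) (r j)
  rw [Finset.sum_congr rfl fun j _ => key j, ← Finset.smul_sum, Finset.sum_add_distrib, h]
  -- The conjugate of the identity is the square of the symmetry, which is the identity.
  have hconj : ∑ j, conj (X := X) (Y := X) (s j ≫ r j) = 𝟙 X.bimod := by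
    refine toLin_injective (LinearMap.ext fun m => ?_)
    rw [sum_toLin]
    simp only [conj_apply]
    rw [← map_sum, ← sum_toLin, h]
    exact X.sym_sym m
  rw [hconj, ← two_smul k (𝟙 X.bimod), smul_smul, smul_smul,
    show (4⁻¹ * 2 * 2 : k) = 1 by
      rw [mul_assoc, show (2 * 2 : k) = 4 by norm_num, inv_mul_cancel₀ h4],
    one_smul]
  rfl

/-- Left and right linearity give `f x = x * f 1 = f 1 * x`, so `f` is multiplication by the central
element `f 1`, which is idempotent because `e` is. -/
theorem unit_idempotent (hA : IsConnectedRing A) (e : unit ι hι ⟶ unit ι hι) (he : e ≫ e = e) :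
    e = 0 ∨ e = 𝟙 _ := by
  let f : A →ₗ[k] A := toLin (toHom e)
  have hl (a x : A) : f (a * x) = a * f x := toLin_left (toHom e) a x
  have hr (x b : A) : f (x * b) = f x * b := toLin_right (toHom e) (MulOpposite.op b) x
  have hf (x : A) : f x = x * f 1 := by rw [← hl, mul_one]
  have hf' (x : A) : f x = f 1 * x := by rw [← hr, one_mul]
  have hff : f (f 1) = f 1 := LinearMap.congr_fun (congrArg (fun g => toLin (toHom g)) he) (1 : A)
  rcases hA.2 (f 1) (Semigroup.mem_center_iff.2 fun x => by rw [← hf, ← hf']) (by rw [← hf, hff])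
    with h | h
  · exact .inl (toHom_injective (toLin_injective (LinearMap.ext fun (x : A) =>
      (hf x).trans (by rw [h, mul_zero]; rfl))))
  · exact .inr (toHom_injective (toLin_injective (LinearMap.ext fun (x : A) =>
      (hf x).trans (by rw [h, mul_one]; rfl))))

theorem not_isZero_unit [Nontrivial A] : ¬ IsZero (unit ι hι) := fun h => by
  have := LinearMap.congr_fun (congrArg (fun g => toLin (toHom g)) (h.eq_of_src (𝟙 _) 0)) (1 : A)
  exact one_ne_zero (α := A) this

end SymBimodule

/-! ### Self-injectivity and the dual of the regular module -/

section DualBasis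

variable {k : Type u} {A : Type v} [Field k] [Ring A] [Algebra k A]

/-- The canonical element `∑ eᵢ ⊗ eᵢ*` is invariant under all endomorphisms. -/
theorem sum_basis_coord_comp {n : ℕ} (e : Module.Basis (Fin n) k A) {P : Type w} [AddCommGroup P]
    [Module k P] (B : A →ₗ[k] Module.Dual k A →ₗ[k] P) (T : A →ₗ[k] A) :
    ∑ i, B (T (e i)) (e.coord i) = ∑ i, B (e i) (e.coord i ∘ₗ T) := by
  have h1 (i : Fin n) : B (T (e i)) (e.coord i) =
      ∑ j, e.coord j (T (e i)) • B (e j) (e.coord i) := by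
    conv_lhs => rw [← e.sum_repr (T (e i)), map_sum, LinearMap.sum_apply]
    simp only [map_smul, LinearMap.smul_apply, Module.Basis.coord_apply]
  have h2 (j : Fin n) : B (e j) (e.coord j ∘ₗ T) =
      ∑ i, e.coord j (T (e i)) • B (e j) (e.coord i) := by
    conv_lhs => rw [← e.sum_dual_apply_smul_coord (e.coord j ∘ₗ T)]
    simp [map_sum]
  simp only [h1, h2]
  exact Finset.sum_comm

variable (k A) in
/-- The space of endomorphisms of `A`, with the action `(c g) x = g (x c)`. -/
def PreMul : Type v := A →ₗ[k] A

instance : AddCommGroup (PreMul k A) := inferInstanceAs (AddCommGroup (A →ₗ[k] A))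

instance : Module A (PreMul k A) where
  smul c g := LinearMap.comp (show A →ₗ[k] A from g) (LinearMap.mulRight k c)
  one_smul g := LinearMap.ext fun x => congrArg g.toFun (mul_one x)
  mul_smul c d g := LinearMap.ext fun x => congrArg g.toFun (mul_assoc x c d).symm
  smul_zero _ := rfl
  smul_add _ _ _ := rfl
  add_smul c d g := LinearMap.ext fun x => (congrArg g.toFun (mul_add x c d)).trans
    (map_add (show A →ₗ[k] A from g) _ _)
  zero_smul g := LinearMap.ext fun x => (congrArg g.toFun (mul_zero x)).trans
    (map_zero (show A →ₗ[k] A from g))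

/-- If `A` is self-injective, then the embedding of `A` into its endomorphisms splits. -/
theorem IsSelfInjective.exists_retraction (hA : IsSelfInjective A) :
    ∃ q : (A →ₗ[k] A) →ₗ[k] A, (∀ g c, q (g ∘ₗ LinearMap.mulRight k c) = c * q g) ∧
      ∀ a, q (LinearMap.mulRight k a) = a := by
  let j : A →ₗ[A] PreMul k A :=
    { toFun := fun a => LinearMap.mulRight k a
      map_add' := fun a b => LinearMap.ext fun x => mul_add x a b
      map_smul' := fun c a => LinearMap.ext fun x => (mul_assoc x c a).symm }
  obtain ⟨q, hq⟩ := Module.Injective.out (self := hA) j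
    (fun a b h => by
      have h' : 1 * a = 1 * b := LinearMap.congr_fun (f := LinearMap.mulRight k a) h 1
      simpa using h') LinearMap.id
  have hq' (g : A →ₗ[k] A) (c : A) :
      q (show PreMul k A from g ∘ₗ LinearMap.mulRight k c) = c * q g := q.map_smul c g
  refine ⟨{ toFun := fun g => q g, map_add' := fun g g' => q.map_add g g', map_smul' := ?_ },
    hq', hq⟩
  intro r g
  -- Scalars act through their images in `A`, so linearity over `A` implies linearity over `k`.
  have : r • g = g ∘ₗ LinearMap.mulRight k (algebraMap k A r) := LinearMap.ext fun x => by
    simp [← Algebra.commutes, ← Algebra.smul_def]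
  rw [this]
  exact (hq' g _).trans (Algebra.smul_def r (q g)).symm

/-- If `A` is self-injective, then the dual of the left module `A` is a direct summand of a free
right module. -/
theorem IsSelfInjective.exists_dual_retraction (hA : IsSelfInjective A) {n : ℕ}
    (e : Module.Basis (Fin n) k A) :
    ∃ s : Fin n → Module.Dual k A →ₗ[k] A,
      (∀ i f a, s i (f ∘ₗ LinearMap.mulLeft k a) = s i f * a) ∧
      ∀ f x, ∑ i, e.coord i (s i f * x) = f x := by
  obtain ⟨q, hq, hq1⟩ := hA.exists_retraction (k := k)
  -- This is the transpose of `q`: identifying End(A) with n copies of A* by the basis, `s i f` is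
  -- the element on which every form `φ` takes the value of `f` at `q` of the rank one map `x ↦ φ x
  -- • e i`, as `hs` states.
  let s (i : Fin n) : Module.Dual k A →ₗ[k] A :=
    { toFun := fun f => ∑ j, f (q ((e.coord j).smulRight (e i))) • e j
      map_add' := fun f g => by simp [add_smul, Finset.sum_add_distrib]
      map_smul' := fun c f => by simp [mul_smul, Finset.smul_sum] }
  have hs (i : Fin n) (f φ : Module.Dual k A) : φ (s i f) = f (q (φ.smulRight (e i))) := by
    have : φ.smulRight (e i) = ∑ j, φ (e j) • (e.coord j).smulRight (e i) := by
      conv_lhs => rw [← e.sum_dual_apply_smul_coord φ]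
      ext x
      simp only [LinearMap.smulRight_apply, LinearMap.sum_apply, LinearMap.smul_apply,
        Finset.sum_smul, smul_assoc]
    rw [this]
    simp [s, map_sum, mul_comm]
  refine ⟨s, fun i f a => ?_, fun f x => ?_⟩
  · refine e.ext_elem fun l => ?_
    change e.coord l _ = (e.coord l ∘ₗ LinearMap.mulRight k a) (s i f)
    rw [hs, hs, LinearMap.comp_apply, LinearMap.mulLeft_apply, ← hq]
    rfl
  · have h (i : Fin n) : e.coord i (s i f * x) =
        f (q ((e.coord i ∘ₗ LinearMap.mulRight k x).smulRight (e i))) :=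
      hs i f (e.coord i ∘ₗ LinearMap.mulRight k x)
    simp only [h]
    rw [← map_sum, ← map_sum]
    -- The rank one maps add up to right multiplication by `x`, which the retraction `q` sends back
    -- to `x`.
    have : ∑ i, (e.coord i ∘ₗ LinearMap.mulRight k x).smulRight (e i) = LinearMap.mulRight k x := by
      ext y
      simp [LinearMap.sum_apply]
    rw [this, hq1]

end DualBasis

/-! ### The bimodule End(A) lies in add(A ⊕ A ⊗ A) -/

namespace Bimodule

open MonoidalCategory

variable {k : Type u} {A : Type v} [Field k] [Ring A] [Algebra k A]

variable (k A) in
/-- The bimodule of linear endomorphisms of `A`, with `(a g b) x = a g (b x)`. It is the right dual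
of `A ⊗ A`. -/
def endo : Bimodule k A where
  carrier := A →ₗ[k] A
  left :=
    { toFun := fun a => LinearMap.compRight k (LinearMap.mulLeft k a)
      map_one' := LinearMap.ext fun g => LinearMap.ext fun x => by simp
      map_mul' := fun a b => LinearMap.ext fun g => LinearMap.ext fun x => by simp
      map_zero' := LinearMap.ext fun g => LinearMap.ext fun x => by simp
      map_add' := fun a b => LinearMap.ext fun g => LinearMap.ext fun x => by simp [add_mul]
      commutes' := fun c => LinearMap.ext fun g => LinearMap.ext fun x => by
        simp [Module.algebraMap_end_apply, ← Algebra.smul_def] }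
  right :=
    { toFun := fun b => LinearMap.lcomp k A (LinearMap.mulLeft k b.unop)
      map_one' := LinearMap.ext fun g => LinearMap.ext fun x => by simp
      map_mul' := fun a b => LinearMap.ext fun g => LinearMap.ext fun x => by simp
      map_zero' := LinearMap.ext fun g => LinearMap.ext fun x => by simp
      map_add' := fun a b => LinearMap.ext fun g => LinearMap.ext fun x => by simp [add_mul]
      commutes' := fun c => LinearMap.ext fun g => LinearMap.ext fun x => by
        simp [Module.algebraMap_end_apply, ← Algebra.smul_def] }
  left_right a b g := rfl

/-- A linear endomorphism of `A` as an element of the bimodule. -/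
def endoMk (g : A →ₗ[k] A) : (endo k A).carrier := g

/-- A linear form on `A` as an element of the bimodule of endomorphisms. -/
def endoForm : Module.Dual k A →ₗ[k] (endo k A).carrier :=
  LinearMap.compRight k (LinearMap.toSpanSingleton k A 1)

/-- The homomorphism `a ⊗ y ↦ (x ↦ f (y x) a)`. -/
def freeToEndo (f : Module.Dual k A) : free k A ⟶ endo k A :=
  let T : (free k A).carrier →ₗ[k] (endo k A).carrier :=
    freeLift <| LinearMap.mk₂ k (fun a y => endoMk ((f ∘ₗ LinearMap.mulLeft k y).smulRight a))
      (fun a a' y => LinearMap.ext fun x => smul_add (f (y * x)) a a')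
      (fun c a y => LinearMap.ext fun x => smul_comm (f (y * x)) c a)
      (fun a y y' => LinearMap.ext fun x => by
        change f ((y + y') * x) • a = f (y * x) • a + f (y' * x) • a
        rw [add_mul, map_add, add_smul])
      (fun c a y => LinearMap.ext fun x => by
        change f ((c • y) * x) • a = c • f (y * x) • a
        rw [smul_mul_assoc, map_smul, smul_assoc])
  ofLin T
    (fun a => LinearMap.congr_fun (f := T ∘ₗ (free k A).left a) (g := (endo k A).left a ∘ₗ T)
      (free_ext fun y z => LinearMap.ext fun x => by
        change f (z * x) • (a * y) = a * f (z * x) • y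
        rw [mul_smul_comm]))
    (fun b => LinearMap.congr_fun (f := T ∘ₗ (free k A).right b) (g := (endo k A).right b ∘ₗ T)
      (free_ext fun y z => LinearMap.ext fun x => by
        change f (z * b.unop * x) • y = f (z * (b.unop * x)) • y
        rw [mul_assoc]))

/-- The bilinear map `(a, y) ↦ a ⊗ y`. -/
def freeMkₗ : A →ₗ[k] A →ₗ[k] (free k A).carrier :=
  LinearMap.mk₂ k freeMk add_freeMk smul_freeMk freeMk_add freeMk_smul

theorem freeMkₗ_apply (a y : A) : freeMkₗ (k := k) a y = freeMk a y := rfl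

/-- The homomorphism `g ↦ ∑ eᵢ ⊗ s (eᵢ* ∘ g)` given by a homomorphism `s` from the dual of `A` to
`A`. -/
def endoToFree {n : ℕ} (e : Module.Basis (Fin n) k A) (s : Module.Dual k A →ₗ[k] A)
    (hs : ∀ f a, s (f ∘ₗ LinearMap.mulLeft k a) = s f * a) : endo k A ⟶ free k A :=
  ofLin (M := endo k A)
    { toFun := fun (g : A →ₗ[k] A) => ∑ i, freeMkₗ (e i) (s (e.coord i ∘ₗ g))
      map_add' := fun (g g' : A →ₗ[k] A) => by
        change ∑ i, freeMkₗ (e i) (s (e.coord i ∘ₗ (g + g'))) = _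
        simp only [LinearMap.comp_add, map_add, Finset.sum_add_distrib]
      map_smul' := fun c (g : A →ₗ[k] A) => by
        change ∑ i, freeMkₗ (e i) (s (e.coord i ∘ₗ (c • g))) = _
        simp only [LinearMap.comp_smul, map_smul, Finset.smul_sum, RingHom.id_apply] }
    (fun a g => by
      change ∑ i, freeMk (e i) (s (e.coord i ∘ₗ (LinearMap.mulLeft k a ∘ₗ g))) =
        (free k A).left a (∑ i, freeMk (e i) (s (e.coord i ∘ₗ g)))
      rw [map_sum]
      exact (sum_basis_coord_comp e ((freeMkₗ (k := k)).compl₂ (s ∘ₗ LinearMap.lcomp k k g))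
        (LinearMap.mulLeft k a)).symm)
    (fun b g => by
      change ∑ i, freeMk (e i) (s ((e.coord i ∘ₗ g) ∘ₗ LinearMap.mulLeft k b.unop)) =
        (free k A).right b (∑ i, freeMk (e i) (s (e.coord i ∘ₗ g)))
      rw [map_sum]
      simp only [hs]
      rfl)

theorem endoToFree_apply {n : ℕ} (e : Module.Basis (Fin n) k A) (s : Module.Dual k A →ₗ[k] A)
    (hs) (g : A →ₗ[k] A) :
    toLin (endoToFree e s hs) (endoMk g) = ∑ i, freeMk (e i) (s (e.coord i ∘ₗ g)) := rfl

/-- As a bimodule End(A) is A ⊗ A*, with A* as a right module. Self-injectivity makes A* a summand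
of a free right module, and tensoring with A makes End(A) a summand of copies of A ⊗ A. -/
theorem inAdd_endo [Module.Finite k A] (hA : IsSelfInjective A) : InAdd (endo k A) := by
  let e := Module.finBasis k A
  obtain ⟨s, hs, hsum⟩ := hA.exists_dual_retraction e
  refine InAdd.of_sum' (fun _ => free k A) (fun _ => inAdd_free)
    (fun i => endoToFree e (s i) (hs i)) (fun i => freeToEndo (e.coord i)) ?_
  refine toLin_injective (LinearMap.ext fun (g : A →ₗ[k] A) => ?_)
  refine (sum_toLin Finset.univ _ (endoMk g)).trans ?_
  refine LinearMap.ext fun x => ?_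
  have h1 (i : Fin _) : toLin (endoToFree e (s i) (hs i) ≫ freeToEndo (e.coord i)) (endoMk g) =
      ∑ j, (e.coord i ∘ₗ LinearMap.mulLeft k (s i (e.coord j ∘ₗ g))).smulRight (e j) := by
    rw [toLin_comp, LinearMap.comp_apply]
    refine (congrArg _ (endoToFree_apply e (s i) (hs i) g)).trans ?_
    rw [map_sum]
    rfl
  rw [Finset.sum_congr rfl fun i _ => h1 i]
  refine (LinearMap.sum_apply _ _ _).trans ?_
  simp only [LinearMap.sum_apply]
  rw [Finset.sum_comm]
  -- For fixed `j` the sum over `i` is the splitting of A* applied to the form `e.coord j ∘ₗ g`.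
  have h2 (j : Fin _) : ∑ i, ((e.coord i ∘ₗ LinearMap.mulLeft k (s i (e.coord j ∘ₗ g))).smulRight
      (e j)) x = e.coord j (g x) • e j := by
    rw [← LinearMap.comp_apply (e.coord j), ← hsum, Finset.sum_smul]
    rfl
  rw [Finset.sum_congr rfl fun j _ => h2 j]
  exact e.sum_repr (g x)

end Bimodule

/-! ### The exact pairing between A ⊗ A and End(A) -/

namespace Bimodule

open MonoidalCategory

variable {k : Type u} {A : Type v} [Field k] [Ring A] [Algebra k A]

/-- The canonical element `∑ (eᵢ ⊗ 1) ⊗ eᵢ*` of `(A ⊗ A) ⊗_A End A`. -/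
def canonical {n : ℕ} (e : Module.Basis (Fin n) k A) : (tensor (free k A) (endo k A)).carrier :=
  ∑ i, tmul (freeMk (e i) 1) (endoForm (e.coord i))

/-- The bilinear map `(a, f) ↦ (a ⊗ 1) ⊗ f`. -/
def canonicalₗ : A →ₗ[k] Module.Dual k A →ₗ[k] (tensor (free k A) (endo k A)).carrier :=
  (tmulₗ (free k A) (endo k A)).compl₁₂ ((freeMkₗ (k := k)).flip 1) endoForm

/-- Left multiplication on the basis vectors can be moved to precomposition on the dual basis, which
is the right action on End(A). This makes the coevaluation right linear. -/
theorem canonical_central {n : ℕ} (e : Module.Basis (Fin n) k A) (a : A) :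
    (tensor (free k A) (endo k A)).left a (canonical e) =
      (tensor (free k A) (endo k A)).right (MulOpposite.op a) (canonical e) := by
  rw [canonical, map_sum, map_sum]
  exact sum_basis_coord_comp e canonicalₗ (LinearMap.mulLeft k a)

/-- The coevaluation `1 ↦ ∑ (eᵢ ⊗ 1) ⊗ eᵢ*`. -/
def freeCoev {n : ℕ} (e : Module.Basis (Fin n) k A) :
    regular k A ⟶ tensor (free k A) (endo k A) :=
  let T : A →ₗ[k] (tensor (free k A) (endo k A)).carrier :=
    (tensor (free k A) (endo k A)).left.toLinearMap.flip (canonical e)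
  ofLin (M := regular k A) T
    (fun a (x : A) => by
      change (tensor (free k A) (endo k A)).left (a * x) _ = _
      rw [map_mul]; rfl)
    (fun b (x : A) => by
      obtain ⟨b, rfl⟩ := MulOpposite.op_surjective b
      change (tensor (free k A) (endo k A)).left (x * b) _ =
        (tensor (free k A) (endo k A)).right (MulOpposite.op b)
          ((tensor (free k A) (endo k A)).left x _)
      rw [map_mul, Module.End.mul_apply, canonical_central, left_right])

theorem freeCoev_apply {n : ℕ} (e : Module.Basis (Fin n) k A) (x : A) :
    toLin (freeCoev e) (reg x) = (tensor (free k A) (endo k A)).left x (canonical e) := rfl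

theorem freeCoev_one {n : ℕ} (e : Module.Basis (Fin n) k A) :
    toLin (freeCoev e) (reg 1) = canonical e := by
  rw [freeCoev_apply, map_one]; rfl

/-- The evaluation `g ⊗ (a ⊗ y) ↦ g a y`. -/
def freeEv : tensor (endo k A) (free k A) ⟶ regular k A :=
  let T : (endo k A).carrier →ₗ[k] (free k A).carrier →ₗ[k] A :=
    { toFun := fun g => freeLift (LinearMap.mul k A ∘ₗ (show A →ₗ[k] A from g))
      map_add' := fun g g' => free_ext fun a y => add_mul (g.toFun a) (g'.toFun a) y
      map_smul' := fun c g => free_ext fun a y => smul_mul_assoc c (g.toFun a) y }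
  ofTensor (P := regular k A) (lift T fun g a => LinearMap.congr_fun
      (f := T ((endo k A).right (MulOpposite.op a) g)) (g := T g ∘ₗ (free k A).left a)
      (free_ext fun _ _ => rfl))
    (fun a g => LinearMap.congr_fun (f := T ((endo k A).left a g))
      (g := LinearMap.mulLeft k a ∘ₗ T g) (free_ext fun x y => mul_assoc a (g.toFun x) y))
    (fun b g => LinearMap.congr_fun (f := T g ∘ₗ (free k A).right b)
      (g := LinearMap.mulRight k b.unop ∘ₗ T g)
      (free_ext fun x y => (mul_assoc (g.toFun x) y b.unop).symm))

theorem freeCoev_freeEv {n : ℕ} (e : Module.Basis (Fin n) k A) :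
    freeCoev e ▷ free k A ≫ (α_ (free k A) (endo k A) (free k A)).hom ≫ free k A ◁ freeEv =
      (λ_ (free k A)).hom ≫ (ρ_ (free k A)).inv := by
  -- After the unitors are moved to one side the claim is that an endomorphism of A ⊗ A is the
  -- identity. It sends a ⊗ b to the sum of eᵢ ⊗ eᵢ*(a) b, the expansion of a in the basis.
  rw [← Iso.inv_comp_eq, ← cancel_mono (ρ_ (free k A)).hom, Iso.inv_hom_id]
  refine toLin_injective (free_ext fun a b => ?_)
  have h : toLin (freeCoev e ▷ free k A ≫ (α_ (free k A) (endo k A) (free k A)).hom ≫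
      free k A ◁ freeEv ≫ (ρ_ (free k A)).hom) (tmul (reg 1) (freeMk a b)) = freeMk a b := by
    change toLin ((α_ (free k A) (endo k A) (free k A)).hom ≫
      free k A ◁ freeEv ≫ (ρ_ (free k A)).hom)
        (tmul (toLin (freeCoev e) (reg 1)) (freeMk a b)) = _
    rw [freeCoev_one, canonical, ← tmulₗ_apply, map_sum, LinearMap.sum_apply, map_sum]
    have h1 (i : Fin n) : toLin ((α_ (free k A) (endo k A) (free k A)).hom ≫
        free k A ◁ freeEv ≫ (ρ_ (free k A)).hom)
          (tmulₗ _ _ (tmul (freeMk (e i) 1) (endoForm (e.coord i))) (freeMk a b)) =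
        freeMk (e.repr a i • e i) b := by
      change freeMk (e i) (1 * ((e.repr a i • (1 : A)) * b)) = _
      rw [one_mul, smul_mul_assoc, one_mul, freeMk_smul, smul_freeMk]
    refine (Finset.sum_congr rfl fun i _ => h1 i).trans ?_
    change ∑ i, (freeMkₗ (k := k)).flip b (e.repr a i • e i) = (freeMkₗ (k := k)).flip b a
    rw [← map_sum, e.sum_repr]
  exact h

theorem freeEv_freeCoev {n : ℕ} (e : Module.Basis (Fin n) k A) :
    endo k A ◁ freeCoev e ≫ (α_ (endo k A) (free k A) (endo k A)).inv ≫ freeEv ▷ endo k A =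
      (ρ_ (endo k A)).hom ≫ (λ_ (endo k A)).inv := by
  -- Here the endomorphism sends g to the sum of the maps x ↦ eᵢ*(x) g(eᵢ), which is g by linearity.
  rw [← Iso.inv_comp_eq, ← cancel_mono (λ_ (endo k A)).hom, Iso.inv_hom_id]
  refine toLin_injective (LinearMap.ext fun (g : A →ₗ[k] A) => ?_)
  have h : toLin (endo k A ◁ freeCoev e ≫ (α_ (endo k A) (free k A) (endo k A)).inv ≫
      freeEv ▷ endo k A ≫ (λ_ (endo k A)).hom) (tmul (endoMk g) (reg 1)) = endoMk g := by
    change toLin ((α_ (endo k A) (free k A) (endo k A)).inv ≫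
      freeEv ▷ endo k A ≫ (λ_ (endo k A)).hom)
        (tmul (endoMk g) (toLin (freeCoev e) (reg 1))) = _
    rw [freeCoev_one, canonical, ← tmulₗ_apply, map_sum, map_sum]
    have h1 (i : Fin n) : toLin ((α_ (endo k A) (free k A) (endo k A)).inv ≫
        freeEv ▷ endo k A ≫ (λ_ (endo k A)).hom)
          (tmulₗ _ _ (endoMk g) (tmul (freeMk (e i) 1) (endoForm (e.coord i)))) =
        endoMk ((e.coord i).smulRight (g (e i))) := by
      refine LinearMap.ext fun x => ?_
      change g (e i) * 1 * e.repr x i • (1 : A) = e.repr x i • g (e i)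
      rw [mul_one, mul_smul_comm, mul_one]
    refine (Finset.sum_congr rfl fun i _ => h1 i).trans ?_
    refine LinearMap.ext fun x => ?_
    refine (LinearMap.sum_apply _ (fun i => (e.coord i).smulRight (g (e i))) x).trans ?_
    change ∑ i, e.repr x i • g (e i) = g x
    conv_rhs => rw [← e.sum_repr x, map_sum]
    simp only [map_smul]
  exact h

end Bimodule

/-! ### Right duals of the four generators -/

namespace SymBimodule

open Bimodule MonoidalCategory ExactPairing

variable {k : Type u} {A : Type v} [Field k] [Ring A] [Algebra k A] [Module.Finite k A]
  {ι : A ≃ₐ[k] A} {hι : Function.Involutive ι}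

/-- The bimodule of linear endomorphisms of `A`, with the symmetry `g ↦ ι g ι`. -/
def symEndo (hA : IsSelfInjective A) (ι : A ≃ₐ[k] A) (hι : Function.Involutive ι) :
    SymBimodule ι hι where
  bimod := endo k A
  inAdd := inAdd_endo hA
  sym := LinearMap.compRight k ι.toLinearMap ∘ₗ LinearMap.lcomp k A ι.toLinearMap
  sym_left a g := LinearMap.ext fun x => map_mul ι a (g.toFun (ι x))
  sym_right b g := LinearMap.ext fun x => by
    change ι (g.toFun (b * ι x)) = ι (g.toFun (ι (ι b * x)))
    rw [map_mul ι, hι]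
  sym_sym g := LinearMap.ext fun x => by
    change ι (ι (g.toFun (ι (ι x)))) = g.toFun x
    rw [hι, hι]

/-- The symmetry applies `ι` to the basis vectors and precomposes the dual basis with `ι`.
Invariance of the canonical element combines the two into `ι ∘ ι`, the identity. Hence the
coevaluation commutes with the symmetries. -/
theorem canonical_sym (hA : IsSelfInjective A) {n : ℕ} (e : Module.Basis (Fin n) k A) :
    (tensor (symSummand ι hι false) (symEndo hA ι hι)).sym (canonical e) = canonical e := by
  have h1 (f : Module.Dual k A) : (symEndo hA ι hι).sym (endoForm f) =
      endoForm (f ∘ₗ ι.toLinearMap) := LinearMap.ext fun x => by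
    change ι (f (ι x) • (1 : A)) = f (ι x) • (1 : A)
    rw [map_smul, map_one]
  have h2 (i : Fin n) : (tensor (symSummand ι hι false) (symEndo hA ι hι)).sym
      (tmul (freeMk (e i) 1) (endoForm (e.coord i))) =
      tmul (freeMk (ι (e i)) 1) (endoForm (e.coord i ∘ₗ ι.toLinearMap)) := by
    refine (tensor_sym_tmul _ _ _ _).trans ?_
    rw [← h1]
    change tmul (freeMk (ι (e i)) (ι 1)) _ = _
    rw [map_one]
    rfl
  refine (map_sum (tensor (symSummand ι hι false) (symEndo hA ι hι)).sym _ _).trans ?_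
  refine (Finset.sum_congr rfl fun i _ => h2 i).trans ?_
  refine (sum_basis_coord_comp e
    ((canonicalₗ (k := k)).compl₂ (LinearMap.lcomp k k ι.toLinearMap)) ι.toLinearMap).trans ?_
  refine Finset.sum_congr rfl fun i _ => congrArg (fun f => tmul (freeMk (e i) 1) (endoForm f)) ?_
  exact LinearMap.ext fun x => congrArg (e.coord i) (hι x)

/-- The exact pairing between `A ⊗ A` and the endomorphisms of `A`. -/
theorem nonempty_freePairing (hA : IsSelfInjective A) :
    Nonempty (ExactPairing (symSummand ι hι false) (symEndo hA ι hι)) := ⟨{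
  coevaluation' := ofHom (X := unit ι hι)
    (Y := tensor (symSummand ι hι false) (symEndo hA ι hι)) (freeCoev (Module.finBasis k A))
    fun (x : A) => by
      change (Bimodule.tensor (free k A) (endo k A)).left (ι x) _ =
        (tensor (symSummand ι hι false) (symEndo hA ι hι)).sym
          ((Bimodule.tensor (free k A) (endo k A)).left x _)
      refine Eq.trans ?_ ((tensor (symSummand ι hι false) (symEndo hA ι hι)).sym_left x _).symm
      rw [canonical_sym]
      rfl
  evaluation' := ofHom (X := tensor (symEndo hA ι hι) (symSummand ι hι false)) (Y := unit ι hι)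
    freeEv <| LinearMap.congr_fun
      (f := toLin freeEv ∘ₗ (tensor (symEndo hA ι hι) (symSummand ι hι false)).sym)
      (g := (unit ι hι).sym ∘ₗ toLin freeEv)
      (tensor_ext fun (g : A →ₗ[k] A) => LinearMap.congr_fun
        (f := toLin freeEv ∘ₗ tmulₗ _ _ ((symEndo hA ι hι).sym g) ∘ₗ
          (symSummand ι hι false).sym)
        (g := (unit ι hι).sym ∘ₗ toLin freeEv ∘ₗ tmulₗ _ _ g)
        (free_ext fun a y => by
          change ι (g (ι (ι a))) * ι y = ι (g a * y)
          rw [hι, map_mul]))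
  coevaluation_evaluation' := toHom_injective (freeEv_freeCoev (Module.finBasis k A))
  evaluation_coevaluation' := toHom_injective (freeCoev_freeEv (Module.finBasis k A)) }⟩

/-- Multiplying both symmetries by a sign preserves exact pairings. -/
theorem nonempty_twistPairing (c : Bool) {X Y : SymBimodule ι hι} (h : ExactPairing X Y) :
    Nonempty (ExactPairing (twist c X) (twist c Y)) :=
by
  -- The two signs multiply to 1, so the tensor product keeps its symmetry and the same evaluation
  -- and coevaluation serve.
  have hs (X Y : SymBimodule ι hι) : (tensor (twist c X) (twist c Y)).sym = (tensor X Y).sym :=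
    tensor_ext fun m n => by
      change tmul (sgn k c • X.sym m) (sgn k c • Y.sym n) = tmul (X.sym m) (Y.sym n)
      rw [smul_tmul, tmul_smul, smul_smul, sgn_mul_sgn, one_smul]
  obtain ⟨η, ε, h1, h2⟩ := h
  let η' : regular k A ⟶ Bimodule.tensor X.bimod Y.bimod := η.1
  let ε' : Bimodule.tensor Y.bimod X.bimod ⟶ regular k A := ε.1
  have h1' : Y.bimod ◁ η' ≫ (α_ Y.bimod X.bimod Y.bimod).inv ≫ ε' ▷ Y.bimod =
      (ρ_ Y.bimod).hom ≫ (λ_ Y.bimod).inv := congrArg Subtype.val h1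
  have h2' : η' ▷ X.bimod ≫ (α_ X.bimod Y.bimod X.bimod).hom ≫ X.bimod ◁ ε' =
      (λ_ X.bimod).hom ≫ (ρ_ X.bimod).inv := congrArg Subtype.val h2
  have hη : ∀ m, toLin η' ((unit ι hι).sym m) = (tensor (twist c X) (twist c Y)).sym (toLin η' m) :=
    fun m => by rw [hs]; exact η.2 m
  have hε : ∀ m, toLin ε' ((tensor (twist c Y) (twist c X)).sym m) = (unit ι hι).sym (toLin ε' m) :=
    fun m => by rw [hs]; exact ε.2 m
  exact ⟨{
    coevaluation' := ofHom (X := unit ι hι) (Y := tensor (twist c X) (twist c Y)) η' hη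
    evaluation' := ofHom (X := tensor (twist c Y) (twist c X)) (Y := unit ι hι) ε' hε
    coevaluation_evaluation' := toHom_injective h1'
    evaluation_coevaluation' := toHom_injective h2' }⟩

theorem exists_rightDual_gen (hA : IsSelfInjective A) (t : Bool × Bool) :
    ∃ Y, Nonempty (ExactPairing (gen ι hι t) Y) := by
  obtain ⟨c, b⟩ := t
  cases b
  · exact ⟨_, nonempty_twistPairing c (nonempty_freePairing hA).some⟩
  · exact ⟨_, nonempty_twistPairing c (exactPairingUnit (C := SymBimodule ι hι))⟩

end SymBimodule

/-! ### Transport along the equivalence with the strictification -/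

namespace Strictification

open Limits MonoidalCategory

variable {C : Type u} [Category.{v} C] [MonoidalCategory C]

instance : (evalFunctor C).Full where
  map_surjective f := ⟨f, rfl⟩

instance : (evalFunctor C).EssSurj where
  mem_essImage X := ⟨⟨[X]⟩, ⟨ρ_ X⟩⟩

instance : (evalFunctor C).IsEquivalence where

instance evalFunctor_monoidal : (evalFunctor C).Monoidal :=
  Monoidal.fromInducedMonoidal (evalFunctor C) _

instance isIdempotentComplete [IsIdempotentComplete C] :
    IsIdempotentComplete (Strictification C) :=
  (Idempotents.isIdempotentComplete_iff_of_equivalence (evalFunctor C).asEquivalence).2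
    inferInstance

theorem exists_exactPairing (h : ∀ X : C, ∃ Y : C, Nonempty (ExactPairing X Y))
    (X : Strictification C) : ∃ Y : Strictification C, Nonempty (ExactPairing X Y) := by
  obtain ⟨Y, ⟨hY⟩⟩ := h ((evalFunctor C).obj X)
  -- The one-letter word `[Y]` evaluates to `Y ⊗ 𝟙_ C`, so the pairing is first moved along the
  -- right unitor.
  have : ExactPairing ((evalFunctor C).obj X) ((evalFunctor C).obj ⟨[Y]⟩) :=
    exactPairingCongrRight (ρ_ Y)
  exact ⟨⟨[Y]⟩, ⟨ExactPairing.ofFullyFaithful (evalFunctor C) X ⟨[Y]⟩⟩⟩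

variable [Preadditive C]

instance hasFiniteBiproducts [HasFiniteBiproducts C] :
    HasFiniteBiproducts (Strictification C) := by
  have : HasFiniteProducts (Strictification C) :=
    ⟨fun _ => Adjunction.hasLimitsOfShape_of_equivalence (evalFunctor C)⟩
  exact HasFiniteBiproducts.of_hasFiniteProducts

instance : (evalFunctor C).Additive where

instance monoidalPreadditive [MonoidalPreadditive C] : MonoidalPreadditive (Strictification C) :=
  monoidalPreadditive_of_faithful (evalFunctor C)

variable (k : Type w) [Field k] [Linear k C]

instance : (evalFunctor C).Linear k where

instance monoidalLinear [MonoidalPreadditive C] [MonoidalLinear k C] :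
    MonoidalLinear k (Strictification C) :=
  MonoidalLinear.ofFaithful k (evalFunctor C)

instance finite_hom [∀ X Y : C, Module.Finite k (X ⟶ Y)] (X Y : Strictification C) :
    Module.Finite k (X ⟶ Y) :=
  inferInstanceAs (Module.Finite k (eval X.word ⟶ eval Y.word))

omit k in
theorem exists_sum_generators {T : Type} (G : T → C)
    (hG : ∀ X : C, ∃ (J : Type) (_ : Fintype J) (t : J → T) (s : ∀ j, X ⟶ G (t j))
      (r : ∀ j, G (t j) ⟶ X), ∑ j, s j ≫ r j = 𝟙 X) (X : Strictification C) :
    ∃ (J : Type) (_ : Fintype J) (t : J → T) (s : ∀ j, X ⟶ ⟨[G (t j)]⟩)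
      (r : ∀ j, (⟨[G (t j)]⟩ : Strictification C) ⟶ X), ∑ j, s j ≫ r j = 𝟙 X := by
  obtain ⟨J, _, t, s, r, h⟩ := hG (eval X.word)
  let s' (j : J) : eval X.word ⟶ G (t j) ⊗ 𝟙_ C := s j ≫ (ρ_ (G (t j))).inv
  let r' (j : J) : G (t j) ⊗ 𝟙_ C ⟶ eval X.word := (ρ_ (G (t j))).hom ≫ r j
  refine ⟨J, inferInstance, t, s', r', ?_⟩
  have h' : ∑ j, s' j ≫ r' j = 𝟙 (eval X.word) := by
    simpa [s', r'] using h
  exact h'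

end Strictification

/-! ### Finitarity of the delooping and the main theorem -/

section SymTwoCategory

open Limits MonoidalCategory

/-- The delooping of a tensor category that satisfies the finiteness conditions. -/
theorem isFinitary_delooping (k : Type w) [Field k] {C : Type u} [Category.{v} C]
    [MonoidalCategory C] [Preadditive C] [Linear k C] [MonoidalPreadditive C] [MonoidalLinear k C]
    [HasFiniteBiproducts C] [IsIdempotentComplete C] [∀ X Y : C, Module.Finite k (X ⟶ Y)]
    (h : HasFinitelyManyIndecomposables (Strictification C)) :
    IsFinitary k (Delooping (Strictification C)) where
  finite_objects := Finite.of_injective (fun _ => ()) fun ⟨⟩ ⟨⟩ _ => rfl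
  additive _ _ := inferInstanceAs (HasFiniteBiproducts (Strictification C))
  idempotent_split _ _ := inferInstanceAs (IsIdempotentComplete (Strictification C))
  krullSchmidt _ _ := isKrullSchmidt_of_hasLocalDecomposition (C := Strictification C)
    (hasLocalDecomposition k)
  finite_indecomposables _ _ := h
  finite_hom _ _ F G := Strictification.finite_hom k F G
  -- Composition in the delooping reverses tensor factors, so left whiskering is tensoring on the
  -- right, and conversely.
  whiskerLeft_add F _ _ η θ :=
    MonoidalPreadditive.add_whiskerRight (C := Strictification C) (X := F) η θ
  whiskerLeft_smul F _ _ r η :=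
    MonoidalLinear.smul_whiskerRight (C := Strictification C) r η F
  add_whiskerRight η θ H :=
    MonoidalPreadditive.whiskerLeft_add (C := Strictification C) (X := H) η θ
  smul_whiskerRight r η H :=
    MonoidalLinear.whiskerLeft_smul (C := Strictification C) H r η
  strict := inferInstance

end SymTwoCategory

end

theorem proposition8p2 (k : Type u) [Field k] [IsAlgClosed k] (hchar : ringChar k ≠ 2)
    (A : Type v) [Ring A] [Algebra k A] [Module.Finite k A]
    (ι : A ≃ₐ[k] A) (hι : Function.Involutive ι) :
    IsFinitary k (SymTwoCategory ι hι) ∧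
      (IsConnectedRing A → HasIndecomposableIdentities (SymTwoCategory ι hι)) ∧
      (IsSelfInjective A → IsWeaklyFiat k (SymTwoCategory ι hι)) := by
  have hgen := SymBimodule.exists_sum_gen (ι := ι) (hι := hι) (Ring.two_ne_zero hchar)
  have hind : HasFinitelyManyIndecomposables (Strictification (SymBimodule ι hι)) :=
    hasFinitelyManyIndecomposables k (fun t => ⟨[SymBimodule.gen ι hι t]⟩)
      (Strictification.exists_sum_generators _ hgen)
  have hfin : IsFinitary k (SymTwoCategory ι hι) := isFinitary_delooping k hind
  refine ⟨hfin, fun hA _ => ?_, fun hA => ?_⟩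
  · have := hA.1
    -- The identity 1-morphism is the empty word, whose endomorphisms are by definition those of the
    -- unit symmetric bimodule.
    refine isIndecomposable_of_idempotents (C := Strictification (SymBimodule ι hι)) (X := ⟨[]⟩)
      (fun h => ?_) fun e he => SymBimodule.unit_idempotent hA e he
    refine SymBimodule.not_isZero_unit (ι := ι) (hι := hι) ((Limits.IsZero.iff_id_eq_zero _).2 ?_)
    exact (Limits.IsZero.iff_id_eq_zero (⟨[]⟩ : Strictification (SymBimodule ι hι))).1 h
  · have hr := Strictification.exists_exactPairing fun X : SymBimodule ι hι => by
      obtain ⟨J, _, t, s, r, h⟩ := hgen X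
      exact exists_exactPairing_of_generators
        (fun j => SymBimodule.exists_rightDual_gen hA (t j)) s r h
    have hl := exists_leftDual_of_rightDuals k hind hr
    -- As `F ≫ G` is `G ⊗ F`, the right dual of an object is its left adjoint as a 1-morphism. So
    -- right adjoints come from the left duals `hl`, and left adjoints from the right duals `hr`.
    refine hfin.isWeaklyFiat k (fun F => ?_) fun G => ?_
    · obtain ⟨X, ⟨h⟩⟩ := hl (show Strictification (SymBimodule ι hι) from F)
      exact ⟨X, ⟨exactPairingAdjunction (D := Strictification (SymBimodule ι hι)) h⟩⟩
    · obtain ⟨Y, ⟨h⟩⟩ := hr (show Strictification (SymBimodule ι hι) from G)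
      exact ⟨Y, ⟨exactPairingAdjunction (D := Strictification (SymBimodule ι hι)) h⟩⟩
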